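/- **Noncommutative Cardano formula.** Let $h\in\mathbb C$, $h\ne 0$, and let $I$ be a linearly ordered set with two distinct elements called $0$ and $1$. Let $H_I$ be the unital $\mathbb C$-algebra with generators $x_i,y_i$ $(i\in I)$ and relations $$x_iy_i=y_ix_i+hy_i^2,$$ $$x_jy_i=y_ix_j+hy_iy_j,\quad y_jx_i=x_iy_j-hy_iy_j,\quad y_jy_i=y_iy_j,\quad x_jx_i=x_ix_j-hx_iy_j+hy_ix_j+h^2y_iy_j\qquad(i<j).$$ For $S\subseteq I$ let $H_S\subseteq H_I$ be the subalgebra generated by $x_i,y_i$, $i\in S$. Let $E,F,H$ be the linear operators on $H_I$ (generators of $U_h(sl(2))$) which vanish on $1$ and satisfy $Ex_i=0$, $Ey_i=x_i$, $Fx_i=y_i$, $Fy_i=0$, $Hx_i=x_i$, $Hy_i=-y_i$ and $$F(ab)=F(a)b+aF(b),\quad E(ab)=E(a)\,e^{-hF}(b)+e^{hF}(a)\,E(b),\quad H(ab)=H(a)\,e^{-hF}(b)+e^{hF}(a)\,H(b).$$ An element is *invariant* if $E,F,H$ all kill it. Put $(ij)=x_iy_j-y_ix_j-hy_iy_j$.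 Let $\Delta_{kl}$ be the derivation of $H_I$ with $x_k\mapsto x_l$, $y_k\mapsto y_l$ that kills the other generators, and let $P_{kl}a=\frac1n\Delta_{kl}a$ for $a$ homogeneous of degree $n\geq 1$ in $x_k,y_k$. Write $x=x_0$, $y=y_0$. Let $f=x^3A+3x^2yB+3xy^2C+y^3D\neq0$ with $A,B,C,D\in H_{I\setminus\{0,1\}}$ be a cubic form, i.e. $f$ is invariant. Let $$\begin{aligned}\Delta={}&x^2(AC-B^2-2hAB+h^2A^2)+xy(AD-BC-hAC+2h^2AB-h^3A^2)\\&+y^2(BD-C^2-2hAD+3h^2B^2-3h^3AB+4h^4A^2),\end{aligned}$$ $$\begin{aligned}d_3={}&-A^2D^2+6ABCD-4AC^3-4B^3D+3B^2C^2+9h(-2AB^2D+ABC^2-A^2CD)\\&+h^2(-9B^4+40A^2BD-7A^2C^2+12AB^2C)+6h^3(-12A^3D-6A^2BC-11AB^3)\\&+2h^4(75A^2B^2+38A^3C)-384h^5A^3B+652h^6A^4,\end{aligned}$$ $$\begin{aligned}j={}&x^3(A^2D-3ABC+2B^3+9hAB^2-2h^2A^2B+6h^3A^3)\\ &+x^2y(3ABD-6AC^2+3B^2C-9hA^2D+12hABC-3hB^3-6h^2AB^2-12h^3A^2B+6h^4A^3)\\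 &+xy^2(-3ACD+6B^2D-3BC^2-6hABD+9hAC^2-3hB^2C+30h^2A^2D-12h^2ABC\\&\qquad+12h^2B^3-12h^3AB^2+60h^4A^2B-90h^5A^3)\\ &+y^3(-AD^2+3BCD-2C^3-15hB^2D+6hBC^2+36h^2ABD-8h^2AC^2+6h^2B^2C-102h^3A^2D\\&\qquad-18h^3ABC-42h^3B^3+38h^4A^2C+126h^4AB^2-378h^5A^2B+704h^6A^3).\end{aligned}$$ Put $\xi=P_{01}^2f$, $f_1=P_{01}^3f$, $\Delta_1=P_{01}^2\Delta$, $j_1=P_{01}^3j$, $\eta=(01)$, and $$\gamma=-x_1^2(B+2hA)-x_1y_1(2C+5hB)-y_1^2(D+3hC),\qquad \delta=x_1^2A+x_1y_1(2B-hA)+y_1^2(C-hB+h^2A).$$ (1) $\Delta$, $j$, $d_3$ are invariant and $4\Delta^3+j^2+d_3f^2=0$. (2) $f_1\ne0$ is an invariant element of $H_{I\setminus\{0\}}$; $\xi,\eta$ are invariant; $\xi=P_{10}f_1=x\delta-y\gamma-hy\delta$. (3) (Typical representation.) $f f_1^2=\xi^3+3\Delta_1\eta^2\xi-j_1\eta^3$.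 (4) $H_I$ has a right quotient division ring $Q_I$ (all elements are quotients $ab^{-1}$ with $a,b\in H_I$, $b\neq 0$). There is a skew field extension $R=Q_I[s,u_1,u_2]$ of $Q_I$, generated over $Q_I$ by elements $s,u_1,u_2$ which are central in $R$, such that $$s^2=-d_3,\quad u_1^3=\tfrac12(j_1+f_1s),\quad u_2^3=\tfrac12(j_1-f_1s),\quad u_1u_2=-\Delta_1,$$ i.e. $u_{1,2}=\sqrt[3]{\tfrac12(j_1\pm f_1\sqrt{-d_3})}$. The operators $E,F,H$ and the automorphism $e^{hF}$ extend to $R$ with the same Leibniz rules and such that $s,u_1,u_2$ are invariant (killed by $E,F,H$ and fixed by the extension of $e^{hF}$). (5) In every extension $R=Q_I[s,u_1,u_2]$ as in the first part of (4), put $\varepsilon=e^{2\pi i/3}$, $\sigma_i=\varepsilon^iu_1+\varepsilon^{2i}u_2$, $X_i=\gamma-\sigma_ix_1$, $Y_i=\delta-\sigma_iy_1$. Then $$f=f_1^{-2}\,(\xi-\sigma_0\eta)(\xi-\sigma_1\eta)(\xi-\sigma_2\eta),\qquad \xi-\sigma_i\eta=xY_i-yX_i-hyY_i ,$$ the factors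 $\xi-\sigma_i\eta$ are central in $R$ (in particular they commute) and are invariant under every extension of $E,F,H,e^{hF}$ to $R$ as in (4) for which $s,u_1,u_2$ are invariant. Moreover, $(X_i,Y_i)$ are homogeneous coordinates of the three zeros of $f$. Here a zero of $f$ in $R$ is a pair $(X,Y)\neq(0,0)$ in $R^2$ such that $x_0\mapsto X$, $y_0\mapsto Y$, $x_k\mapsto x_k$, $y_k\mapsto y_k$ $(k\ne0)$ defines an algebra homomorphism $H_I\to R$, and this homomorphism maps $f$ to $0$. Each $(X_i,Y_i)$ is a zero with $Y_i\neq0$, and every zero $(X,Y)$ satisfies $Y\neq0$ and $XY^{-1}+\frac h2=Z_i$ for some $i\in\{0,1,2\}$, where $$Z_i=X_iY_i^{-1}+\tfrac h2=\bigl(\gamma-\sigma_ix_1\bigr)\bigl(\delta-\sigma_iy_1\bigr)^{-1}+\tfrac h2 .$$ -/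

import Mathlib

universe u v w

namespace NCForms

/-! ## The algebra `H_I` of noncommutative homogeneous coordinates -/

/-- The free generators `x i`, `y i`, for `i ∈ I`. -/
inductive Gen (I : Type u) : Type u
  | x : I → Gen I
  | y : I → Gen I

/-- The free variable `x i`. -/
noncomputable abbrev fx {I : Type u} (i : I) : FreeAlgebra ℂ (Gen I) :=
  FreeAlgebra.ι ℂ (Gen.x i)
/-- The free variable `y i`. -/
noncomputable abbrev fy {I : Type u} (i : I) : FreeAlgebra ℂ (Gen I) :=
  FreeAlgebra.ι ℂ (Gen.y i)

section Algebra

variable (h : ℂ) (I : Type u) [LinearOrder I]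

/-- The defining relations of `H_I`. -/
inductive Rel : FreeAlgebra ℂ (Gen I) → FreeAlgebra ℂ (Gen I) → Prop
  | xy_self (i : I) : Rel (fx i * fy i) (fy i * fx i + h • (fy i * fy i))
  | xy (i j : I) (hij : i < j) : Rel (fx j * fy i) (fy i * fx j + h • (fy i * fy j))
  | yx (i j : I) (hij : i < j) : Rel (fy j * fx i) (fx i * fy j - h • (fy i * fy j))
  | yy (i j : I) (hij : i < j) : Rel (fy j * fy i) (fy i * fy j)
  | xx (i j : I) (hij : i < j) : Rel (fx j * fx i)
      (fx i * fx j - h • (fx i * fy j) + h • (fy i * fx j) + h ^ 2 • (fy i * fy j))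

/-- `H_I`: the complex unital algebra with generators `x i`, `y i` and the above relations. -/
def HAlg : Type u := RingQuot (Rel h I)

noncomputable instance : Ring (HAlg h I) := inferInstanceAs (Ring (RingQuot (Rel h I)))
noncomputable instance : Algebra ℂ (HAlg h I) :=
  inferInstanceAs (Algebra ℂ (RingQuot (Rel h I)))

end Algebra

section Basic

variable {h : ℂ} {I : Type u} [LinearOrder I]

/-- The class of a generator in `H_I`. -/
noncomputable def gen (g : Gen I) : HAlg h I :=
  RingQuot.mkAlgHom ℂ (Rel h I) (FreeAlgebra.ι ℂ g)

/-- The coordinate `x_i ∈ H_I`. -/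
noncomputable def x (i : I) : HAlg h I := gen (Gen.x i)
/-- The coordinate `y_i ∈ H_I`. -/
noncomputable def y (i : I) : HAlg h I := gen (Gen.y i)

theorem xy_self (i : I) : (x i * y i : HAlg h I) = y i * x i + h • (y i * y i) := by
  simpa using! RingQuot.mkAlgHom_rel ℂ (Rel.xy_self (h := h) i)

theorem xy_lt {i j : I} (hij : i < j) :
    (x j * y i : HAlg h I) = y i * x j + h • (y i * y j) := by
  simpa using! RingQuot.mkAlgHom_rel ℂ (Rel.xy (h := h) i j hij)

theorem yx_lt {i j : I} (hij : i < j) :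
    (y j * x i : HAlg h I) = x i * y j - h • (y i * y j) := by
  simpa using! RingQuot.mkAlgHom_rel ℂ (Rel.yx (h := h) i j hij)

theorem yy_lt {i j : I} (hij : i < j) : (y j * y i : HAlg h I) = y i * y j := by
  simpa using! RingQuot.mkAlgHom_rel ℂ (Rel.yy (h := h) i j hij)

theorem xx_lt {i j : I} (hij : i < j) : (x j * x i : HAlg h I) =
    x i * x j - h • (x i * y j) + h • (y i * x j) + h ^ 2 • (y i * y j) := by
  simpa using! RingQuot.mkAlgHom_rel ℂ (Rel.xx (h := h) i j hij)

theorem yy (i j : I) : (y i * y j : HAlg h I) = y j * y i := by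
  rcases lt_trichotomy i j with hij | rfl | hij
  · exact (yy_lt hij).symm
  · rfl
  · exact yy_lt hij

theorem xy (i j : I) : (x i * y j : HAlg h I) = y j * x i + h • (y i * y j) := by
  rcases lt_trichotomy i j with hij | rfl | hij
  · rw [yx_lt hij]; abel
  · exact xy_self i
  · rw [xy_lt hij, yy i j]

theorem xx (i j : I) : (x j * x i : HAlg h I) =
    x i * x j - h • (x i * y j) + h • (y i * x j) + h ^ 2 • (y i * y j) := by
  rcases lt_trichotomy i j with hij | rfl | hij
  · exact xx_lt hij
  · rw [xy i i]; module
  · rw [xx_lt hij, xy j i, xy i j, yy j i]; module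

/-- An algebra homomorphism out of `H_I` is given by images of the generators satisfying the
defining relations. -/
noncomputable def lift {R : Type v} [Ring R] [Algebra ℂ R] (a b : I → R)
    (hab : ∀ i j, a i * b j = b j * a i + h • (b i * b j))
    (hbb : ∀ i j, b i * b j = b j * b i)
    (haa : ∀ i j, i < j → a j * a i =
      a i * a j - h • (a i * b j) + h • (b i * a j) + h ^ 2 • (b i * b j)) :
    HAlg h I →ₐ[ℂ] R :=
  RingQuot.liftAlgHom ℂ ⟨FreeAlgebra.lift ℂ (fun g => match g with
    | Gen.x i => a i
    | Gen.y i => b i), by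
      intro p q hpq
      cases hpq with
      | xy_self i => simpa using hab i i
      | xy i j hij => simpa [hbb j i] using hab j i
      | yx i j hij => simp [hab i j]
      | yy i j hij => simpa using hbb j i
      | xx i j hij => simpa using haa i j hij⟩

section lift
variable {R : Type v} [Ring R] [Algebra ℂ R] (a b : I → R)
    (hab : ∀ i j, a i * b j = b j * a i + h • (b i * b j))
    (hbb : ∀ i j, b i * b j = b j * b i)
    (haa : ∀ i j, i < j → a j * a i =
      a i * a j - h • (a i * b j) + h • (b i * a j) + h ^ 2 • (b i * b j))

@[simp] theorem lift_x (i : I) : lift a b hab hbb haa (x i) = a i := by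
  unfold lift x gen
  erw [RingQuot.liftAlgHom_mkAlgHom_apply]
  simp

@[simp] theorem lift_y (i : I) : lift a b hab hbb haa (y i) = b i := by
  unfold lift y gen
  erw [RingQuot.liftAlgHom_mkAlgHom_apply]
  simp
end lift

/-- Induction principle: `H_I` is generated by the `x i`, `y i`. -/
theorem induction {P : HAlg h I → Prop} (hx : ∀ i, P (x i)) (hy : ∀ i, P (y i))
    (hc : ∀ c : ℂ, P (algebraMap ℂ _ c)) (hadd : ∀ a b, P a → P b → P (a + b))
    (hmul : ∀ a b, P a → P b → P (a * b)) (a : HAlg h I) : P a := by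
  obtain ⟨a, rfl⟩ := RingQuot.mkAlgHom_surjective ℂ (Rel h I) a
  induction a using FreeAlgebra.induction with
  | grade0 r => rw [AlgHom.commutes]; exact hc r
  | grade1 g =>
    cases g with
    | x i => exact hx i
    | y i => exact hy i
  | mul a b ha hb => rw [map_mul]; exact hmul _ _ ha hb
  | add a b ha hb => rw [map_add]; exact hadd _ _ ha hb

/-! ## The action of `U_h(sl(2))` on `H_I` -/

/-- `e^{tF}`. As `F` is a derivation with `F x_i = y_i`, `F y_i = 0`, this is the algebra
endomorphism with `x_i ↦ x_i + t y_i`, `y_i ↦ y_i`. -/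
noncomputable def expF (t : ℂ) : HAlg h I →ₐ[ℂ] HAlg h I :=
  lift (fun i => x i + t • y i) y
    (fun i j => by
      simp only [add_mul, mul_add, smul_mul_assoc, mul_smul_comm, xy i j, yy i j]; module)
    yy
    (fun i j hij => by
      simp only [add_mul, mul_add, smul_mul_assoc, mul_smul_comm, smul_add, smul_smul,
        xx_lt hij, xy j i, xy i j, yy j i]
      module)

@[simp] theorem expF_x (t : ℂ) (i : I) : expF t (x i : HAlg h I) = x i + t • y i := by
  simp [expF]
@[simp] theorem expF_y (t : ℂ) (i : I) : expF t (y i : HAlg h I) = y i := by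
  simp [expF]

open Matrix in
/-- The homomorphism `a ↦ !![S a, D a; 0, T a]`, where `S = e^{sF}`, `T = e^{tF}`, and `D` is the
`(S, T)`-derivation with `D x_i = p i` and `D y_i = q i`. -/
noncomputable def triHom (s t : ℂ) (p q : I → HAlg h I)
    (hpq : ∀ i j, (x i + s • y i) * q j + p i * y j =
      y j * p i + q j * (x i + t • y i) + h • (y i * q j + q i * y j))
    (hqq : ∀ i j, y i * q j + q i * y j = y j * q i + q j * y i)
    (hpp : ∀ i j, i < j → (x j + s • y j) * p i + p j * (x i + t • y i) =
      (x i + s • y i) * p j + p i * (x j + t • y j)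
      - h • ((x i + s • y i) * q j + p i * y j)
      + h • (y i * p j + q i * (x j + t • y j))
      + h ^ 2 • (y i * q j + q i * y j)) :
    HAlg h I →ₐ[ℂ] Matrix (Fin 2) (Fin 2) (HAlg h I) :=
  lift (fun i => !![expF s (x i), p i; 0, expF t (x i)])
    (fun i => !![expF s (y i), q i; 0, expF t (y i)])
    (fun i j => by
      have e (t : ℂ) := congrArg (expF t) (xy (h := h) i j)
      have e1 := e s
      have e2 := e t
      have e3 := hpq i j
      simp only [map_mul, map_add, map_smul, expF_x, expF_y] at e1 e2
      ext a b
      fin_cases a <;> fin_cases b <;> simp [e1, e2, e3])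
    (fun i j => by
      have e3 := hqq i j
      ext a b
      fin_cases a <;> fin_cases b <;> simp [yy i j, e3])
    (fun i j hij => by
      have e (t : ℂ) := congrArg (expF t) (xx (h := h) i j)
      have e1 := e s
      have e2 := e t
      have e3 := hpp i j hij
      simp only [map_mul, map_add, map_sub, map_smul, expF_x, expF_y] at e1 e2
      ext a b
      fin_cases a <;> fin_cases b <;> simp [e1, e2, e3])


theorem triHom_eq {s t : ℂ} {p q : I → HAlg h I} (hpq hqq hpp) (a : HAlg h I) :
    triHom s t p q hpq hqq hpp a 0 0 = expF s a ∧ triHom s t p q hpq hqq hpp a 1 0 = 0 ∧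
      triHom s t p q hpq hqq hpp a 1 1 = expF t a := by
  induction a using induction with
  | hx i => simp [triHom]
  | hy i => simp [triHom]
  | hc c => simp [Matrix.algebraMap_matrix_apply, AlgHomClass.commutes]
  | hadd a b ha hb => simp [ha, hb]
  | hmul a b ha hb => simp [Matrix.mul_apply, ha, hb]

theorem triHom_mul {s t : ℂ} {p q : I → HAlg h I} (hpq hqq hpp) (a b : HAlg h I) :
    triHom s t p q hpq hqq hpp (a * b) 0 1 =
      triHom s t p q hpq hqq hpp a 0 1 * expF t b
        + expF s a * triHom s t p q hpq hqq hpp b 0 1 := by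
  rw [map_mul, Matrix.mul_apply, Fin.sum_univ_two, (triHom_eq hpq hqq hpp a).1,
    (triHom_eq hpq hqq hpp b).2.2, add_comm]

theorem expF_zero (a : HAlg h I) : expF 0 a = a := by
  induction a using induction with
  | hx i => simp
  | hy i => simp
  | hc c => exact AlgHomClass.commutes _ c
  | hadd a b ha hb => rw [map_add, ha, hb]
  | hmul a b ha hb => rw [map_mul, ha, hb]

/-- The homomorphism defining `E`. -/
noncomputable def homE : HAlg h I →ₐ[ℂ] Matrix (Fin 2) (Fin 2) (HAlg h I) :=
  triHom h (-h) (fun _ => 0) x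
    (fun i j => by
      simp only [add_mul, mul_add, zero_mul, mul_zero, smul_mul_assoc, mul_smul_comm, xx i j,
        xy i j, xy j i, yy j i]
      module)
    (fun i j => by rw [xy i j, xy j i, yy i j]; abel)
    (fun i j hij => by
      simp only [mul_zero, zero_mul, add_mul, mul_add, smul_mul_assoc, mul_smul_comm, xy i j]
      module)

/-- The homomorphism defining `F`. -/
noncomputable def homF : HAlg h I →ₐ[ℂ] Matrix (Fin 2) (Fin 2) (HAlg h I) :=
  triHom 0 0 y (fun _ => 0)
    (fun i j => by simp [yy i j])
    (fun i j => by simp)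
    (fun i j hij => by
      simp only [zero_smul, add_zero, mul_zero, zero_mul, xy i j, xy j i, yy j i]
      module)

/-- The homomorphism defining the action of the generator `H`. -/
noncomputable def homH : HAlg h I →ₐ[ℂ] Matrix (Fin 2) (Fin 2) (HAlg h I) :=
  triHom h (-h) x (fun i => -y i)
    (fun i j => by
      simp only [add_mul, mul_add, mul_neg, neg_mul, smul_mul_assoc, mul_smul_comm,
        xy i j, yy j i]
      module)
    (fun i j => by simp [yy i j])
    (fun i j hij => by
      simp only [add_mul, mul_add, mul_neg, neg_mul, smul_mul_assoc, mul_smul_comm,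
        xx i j, xy i j, xy j i, yy j i]
      module)

/-- The homomorphism defining the polarization derivation `Δ_{kl}`. -/
noncomputable def homPol (k l : I) : HAlg h I →ₐ[ℂ] Matrix (Fin 2) (Fin 2) (HAlg h I) :=
  triHom 0 0 (fun i => if i = k then x l else 0) (fun i => if i = k then y l else 0)
    (fun i j => by
      by_cases hi : i = k <;> by_cases hj : j = k <;>
      simp only [hi, hj, if_true, if_false, zero_smul, add_zero, zero_add, mul_zero, zero_mul,
        xy l k, xy k l, xy i l, xy l j, yy l k, yy l j, smul_zero]
      module)
    (fun i j => by
      by_cases hi : i = k <;> by_cases hj : j = k <;>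
      simp only [hi, hj, if_true, if_false, add_zero, zero_add, mul_zero, zero_mul,
        yy l k, yy l j, yy l i]
      try abel)
    (fun i j hij => by
      by_cases hi : i = k <;> by_cases hj : j = k <;>
      simp only [hi, hj, if_true, if_false, zero_smul, add_zero, zero_add, mul_zero, zero_mul,
        smul_zero, sub_zero]
      · exact absurd (hi.trans hj.symm) hij.ne
      · rw [xx l j]
      · rw [xx i l])

/-- The operator `F` on `H_I`. -/
noncomputable def actF : HAlg h I →ₗ[ℂ] HAlg h I :=
  Matrix.entryLinearMap ℂ (HAlg h I) 0 1 ∘ₗ homF.toLinearMap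
/-- The operator `E` on `H_I`. -/
noncomputable def actE : HAlg h I →ₗ[ℂ] HAlg h I :=
  Matrix.entryLinearMap ℂ (HAlg h I) 0 1 ∘ₗ homE.toLinearMap
/-- The operator `H` on `H_I`. -/
noncomputable def actH : HAlg h I →ₗ[ℂ] HAlg h I :=
  Matrix.entryLinearMap ℂ (HAlg h I) 0 1 ∘ₗ homH.toLinearMap
/-- The polarization derivation `Δ_{kl}` of `H_I`. -/
noncomputable def polDer (k l : I) : HAlg h I →ₗ[ℂ] HAlg h I :=
  Matrix.entryLinearMap ℂ (HAlg h I) 0 1 ∘ₗ (homPol k l).toLinearMap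

/-! The operators have the prescribed values on `1`, `x i`, `y i` and satisfy the prescribed
Leibniz rules; this determines them. -/

theorem actF_one : actF (1 : HAlg h I) = 0 := by simp [actF]
theorem actE_one : actE (1 : HAlg h I) = 0 := by simp [actE]
theorem actH_one : actH (1 : HAlg h I) = 0 := by simp [actH]
theorem actF_x (i : I) : actF (x i : HAlg h I) = y i := by simp [actF, homF, triHom]
theorem actF_y (i : I) : actF (y i : HAlg h I) = 0 := by simp [actF, homF, triHom]
theorem actE_x (i : I) : actE (x i : HAlg h I) = 0 := by simp [actE, homE, triHom]
theorem actE_y (i : I) : actE (y i : HAlg h I) = x i := by simp [actE, homE, triHom]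
theorem actH_x (i : I) : actH (x i : HAlg h I) = x i := by simp [actH, homH, triHom]
theorem actH_y (i : I) : actH (y i : HAlg h I) = -y i := by simp [actH, homH, triHom]
theorem polDer_x (k l i : I) :
    polDer k l (x i : HAlg h I) = if i = k then x l else 0 := by simp [polDer, homPol, triHom]
theorem polDer_y (k l i : I) :
    polDer k l (y i : HAlg h I) = if i = k then y l else 0 := by simp [polDer, homPol, triHom]

theorem actF_mul (a b : HAlg h I) : actF (a * b) = actF a * b + a * actF b := by
  refine (triHom_mul _ _ _ a b).trans ?_
  rw [expF_zero, expF_zero]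
  rfl
theorem actE_mul (a b : HAlg h I) :
    actE (a * b) = actE a * expF (-h) b + expF h a * actE b := triHom_mul _ _ _ a b
theorem actH_mul (a b : HAlg h I) :
    actH (a * b) = actH a * expF (-h) b + expF h a * actH b := triHom_mul _ _ _ a b
theorem polDer_mul (k l : I) (a b : HAlg h I) :
    polDer k l (a * b) = polDer k l a * b + a * polDer k l b := by
  refine (triHom_mul _ _ _ a b).trans ?_
  rw [expF_zero, expF_zero]
  rfl

/-- `a ∈ H_I` is an invariant element. -/
def IsInvariant (a : HAlg h I) : Prop := actE a = 0 ∧ actF a = 0 ∧ actH a = 0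

/-- The bracket symbol `(ij)`. -/
noncomputable def bracket (i j : I) : HAlg h I := x i * y j - y i * x j - h • (y i * y j)

/-- The polarization operator `P_{kl} = (1/n) Δ_{kl}` on elements which are homogeneous of
degree `n` with respect to the index `k`. -/
noncomputable def polar (n : ℕ) (k l : I) (a : HAlg h I) : HAlg h I :=
  (1 / (n : ℂ)) • polDer k l a

variable (h) in
/-- The subalgebra `H_S ⊆ H_I` generated by `x i`, `y i` with `i ∈ S`. -/
noncomputable def sub (S : Set I) : Subalgebra ℂ (HAlg h I) := Algebra.adjoin ℂ (x '' S ∪ y '' S)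

/-! ## Cubic forms and their covariants -/

variable (h) in
/-- A cubic form `f = x³A + 3x²yB + 3xy²C + y³D` in the variables `x = x_o`, `y = y_o`, with
coefficients which involve neither the index `o` (written `0` in text) nor `p` (written `1`). -/
structure CubicForm (o p : I) where
  A : HAlg h I
  B : HAlg h I
  C : HAlg h I
  D : HAlg h I
  A_mem : A ∈ sub h {o, p}ᶜ
  B_mem : B ∈ sub h {o, p}ᶜ
  C_mem : C ∈ sub h {o, p}ᶜ
  D_mem : D ∈ sub h {o, p}ᶜ
  ne_zero : x o ^ 3 * A + 3 * x o ^ 2 * y o * B + 3 * x o * y o ^ 2 * C + y o ^ 3 * D ≠ 0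
  invariant : IsInvariant
    (x o ^ 3 * A + 3 * x o ^ 2 * y o * B + 3 * x o * y o ^ 2 * C + y o ^ 3 * D)

namespace CubicForm

variable {o p : I} (f : CubicForm h o p)

/-- The form itself, as an element of `H_I`. -/
noncomputable def form : HAlg h I :=
  x o ^ 3 * f.A + 3 * x o ^ 2 * y o * f.B + 3 * x o * y o ^ 2 * f.C + y o ^ 3 * f.D

/-- The Hessian covariant `Δ`. -/
noncomputable def hessian : HAlg h I :=
  x o ^ 2 * (f.A * f.C - f.B ^ 2 - (2 * h) • (f.A * f.B) + h ^ 2 • f.A ^ 2)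
  + x o * y o * (f.A * f.D - f.B * f.C - h • (f.A * f.C) + (2 * h ^ 2) • (f.A * f.B)
      - h ^ 3 • f.A ^ 2)
  + y o ^ 2 * (f.B * f.D - f.C ^ 2 - (2 * h) • (f.A * f.D) + (3 * h ^ 2) • f.B ^ 2
      - (3 * h ^ 3) • (f.A * f.B) + (4 * h ^ 4) • f.A ^ 2)

/-- The discriminant `d₃`. -/
noncomputable def disc : HAlg h I :=
  -(f.A ^ 2 * f.D ^ 2) + 6 * (f.A * f.B * f.C * f.D) - 4 * (f.A * f.C ^ 3)
    - 4 * (f.B ^ 3 * f.D) + 3 * (f.B ^ 2 * f.C ^ 2)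
  + (9 * h) • (-2 * (f.A * f.B ^ 2 * f.D) + f.A * f.B * f.C ^ 2 - f.A ^ 2 * f.C * f.D)
  + h ^ 2 • (-9 * f.B ^ 4 + 40 * (f.A ^ 2 * f.B * f.D) - 7 * (f.A ^ 2 * f.C ^ 2)
      + 12 * (f.A * f.B ^ 2 * f.C))
  + (6 * h ^ 3) • (-12 * (f.A ^ 3 * f.D) - 6 * (f.A ^ 2 * f.B * f.C) - 11 * (f.A * f.B ^ 3))
  + (2 * h ^ 4) • (75 * (f.A ^ 2 * f.B ^ 2) + 38 * (f.A ^ 3 * f.C))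
  - (384 * h ^ 5) • (f.A ^ 3 * f.B) + (652 * h ^ 6) • f.A ^ 4

/-- The cubic covariant `j`. -/
noncomputable def cubicCov : HAlg h I :=
  x o ^ 3 * (f.A ^ 2 * f.D - 3 * (f.A * f.B * f.C) + 2 * f.B ^ 3 + (9 * h) • (f.A * f.B ^ 2)
      - (2 * h ^ 2) • (f.A ^ 2 * f.B) + (6 * h ^ 3) • f.A ^ 3)
  + x o ^ 2 * y o * (3 * (f.A * f.B * f.D) - 6 * (f.A * f.C ^ 2) + 3 * (f.B ^ 2 * f.C)
      - (9 * h) • (f.A ^ 2 * f.D) + (12 * h) • (f.A * f.B * f.C) - (3 * h) • f.B ^ 3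
      - (6 * h ^ 2) • (f.A * f.B ^ 2) - (12 * h ^ 3) • (f.A ^ 2 * f.B) + (6 * h ^ 4) • f.A ^ 3)
  + x o * y o ^ 2 * (-3 * (f.A * f.C * f.D) + 6 * (f.B ^ 2 * f.D) - 3 * (f.B * f.C ^ 2)
      - (6 * h) • (f.A * f.B * f.D) + (9 * h) • (f.A * f.C ^ 2) - (3 * h) • (f.B ^ 2 * f.C)
      + (30 * h ^ 2) • (f.A ^ 2 * f.D) - (12 * h ^ 2) • (f.A * f.B * f.C)
      + (12 * h ^ 2) • f.B ^ 3 - (12 * h ^ 3) • (f.A * f.B ^ 2)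
      + (60 * h ^ 4) • (f.A ^ 2 * f.B) - (90 * h ^ 5) • f.A ^ 3)
  + y o ^ 3 * (-(f.A * f.D ^ 2) + 3 * (f.B * f.C * f.D) - 2 * f.C ^ 3
      - (15 * h) • (f.B ^ 2 * f.D) + (6 * h) • (f.B * f.C ^ 2)
      + (36 * h ^ 2) • (f.A * f.B * f.D) - (8 * h ^ 2) • (f.A * f.C ^ 2)
      + (6 * h ^ 2) • (f.B ^ 2 * f.C) - (102 * h ^ 3) • (f.A ^ 2 * f.D)
      - (18 * h ^ 3) • (f.A * f.B * f.C) - (42 * h ^ 3) • f.B ^ 3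
      + (38 * h ^ 4) • (f.A ^ 2 * f.C) + (126 * h ^ 4) • (f.A * f.B ^ 2)
      - (378 * h ^ 5) • (f.A ^ 2 * f.B) + (704 * h ^ 6) • f.A ^ 3)

/-- `ξ = P_{op}² f`. -/
noncomputable def xi : HAlg h I := polar 2 o p (polar 3 o p f.form)
/-- `f₁ = P_{op}³ f`. -/
noncomputable def f₁ : HAlg h I := polar 1 o p f.xi
/-- `Δ₁ = P_{op}² Δ`. -/
noncomputable def hessian₁ : HAlg h I := polar 1 o p (polar 2 o p f.hessian)
/-- `j₁ = P_{op}³ j`. -/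
noncomputable def cubicCov₁ : HAlg h I := polar 1 o p (polar 2 o p (polar 3 o p f.cubicCov))

/-- `η = (op)`. -/
noncomputable def eta (_f : CubicForm h o p) : HAlg h I := bracket o p

/-- `γ`, where `ξ = xδ - yγ - hyδ`. -/
noncomputable def gamma : HAlg h I :=
  -(x p ^ 2 * (f.B + (2 * h) • f.A)) - x p * y p * (2 * f.C + (5 * h) • f.B)
    - y p ^ 2 * (f.D + (3 * h) • f.C)
/-- `δ`, where `ξ = xδ - yγ - hyδ`. -/
noncomputable def delta : HAlg h I :=
  x p ^ 2 * f.A + x p * y p * (2 * f.B - h • f.A)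
    + y p ^ 2 * (f.C - h • f.B + h ^ 2 • f.A)

end CubicForm

/-! ## The skew field `Q_I`, its central extensions, and zeros -/

/-- `ι : H_I → Q` exhibits the division ring `Q` as the right quotient division ring of `H_I`:
`ι` is injective and every element of `Q` is a right quotient. (Such a `Q` is unique up to a unique
isomorphism.) -/
structure IsQuotientDivisionRing {Q : Type v} [DivisionRing Q] [Algebra ℂ Q]
    (ι : HAlg h I →ₐ[ℂ] Q) : Prop where
  injective : Function.Injective ι
  exists_quotient : ∀ q : Q, ∃ a b : HAlg h I, b ≠ 0 ∧ q = ι a * (ι b)⁻¹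

/-- An extension of the action of `E, F, H` (and of the automorphism `T = e^{hF}`) from `H_I` to a
division ring `R` over `H_I`, with the same Leibniz rules. -/
structure ExtendedAction {R : Type v} [DivisionRing R] [Algebra ℂ R]
    (φ : HAlg h I →ₐ[ℂ] R) where
  E : R →ₗ[ℂ] R
  F : R →ₗ[ℂ] R
  H : R →ₗ[ℂ] R
  T : R ≃ₐ[ℂ] R
  E_coe : ∀ a, E (φ a) = φ (actE a)
  F_coe : ∀ a, F (φ a) = φ (actF a)
  H_coe : ∀ a, H (φ a) = φ (actH a)
  T_coe : ∀ a, T (φ a) = φ (expF h a)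
  E_mul : ∀ a b, E (a * b) = E a * T.symm b + T a * E b
  F_mul : ∀ a b, F (a * b) = F a * b + a * F b
  H_mul : ∀ a b, H (a * b) = H a * T.symm b + T a * H b

/-- Invariant elements with respect to an extended action. -/
def ExtendedAction.IsInvariant {R : Type v} [DivisionRing R] [Algebra ℂ R]
    {φ : HAlg h I →ₐ[ℂ] R} (act : ExtendedAction φ) (r : R) : Prop :=
  act.E r = 0 ∧ act.F r = 0 ∧ act.H r = 0 ∧ act.T r = r

/-- `R = Q_I[s, u₁, u₂]` is the central skew field extension of `Q_I` by
`s = √(-d₃)` and `u₁, u₂ = ∛(½ (j₁ ± f₁ √(-d₃)))`, with the cube roots matched by `u₁u₂ = -Δ₁`. -/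
structure IsCardanoExtension {o p : I} (f : CubicForm h o p)
    {Q : Type v} [DivisionRing Q] [Algebra ℂ Q] (ι : HAlg h I →ₐ[ℂ] Q)
    {R : Type w} [DivisionRing R] [Algebra ℂ R] (κ : Q →ₐ[ℂ] R) (s u₁ u₂ : R) : Prop where
  s_central : s ∈ Subalgebra.center ℂ R
  u₁_central : u₁ ∈ Subalgebra.center ℂ R
  u₂_central : u₂ ∈ Subalgebra.center ℂ R
  generate : Algebra.adjoin ℂ (Set.range κ ∪ {s, u₁, u₂}) = ⊤
  s_sq : s ^ 2 = -κ (ι f.disc)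
  u₁_cube : u₁ ^ 3 = (1 / 2 : ℂ) • (κ (ι f.cubicCov₁) + κ (ι f.f₁) * s)
  u₂_cube : u₂ ^ 3 = (1 / 2 : ℂ) • (κ (ι f.cubicCov₁) - κ (ι f.f₁) * s)
  u₁_mul_u₂ : u₁ * u₂ = -κ (ι f.hessian₁)

/-- `ε = e^{2πi/3}`. -/
noncomputable def eps : ℂ := Complex.exp (2 * Real.pi * Complex.I / 3)

/-- `σ_i = ε^i u₁ + ε^{2i} u₂`. -/
noncomputable def sigma {R : Type v} [DivisionRing R] [Algebra ℂ R] (u₁ u₂ : R) (i : ℕ) : R :=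
  eps ^ i • u₁ + eps ^ (2 * i) • u₂

/-- `(X, Y) ≠ (0, 0)` are homogeneous coordinates in `R` of a zero of the form `f` (in the variables
`x_o, y_o`): the substitution `x_o ↦ X`, `y_o ↦ Y`, leaving the other `x_i, y_i` unchanged, is
compatible with the relations of `H_I`, and the resulting homomorphism kills `f`. -/
def IsZero {R : Type v} [DivisionRing R] [Algebra ℂ R] (φ : HAlg h I →ₐ[ℂ] R) (o : I)
    (f : HAlg h I) (X Y : R) : Prop :=
  (X ≠ 0 ∨ Y ≠ 0) ∧ ∃ G : HAlg h I →ₐ[ℂ] R, G (x o) = X ∧ G (y o) = Y ∧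
    (∀ i, i ≠ o → G (x i) = φ (x i) ∧ G (y i) = φ (y i)) ∧ G f = 0

end Basic

end NCForms

section
open Polynomial
set_option linter.unusedSectionVars false
set_option linter.unusedSimpArgs false

namespace NCForms

/-! ## Skew Laurent polynomials over the shift automorphism -/

section Shift

variable {L : Type u} [Field L]

/-! The algebra `H_I` is modelled inside skew Laurent polynomials `∑ p_n(T) y^n` over `L[T]`, where
`y p(T) = p(T - h) y` and `L` is a field with parameters `v_i`, `r_i`. The assignment `x_i ↦ v_i y T
+ r_i y⁻¹`, `y_i ↦ v_i y` (`psi`) respects the relations for all values of the parameters. For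
independent parameters it is injective (`gpsi_injective`): monomials with the `y_i` in front span
`H_I`, and the image of such a monomial at `T = 0`, `y = 1` has its own parameter monomial as the
term of top degree in the `r_i`.

In this model `F` is `d/dT`, and `a ↦ y⁻¹ a y` is `e^{hF}`. The maps `a ↦ y H(a) y` and `a ↦ y E(a)
y` become ordinary derivations: a commutator with an element of degree 2 in `y`, plus, for `E`, the
derivation `d` of `L` with `v_i ↦ r_i ↦ 0`. Hence invariant elements are those which map to scalars
`l ∈ L` with `d l = 0` (`IsInvariant.exists_psi_eq`, `IsInvariant.der_eq_zero`,
`isInvariant_of_gpsi`); in particular they are central and fixed by `e^{hF}`.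

The coefficients of a cubic form do not involve the index `o`, so the parameters at `o` can be
varied while the coefficients stay fixed. All the resulting values of the form are scalars, and this
forces the coefficients into an explicit shape with four scalars `α, β, γ, δ` (`exists_coeff`). The
form becomes the classical binary cubic `α r³ + 3β r² v + 3γ r v² + δ v³`. The correction terms in
`h` turn the Hessian, the discriminant and `j` into their classical counterparts, and `d` acts on
`α, β, γ, δ` classically (`CubicForm.Real.coeffDer`). Invariance, the syzygy and the typical
representation are then polynomial identities in a field.

Polynomial growth gives the Ore conditions (`PolyGrowth.left_ore`, `PolyGrowth.right_ore`), hence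
the quotient division ring. Over a Cardano extension the right side of the typical representation is
the resolvent cubic, which splits (`prod_sub_sigma`). The pair `(γ, δ)` is realised in the same form
as a pair of generators, so `(X_i, Y_i)`, a combination of two such pairs with a central
coefficient, may be substituted for `(x, y)`; it annihilates one factor
(`IsCardanoExtension.isZero`). Conversely, at any zero one of the factors vanishes, and this linear
equation determines `X Y⁻¹` (`IsCardanoExtension.zero_classification`).

For existence, `L` is taken algebraically closed. The radicals lie in `L`, so they are central in
the fractions of the skew Laurent ring, and `d` kills them because it kills their powers. The
subalgebra which they generate over `Q_I` is a division ring stable under the action. -/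

/-- The infinite cyclic group generated by the shift `X ↦ X - h` of `L[X]`. -/
def ShiftGroup (_h : L) : Type := Multiplicative ℤ

instance (h : L) : CommGroup (ShiftGroup h) := inferInstanceAs (CommGroup (Multiplicative ℤ))

/-- The `n`-th power of the shift. -/
def ShiftGroup.of (h : L) (n : ℤ) : ShiftGroup h := (Multiplicative.ofAdd n : Multiplicative ℤ)

/-- The exponent of a power of the shift. -/
def ShiftGroup.exp {h : L} (g : ShiftGroup h) : ℤ := Multiplicative.toAdd (α := ℤ) g

theorem ShiftGroup.of_inj {h : L} {m n : ℤ} : ShiftGroup.of h m = ShiftGroup.of h n ↔ m = n :=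
  Multiplicative.ofAdd.injective.eq_iff

/-- This action encodes the rule `y p(T) = p(T - h) y`. The group carries `h` in its type so that
the action can depend on it. -/
noncomputable instance (h : L) : MulSemiringAction (ShiftGroup h) L[X] where
  smul g p := taylorAlgHom (-((g.exp : L) * h)) p
  one_smul p := by
    change taylorAlgHom (-(((0 : ℤ) : L) * h)) p = p
    simp
  mul_smul a b p := by
    change taylorAlgHom (-(((a.exp + b.exp : ℤ) : L) * h)) p = taylorAlgHom _ (taylorAlgHom _ p)
    simp only [taylorAlgHom_apply, taylor_taylor]
    rw [show -(((a.exp + b.exp : ℤ) : L) * h) = -((b.exp : L) * h) + -((a.exp : L) * h) by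
      push_cast; ring]
    first | rfl | rw [add_comm]
  smul_zero a := map_zero (taylorAlgHom _)
  smul_add a := map_add (taylorAlgHom _)
  smul_one a := map_one (taylorAlgHom _)
  smul_mul a := map_mul (taylorAlgHom _)

instance (h : L) : SMulCommClass (ShiftGroup h) L L[X] where
  smul_comm g c p := map_smul (taylorAlgHom (-((g.exp : L) * h))) c p

instance (h : L) [Algebra ℂ L] : SMulCommClass (ShiftGroup h) ℂ L[X] where
  smul_comm g c p := by
    rw [← algebraMap_smul L c p, smul_comm, algebraMap_smul]

/-- Skew Laurent polynomials `∑ p_n(T) y^n` over `L` with `y p(T) = p(T - h) y`. -/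
abbrev ShiftAlg (h : L) : Type u := SkewMonoidAlgebra L[X] (ShiftGroup h)

variable {h : L}

/-- The monomial `p(T) y^n`. -/
noncomputable def mono (h : L) (n : ℤ) (p : L[X]) : ShiftAlg h :=
  SkewMonoidAlgebra.single (ShiftGroup.of h n) p

/-- The shift `p(T) ↦ p(T - n h)`. -/
noncomputable def shift (h : L) (n : ℤ) : L[X] →ₐ[L] L[X] := taylorAlgHom (-((n : L) * h))

@[simp] theorem shift_X (n : ℤ) : shift h n X = X - C ((n : L) * h) := by
  simp [shift, sub_eq_add_neg]

@[simp] theorem shift_C (n : ℤ) (l : L) : shift h n (C l) = C l := by simp [shift]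

theorem shift_injective (n : ℤ) : Function.Injective (shift h n) := taylor_injective _

theorem mono_mul_mono (m n : ℤ) (p q : L[X]) :
    mono h m p * mono h n q = mono h (m + n) (p * shift h m q) :=
  SkewMonoidAlgebra.single_mul_single

theorem mono_zero_one : mono h 0 1 = 1 := rfl

theorem mono_add (n : ℤ) (p q : L[X]) : mono h n (p + q) = mono h n p + mono h n q :=
  SkewMonoidAlgebra.single_add _ _ _

theorem mono_sub (n : ℤ) (p q : L[X]) : mono h n (p - q) = mono h n p - mono h n q := by
  rw [eq_sub_iff_add_eq, ← mono_add, sub_add_cancel]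

theorem mono_zero (n : ℤ) : mono h n 0 = 0 := SkewMonoidAlgebra.single_zero _

theorem smul_mono (l : L) (n : ℤ) (p : L[X]) : l • mono h n p = mono h n (C l * p) := by
  rw [← smul_eq_C_mul]; exact SkewMonoidAlgebra.smul_single _ _ _

theorem algebraMap_eq_mono (l : L) : algebraMap L (ShiftAlg h) l = mono h 0 (C l) := rfl

@[elab_as_elim]
theorem ShiftAlg.induction {P : ShiftAlg h → Prop} (s : ShiftAlg h)
    (hm : ∀ n p, P (mono h n p)) (hadd : ∀ a b, P a → P b → P (a + b)) : P s :=
  SkewMonoidAlgebra.induction_on' s (fun n p => hm n p) (fun a b => hadd a b)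

/-- The coefficient of `y^n`. -/
noncomputable def cf (n : ℤ) : ShiftAlg h →ₗ[L] L[X] where
  toFun s := s.coeff (ShiftGroup.of h n)
  map_add' s t := by simp
  map_smul' l s := by simp

theorem cf_mono (n m : ℤ) (p : L[X]) : cf n (mono h m p) = if m = n then p else 0 := by
  classical
  change (SkewMonoidAlgebra.single (ShiftGroup.of h m) p).coeff (ShiftGroup.of h n) = _
  rw [SkewMonoidAlgebra.coeff_single_apply]
  simp only [ShiftGroup.of_inj]

theorem ShiftAlg.ext {s t : ShiftAlg h} (H : ∀ n, cf n s = cf n t) : s = t :=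
  SkewMonoidAlgebra.ext (fun n => H n)

theorem exists_cf_eq_zero (s : ShiftAlg h) : ∃ N : ℕ, ∀ n : ℤ, (N : ℤ) < |n| → cf n s = 0 := by
  induction s using ShiftAlg.induction with
  | hm m p =>
    refine ⟨m.natAbs, fun n hn => ?_⟩
    rw [cf_mono, if_neg]
    rintro rfl
    simp at hn
  | hadd a b ha hb =>
    obtain ⟨N, hN⟩ := ha
    obtain ⟨M, hM⟩ := hb
    refine ⟨max N M, fun n hn => ?_⟩
    rw [map_add, hN n, hM n, add_zero] <;> push_cast at hn <;> grind

theorem cf_mono_mul (n m : ℤ) (p : L[X]) (s : ShiftAlg h) :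
    cf n (mono h m p * s) = p * shift h m (cf (n - m) s) := by
  induction s using ShiftAlg.induction with
  | hm k q =>
    rw [mono_mul_mono, cf_mono, cf_mono]
    by_cases hk : m + k = n
    · rw [if_pos hk, if_pos (by omega)]
    · rw [if_neg hk, if_neg (by omega), map_zero, mul_zero]
  | hadd a b ha hb => rw [mul_add, map_add, ha, hb, map_add, map_add, mul_add]

theorem cf_mul_mono (n m : ℤ) (p : L[X]) (s : ShiftAlg h) :
    cf n (s * mono h m p) = cf (n - m) s * shift h (n - m) p := by
  induction s using ShiftAlg.induction with
  | hm k q =>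
    rw [mono_mul_mono, cf_mono, cf_mono]
    by_cases hk : k + m = n
    · obtain rfl : k = n - m := by omega
      simp
    · rw [if_neg hk, if_neg (by omega), zero_mul]
  | hadd a b ha hb => rw [add_mul, map_add, ha, hb, map_add, add_mul]

/-- The leading coefficient of a product. -/
theorem cf_mul_of_top {a b : ShiftAlg h} {m n : ℤ} (ha : ∀ k, m < k → cf k a = 0)
    (hb : ∀ k, n < k → cf k b = 0) : cf (m + n) (a * b) = cf m a * shift h m (cf n b) := by
  let F : ShiftAlg h → L[X] := fun c => cf m c * shift h m (cf n b)
  have key : ∀ c : ShiftAlg h, (∀ k, m < k → cf k c = 0) →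
      cf (m + n) (c * b) = cf m c * shift h m (cf n b) := by
    intro c hc
    have e : c = c.sum fun g p => mono h g.exp p :=
      (SkewMonoidAlgebra.sum_single c).symm
    have e1 : ∀ k : ℤ, cf k (c * b) = c.sum fun g p =>
        p * shift h g.exp
          (cf (k - g.exp) b) := by
      intro k
      conv_lhs => rw [e]
      rw [SkewMonoidAlgebra.sum_def', Finset.sum_mul, map_sum, SkewMonoidAlgebra.sum_def']
      exact Finset.sum_congr rfl fun g _ => cf_mono_mul _ _ _ _
    -- Only the exponent `m` contributes: a smaller one meets a coefficient of `b` above `n`, and a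
    -- larger one does not occur in `c`.
    rw [e1, SkewMonoidAlgebra.sum_def', Finset.sum_eq_single (ShiftGroup.of h m)]
    · rw [show (m + n - (ShiftGroup.of h m).exp : ℤ) = n from add_sub_cancel_left m n]
      rfl
    · intro g hg hgm
      rcases lt_trichotomy g.exp m with hlt | heq | hgt
      · rw [hb _ (by omega), map_zero, mul_zero]
      · exact absurd heq hgm
      · have : c.coeff g = 0 := hc _ hgt
        rw [this, zero_mul]
    · intro hm
      rw [SkewMonoidAlgebra.notMem_support_iff.mp hm, zero_mul]
  exact key a ha

theorem exists_top {a : ShiftAlg h} (ha : a ≠ 0) :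
    ∃ m : ℤ, cf m a ≠ 0 ∧ ∀ k, m < k → cf k a = 0 := by
  obtain ⟨N, hN⟩ := exists_cf_eq_zero a
  have hne : ∃ n, cf n a ≠ 0 := by
    by_contra! H
    exact ha (ShiftAlg.ext fun n => by rw [H n, map_zero])
  have hbd : ∀ z, cf z a ≠ 0 → z ≤ N := by
    intro z hz
    by_contra! H
    exact hz (hN z (lt_of_lt_of_le H (le_abs_self z)))
  obtain ⟨m, hm, hmax⟩ := Int.exists_greatest_of_bdd ⟨N, hbd⟩ hne
  refine ⟨m, hm, fun k hk => ?_⟩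
  by_contra H
  exact absurd (hmax k H) (not_le.mpr hk)

/-- Leading coefficients in `y` multiply up to a shift, which is injective on the domain `L[X]`. -/
instance : NoZeroDivisors (ShiftAlg h) where
  eq_zero_or_eq_zero_of_mul_eq_zero {a b} hab := by
    by_contra! H
    obtain ⟨m, hm, hm'⟩ := exists_top H.1
    obtain ⟨n, hn, hn'⟩ := exists_top H.2
    have := cf_mul_of_top hm' hn'
    rw [hab, map_zero, eq_comm, mul_eq_zero, map_eq_zero_iff _ (shift_injective m)] at this
    tauto

instance : Nontrivial (ShiftAlg h) :=
  ⟨⟨0, 1, fun H => by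
    have := congrArg (cf (h := h) 0) H
    rw [← mono_zero_one, cf_mono] at this
    simp at this⟩⟩

instance [Algebra ℂ L] : IsScalarTower ℂ L (ShiftAlg h) :=
  IsScalarTower.of_algebraMap_eq fun c => by
    change mono h 0 (algebraMap ℂ L[X] c) = mono h 0 (C (algebraMap ℂ L c))
    rfl

/-! ### Coefficientwise derivations -/

/-- A linear endomorphism of `L[X]` applied to the coefficients. -/
noncomputable def coeffMap [Algebra ℂ L] (d : L[X] →ₗ[ℂ] L[X]) : ShiftAlg h →ₗ[ℂ] ShiftAlg h where
  toFun s := ⟨s.coeff.mapRange d (map_zero d)⟩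
  map_add' s t := by
    apply SkewMonoidAlgebra.ext
    intro n
    simp
  map_smul' c t := by
    apply SkewMonoidAlgebra.ext
    intro n
    simp

theorem cf_coeffMap [Algebra ℂ L] (d : L[X] →ₗ[ℂ] L[X]) (n : ℤ) (s : ShiftAlg h) :
    cf n (coeffMap d s) = d (cf n s) := by
  rfl

theorem coeffMap_mono [Algebra ℂ L] (d : L[X] →ₗ[ℂ] L[X]) (n : ℤ) (p : L[X]) :
    coeffMap d (mono h n p) = mono h n (d p) := by
  refine ShiftAlg.ext fun m => ?_
  rw [cf_coeffMap, cf_mono, cf_mono]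
  split_ifs
  · rfl
  · exact map_zero d

/-- Commuting with all shifts makes `d` compatible with the twisted multiplication, so it extends to
a derivation which kills `y`. -/
theorem coeffMap_mul [Algebra ℂ L] (d : L[X] →ₗ[ℂ] L[X]) (hd : ∀ p q, d (p * q) = d p * q + p * d q)
    (hs : ∀ n p, d (shift h n p) = shift h n (d p)) (a b : ShiftAlg h) :
    coeffMap d (a * b) = coeffMap d a * b + a * coeffMap d b := by
  induction a using ShiftAlg.induction with
  | hadd a a' ha ha' => simp only [add_mul, map_add, ha, ha']; abel
  | hm m p =>
    induction b using ShiftAlg.induction with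
    | hadd b b' hb hb' => simp only [mul_add, map_add, hb, hb']; abel
    | hm n q =>
      simp only [mono_mul_mono, coeffMap_mono, hd, hs, mono_add]

end Shift
end NCForms

namespace NCForms

/-! ## Algebras of polynomial growth satisfy the Ore conditions -/

section Growth

variable (k : Type u) [Field k] (A : Type v) [Ring A] [Algebra k A]

/-- Any two elements lie in a filtered piece whose dimensions grow polynomially. -/
def PolyGrowth : Prop :=
  ∀ a b : A, ∃ (U : ℕ → Submodule k A) (d C N : ℕ), a ∈ U d ∧ b ∈ U d ∧ 1 ∈ U 0 ∧
    (∀ i j, U i * U j ≤ U (i + j)) ∧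
    ∀ m, Module.Finite k (U m) ∧ Module.finrank k (U m) ≤ C * (m + 1) ^ N

variable {k A}

theorem exists_mul_pow_lt_two_pow (C d N : ℕ) : ∃ m : ℕ, C * (d * m + 1) ^ N < 2 ^ m := by
  have h1 := tendsto_pow_const_div_const_pow_of_one_lt N (one_lt_two (α := ℝ))
  have h2 := h1.const_mul ((C : ℝ) * (d + 1) ^ N)
  rw [mul_zero] at h2
  obtain ⟨m, hm, hm1⟩ := ((h2.eventually (gt_mem_nhds one_pos)).and
    (Filter.eventually_ge_atTop 1)).exists
  refine ⟨m, ?_⟩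
  have h3 : (0 : ℝ) < 2 ^ m := by positivity
  rw [← mul_div_assoc, div_lt_one h3] at hm
  have h4 : ((C * (d * m + 1) ^ N : ℕ) : ℝ) ≤ (C : ℝ) * (d + 1) ^ N * (m : ℝ) ^ N := by
    push_cast
    rw [mul_assoc, ← mul_pow]
    have : (1 : ℝ) ≤ m := by exact_mod_cast hm1
    gcongr
    nlinarith
  exact_mod_cast lt_of_le_of_lt h4 hm

/-- Products of `m` factors from the span of `a, b` stay in the piece `U (d * m)`, whose dimension
is polynomial in `m` and so falls behind `2 ^ m`. -/
theorem PolyGrowth.exists_finrank_pow_lt (H : PolyGrowth k A) (a b : A) :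
    ∃ m : ℕ, Module.finrank k ((Submodule.span k {a, b}) ^ m : Submodule k A) < 2 ^ m := by
  obtain ⟨U, d, C, N, ha, hb, h1, hU, hfin⟩ := H a b
  have hle : ∀ m : ℕ, (Submodule.span k {a, b}) ^ m ≤ U (d * m) := by
    intro m
    induction m with
    | zero => rw [pow_zero, Submodule.one_le]; exact h1
    | succ m ih =>
      rw [pow_succ]
      refine (mul_le_mul' ih (Submodule.span_le.mpr ?_)).trans (hU _ _)
      rintro z (rfl | rfl)
      exacts [ha, hb]
  obtain ⟨m, hm⟩ := exists_mul_pow_lt_two_pow C d N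
  have := (hfin (d * m)).1
  exact ⟨m, ((Submodule.finrank_mono (hle m)).trans (hfin _).2).trans_lt hm⟩

/-- Each power contains two independent copies of the preceding one, so the dimension at least
doubles, as it would in a free algebra on two generators. -/
theorem two_pow_le_finrank_pow [Nontrivial A] (W : Submodule k A) [hW : Module.Finite k W]
    (f : ∀ m : ℕ, ((W ^ m : Submodule k A) × (W ^ m : Submodule k A)) →ₗ[k]
      (W ^ (m + 1) : Submodule k A)) (hf : ∀ m, Function.Injective (f m)) (m : ℕ) :
    2 ^ m ≤ Module.finrank k (W ^ m : Submodule k A) := by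
  have hfin : ∀ m : ℕ, Module.Finite k (W ^ m : Submodule k A) := fun m =>
    Module.Finite.iff_fg.mpr ((Module.Finite.iff_fg.mp hW).pow m)
  induction m with
  | zero =>
    rw [pow_zero, pow_zero, Submodule.one_eq_span, finrank_span_singleton one_ne_zero]
  | succ m ih =>
    have := hfin m
    have := hfin (m + 1)
    have := LinearMap.finrank_le_finrank_of_injective (hf m)
    rw [Module.finrank_prod] at this
    rw [pow_succ]
    omega

/-- If no such pair existed, `(c, d) ↦ a c - b d` would be injective. It maps two copies of `W ^ m`
into `W ^ (m + 1)`, so the dimensions would double at each step, against polynomial growth. -/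
theorem PolyGrowth.right_ore [IsDomain A] (H : PolyGrowth k A) (a : A) {b : A}
    (hb : b ≠ 0) : ∃ c d : A, a * c = b * d ∧ c ≠ 0 := by
  by_contra! hc
  obtain ⟨m, hm⟩ := H.exists_finrank_pow_lt a b
  set W := Submodule.span k {a, b} with hW
  have haW : a ∈ W := Submodule.subset_span (by simp)
  have hbW : b ∈ W := Submodule.subset_span (by simp)
  have : Module.Finite k W := Module.Finite.span_of_finite k (by simp)
  refine absurd (two_pow_le_finrank_pow W (fun m => LinearMap.codRestrict _
    ((LinearMap.mulLeft k a).comp ((Submodule.subtype _).comp (LinearMap.fst k _ _)) -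
      (LinearMap.mulLeft k b).comp ((Submodule.subtype _).comp (LinearMap.snd k _ _))) ?_) ?_ m)
    (not_le.mpr hm)
  · rintro ⟨c, d⟩
    rw [pow_succ']
    exact sub_mem (Submodule.mul_mem_mul haW c.2) (Submodule.mul_mem_mul hbW d.2)
  · intro m
    rw [← LinearMap.ker_eq_bot, LinearMap.ker_eq_bot']
    rintro ⟨c, d⟩ hcd
    have e : a * (c : A) - b * (d : A) = 0 := congrArg Subtype.val hcd
    have hc0 := hc _ _ (sub_eq_zero.mp e)
    rw [hc0, mul_zero, zero_sub, neg_eq_zero, mul_eq_zero] at e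
    exact Prod.ext (Subtype.ext hc0) (Subtype.ext (e.resolve_left hb))

/-- The mirror image of `PolyGrowth.right_ore`, with right multiplications. Both sides are needed:
`OreLocalization` is built from left fractions, whereas `IsQuotientDivisionRing` asks for right
ones. -/
theorem PolyGrowth.left_ore [IsDomain A] (H : PolyGrowth k A) (a : A) {b : A}
    (hb : b ≠ 0) : ∃ c d : A, c * a = d * b ∧ c ≠ 0 := by
  by_contra! hc
  obtain ⟨m, hm⟩ := H.exists_finrank_pow_lt a b
  set W := Submodule.span k {a, b} with hW
  have haW : a ∈ W := Submodule.subset_span (by simp)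
  have hbW : b ∈ W := Submodule.subset_span (by simp)
  have : Module.Finite k W := Module.Finite.span_of_finite k (by simp)
  refine absurd (two_pow_le_finrank_pow W (fun m => LinearMap.codRestrict _
    ((LinearMap.mulRight k a).comp ((Submodule.subtype _).comp (LinearMap.fst k _ _)) -
      (LinearMap.mulRight k b).comp ((Submodule.subtype _).comp (LinearMap.snd k _ _))) ?_) ?_ m)
    (not_le.mpr hm)
  · rintro ⟨c, d⟩
    rw [pow_succ]
    exact sub_mem (Submodule.mul_mem_mul c.2 haW) (Submodule.mul_mem_mul d.2 hbW)
  · intro m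
    rw [← LinearMap.ker_eq_bot, LinearMap.ker_eq_bot']
    rintro ⟨c, d⟩ hcd
    have e : (c : A) * a - (d : A) * b = 0 := congrArg Subtype.val hcd
    have hc0 := hc _ _ (sub_eq_zero.mp e)
    rw [hc0, zero_mul, zero_sub, neg_eq_zero, mul_eq_zero] at e
    exact Prod.ext (Subtype.ext hc0) (Subtype.ext (e.resolve_right hb))

open nonZeroDivisors in
theorem PolyGrowth.nonempty_oreSet [IsDomain A] (H : PolyGrowth k A) :
    Nonempty (OreLocalization.OreSet A⁰) := by
  rw [OreLocalization.nonempty_oreSet_iff]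
  refine ⟨fun r₁ r₂ s hs => ⟨1, ?_⟩, fun r s => ?_⟩
  · rw [mul_right_cancel₀ (nonZeroDivisors.coe_ne_zero s) hs]
  · obtain ⟨c, d, hcd, hc⟩ := H.left_ore r (nonZeroDivisors.coe_ne_zero s)
    exact ⟨d, ⟨c, mem_nonZeroDivisors_of_ne_zero hc⟩, hcd⟩

end Growth

/-! ### Polynomial growth of skew Laurent polynomials -/

section ShiftGrowth

variable {L : Type u} [Field L] {h : L}

/-- The span of the monomials `T^j y^n` with `|n| ≤ m`, `j ≤ m`. -/
noncomputable def ShiftAlg.filt (h : L) (m : ℕ) : Submodule L (ShiftAlg h) :=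
  Submodule.span L (Set.range fun i : Fin (2 * m + 1) × Fin (m + 1) =>
    mono h ((i.1 : ℤ) - m) (X ^ (i.2 : ℕ)))

theorem ShiftAlg.mono_mem_filt {m : ℕ} {n : ℤ} {p : L[X]} (hn : |n| ≤ m) (hp : p.natDegree ≤ m) :
    mono h n p ∈ ShiftAlg.filt h m := by
  rw [abs_le] at hn
  have e : mono h n p = ∑ i ∈ Finset.range (m + 1), p.coeff i • mono h n (X ^ i) := by
    conv_lhs => rw [p.as_sum_range_C_mul_X_pow' (Nat.lt_succ_of_le hp)]
    simp only [smul_mono]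
    exact map_sum (AddMonoidHom.mk' (mono h n) (mono_add n)) _ _
  rw [e]
  refine Submodule.sum_mem _ fun i hi => Submodule.smul_mem _ _ (Submodule.subset_span ?_)
  refine ⟨⟨⟨(n + m).toNat, by omega⟩, ⟨i, Finset.mem_range.mp hi⟩⟩, ?_⟩
  have : (((n + m).toNat : ℕ) : ℤ) - m = n := by omega
  simp only [this]

/-- A shift preserves the degree in `T`, so both the exponents of `y` and the degrees in `T` add up
as in the commutative case. -/
theorem ShiftAlg.filt_mul_le (i j : ℕ) :
    ShiftAlg.filt h i * ShiftAlg.filt h j ≤ ShiftAlg.filt h (i + j) := by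
  rw [ShiftAlg.filt, ShiftAlg.filt, Submodule.span_mul_span, Submodule.span_le]
  rintro _ ⟨_, ⟨⟨a, b⟩, rfl⟩, _, ⟨⟨c, d⟩, rfl⟩, rfl⟩
  simp only [mono_mul_mono, SetLike.mem_coe]
  apply ShiftAlg.mono_mem_filt
  · rw [abs_le]; constructor <;> push_cast <;> omega
  · refine natDegree_mul_le.trans ?_
    rw [shift, taylorAlgHom_apply, natDegree_taylor]
    simp only [natDegree_X_pow]
    omega

theorem ShiftAlg.filt_mono {i j : ℕ} (hij : i ≤ j) : ShiftAlg.filt h i ≤ ShiftAlg.filt h j := by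
  rw [ShiftAlg.filt, Submodule.span_le]
  rintro _ ⟨⟨a, b⟩, rfl⟩
  apply ShiftAlg.mono_mem_filt
  · rw [abs_le]; constructor <;> omega
  · rw [natDegree_X_pow]; omega

theorem ShiftAlg.exists_mem_filt (s : ShiftAlg h) : ∃ m, s ∈ ShiftAlg.filt h m := by
  induction s using ShiftAlg.induction with
  | hm n p => exact ⟨max n.natAbs p.natDegree, ShiftAlg.mono_mem_filt (by
      rw [Int.abs_eq_natAbs]; exact_mod_cast le_max_left _ _) (le_max_right _ _)⟩
  | hadd a b ha hb =>
    obtain ⟨i, hi⟩ := ha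
    obtain ⟨j, hj⟩ := hb
    exact ⟨max i j, add_mem (ShiftAlg.filt_mono (le_max_left _ _) hi)
      (ShiftAlg.filt_mono (le_max_right _ _) hj)⟩

instance : IsDomain (ShiftAlg h) := NoZeroDivisors.to_isDomain _

theorem ShiftAlg.polyGrowth : PolyGrowth L (ShiftAlg h) := by
  intro a b
  obtain ⟨i, hi⟩ := ShiftAlg.exists_mem_filt a
  obtain ⟨j, hj⟩ := ShiftAlg.exists_mem_filt b
  -- The two constants come from the count of spanning monomials, `(2m + 1)(m + 1) ≤ 2 (m + 1)²`.
  refine ⟨ShiftAlg.filt h, max i j, 2, 2, ShiftAlg.filt_mono (le_max_left _ _) hi,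
    ShiftAlg.filt_mono (le_max_right _ _) hj, ?_, ShiftAlg.filt_mul_le, fun m => ⟨?_, ?_⟩⟩
  · rw [← mono_zero_one]
    exact ShiftAlg.mono_mem_filt (by simp) (by simp)
  · exact Module.Finite.span_of_finite L (Set.finite_range _)
  · refine (finrank_range_le_card _).trans ?_
    simp only [Fintype.card_prod, Fintype.card_fin]
    nlinarith

noncomputable instance : OreLocalization.OreSet (nonZeroDivisors (ShiftAlg h)) :=
  ShiftAlg.polyGrowth.nonempty_oreSet.some

end ShiftGrowth
end NCForms

namespace NCForms

/-! ## Spanning by ordered monomials -/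

section PBW

variable {h : ℂ} {I : Type u} [LinearOrder I]

/-- A word in the `y_i`. -/
noncomputable def yw (h : ℂ) (l : List I) : HAlg h I := (l.map y).prod
/-- A word in the `x_i`. -/
noncomputable def xw (h : ℂ) (l : List I) : HAlg h I := (l.map x).prod

/-- The span of the products of a word in the `y_i` and a word of length `< q` in the `x_i`. -/
noncomputable def xFilt (h : ℂ) (I : Type u) [LinearOrder I] (q : ℕ) : Submodule ℂ (HAlg h I) :=
  Submodule.span ℂ {a | ∃ l m : List I, m.length < q ∧ a = yw h l * xw h m}

theorem yw_mul_xw_mem {l m : List I} {q : ℕ} (hm : m.length < q) :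
    yw h l * xw h m ∈ xFilt h I q := Submodule.subset_span ⟨l, m, hm, rfl⟩

theorem xFilt_mono {q r : ℕ} (hqr : q ≤ r) : xFilt h I q ≤ xFilt h I r :=
  Submodule.span_mono fun _ ⟨l, m, hm, ha⟩ => ⟨l, m, hm.trans_le hqr, ha⟩

theorem yw_cons (i : I) (l : List I) : yw h (i :: l) = y i * yw h l := by simp [yw]
theorem xw_cons (i : I) (l : List I) : xw h (i :: l) = x i * xw h l := by simp [xw]

theorem yw_perm {l m : List I} (H : l.Perm m) : yw h l = yw h m := by
  induction H with
  | nil => rfl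
  | cons i _ ih => rw [yw_cons, yw_cons, ih]
  | swap i j l => simp only [yw_cons, ← mul_assoc, yy i j]
  | trans _ _ h1 h2 => exact h1.trans h2

theorem y_mul_mem_xFilt (i : I) {q : ℕ} {a : HAlg h I} (ha : a ∈ xFilt h I q) :
    y i * a ∈ xFilt h I q := by
  refine Submodule.span_induction (p := fun a _ => y i * a ∈ xFilt h I q) ?_ (by simp)
    (fun a b _ _ ha hb => by rw [mul_add]; exact add_mem ha hb)
    (fun c a _ ha => by rw [mul_smul_comm]; exact Submodule.smul_mem _ c ha) ha
  rintro _ ⟨l, m, hm, rfl⟩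
  rw [← mul_assoc, ← yw_cons]
  exact yw_mul_xw_mem hm

theorem yw_mul_mem_xFilt (l : List I) {q : ℕ} {a : HAlg h I} (ha : a ∈ xFilt h I q) :
    yw h l * a ∈ xFilt h I q := by
  induction l with
  | nil => simpa [yw] using ha
  | cons i l ih => rw [yw_cons, mul_assoc]; exact y_mul_mem_xFilt i ih

theorem x_mul_yw (i : I) (l : List I) :
    (x i : HAlg h I) * yw h l = yw h l * x i + (l.length * h : ℂ) • (y i * yw h l) := by
  induction l with
  | nil => simp [yw]
  | cons j l ih =>
    rw [yw_cons, ← mul_assoc, xy i j, add_mul, mul_assoc, ih, mul_add, mul_smul_comm,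
      ← mul_assoc (y j) (y i), yy j i, smul_mul_assoc]
    simp only [List.length_cons, Nat.cast_add, Nat.cast_one, mul_assoc]
    module

theorem x_mul_mem_xFilt (i : I) {q : ℕ} {a : HAlg h I} (ha : a ∈ xFilt h I q) :
    x i * a ∈ xFilt h I (q + 1) := by
  refine Submodule.span_induction (p := fun a _ => x i * a ∈ xFilt h I (q + 1)) ?_ (by simp)
    (fun a b _ _ ha hb => by rw [mul_add]; exact add_mem ha hb)
    (fun c a _ ha => by rw [mul_smul_comm]; exact Submodule.smul_mem _ c ha) ha
  rintro _ ⟨l, m, hm, rfl⟩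
  rw [← mul_assoc, x_mul_yw, add_mul, mul_assoc, ← xw_cons, smul_mul_assoc, ← yw_cons]
  exact add_mem (yw_mul_xw_mem (by simpa using hm))
    (Submodule.smul_mem _ _ (yw_mul_xw_mem (by omega)))

/-- The commutator of `x_j` and `x_i` is `h (y_i x_j - y_j x_i)`, so exchanging two neighbours costs
only terms with fewer `x`'s. -/
theorem xw_perm_sub_mem {l m : List I} (H : l.Perm m) : xw h l - xw h m ∈ xFilt h I l.length := by
  induction H with
  | nil => simp
  | cons i _ ih =>
    rw [xw_cons, xw_cons, ← mul_sub]
    exact x_mul_mem_xFilt i ih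
  | swap i j l =>
    have e : (x j * (x i * xw h l) - x i * (x j * xw h l) : HAlg h I) =
        h • (yw h [i] * xw h (j :: l)) - h • (yw h [j] * xw h (i :: l)) := by
      have e1 : ∀ k : I, yw h [k] = y k := fun k => by simp [yw]
      simp only [e1, ← mul_assoc, xx i j, xy i j, xw_cons, add_mul, sub_mul, smul_mul_assoc,
        smul_add]
      module
    rw [xw_cons, xw_cons, xw_cons, xw_cons, e]
    refine sub_mem (Submodule.smul_mem _ _ (yw_mul_xw_mem ?_))
      (Submodule.smul_mem _ _ (yw_mul_xw_mem ?_)) <;> simp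
  | @trans l₁ l₂ l₃ h1 _ ih1 ih2 =>
    rw [← sub_add_sub_cancel]
    exact add_mem ih1 (h1.length_eq ▸ ih2)

theorem exists_mem_xFilt (a : HAlg h I) : ∃ q, a ∈ xFilt h I q := by
  -- Stability of the filtration under left multiplication by `a` passes to products, so it can be
  -- proved by induction on `a`; the claim is the case `b = 1`.
  have key : ∀ b : HAlg h I, (∃ q, b ∈ xFilt h I q) → ∃ q, a * b ∈ xFilt h I q := by
    induction a using induction with
    | hx i => exact fun b ⟨q, hq⟩ => ⟨q + 1, x_mul_mem_xFilt i hq⟩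
    | hy i => exact fun b ⟨q, hq⟩ => ⟨q, y_mul_mem_xFilt i hq⟩
    | hc c =>
      rintro b ⟨q, hq⟩
      exact ⟨q, by rw [← Algebra.smul_def]; exact Submodule.smul_mem _ c hq⟩
    | hadd a a' ha ha' =>
      intro b hb
      obtain ⟨q, hq⟩ := ha b hb
      obtain ⟨r, hr⟩ := ha' b hb
      refine ⟨max q r, ?_⟩
      rw [add_mul]
      exact add_mem (xFilt_mono (le_max_left _ _) hq) (xFilt_mono (le_max_right _ _) hr)
    | hmul a a' ha ha' =>
      intro b hb
      rw [mul_assoc]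
      exact ha _ (ha' b hb)
  have h1 : yw h ([] : List I) * xw h [] ∈ xFilt h I 1 := yw_mul_xw_mem (by simp)
  simpa [yw, xw] using key 1 ⟨1, by simpa [yw, xw] using h1⟩

/-- The polynomial algebra which models `H_I` as a vector space. -/
abbrev PolyGen (I : Type u) : Type u := MvPolynomial (I ⊕ I) ℂ

/-- The list of indices, with multiplicities, of an exponent. -/
noncomputable def expList (e : I →₀ ℕ) : List I := e.toMultiset.toList

theorem exists_expList_perm (l : List I) : ∃ e : I →₀ ℕ, (expList e).Perm l := by
  classical
  refine ⟨Multiset.toFinsupp (l : Multiset I), ?_⟩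
  rw [expList, ← Multiset.coe_eq_coe]
  simp

theorem prod_expList {M : Type*} [CommMonoid M] (e : I →₀ ℕ) (f : I → M) :
    ((expList e).map f).prod = e.prod fun i n => f i ^ n := by
  classical
  rw [expList, ← Multiset.prod_coe, ← Multiset.map_coe, Multiset.coe_toList,
    Finsupp.toMultiset_map, Finsupp.prod_toMultiset]
  rw [Finsupp.prod_mapDomain_index (by simp) (by intros; rw [pow_add])]

theorem length_expList (e : I →₀ ℕ) : (expList e).length = e.sum fun _ n => n := by
  rw [expList, Multiset.length_toList, Finsupp.card_toMultiset]
  rfl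

/-- The linear map which sends a monomial to an ordered monomial; the first summand of `I ⊕ I`
indexes the `y_i`. -/
noncomputable def ordMon (h : ℂ) (I : Type u) [LinearOrder I] : PolyGen I →ₗ[ℂ] HAlg h I :=
  (MvPolynomial.basisMonomials (I ⊕ I) ℂ).constr ℂ fun e =>
    yw h (expList (Finsupp.sumFinsuppEquivProdFinsupp e).1) *
      xw h (expList (Finsupp.sumFinsuppEquivProdFinsupp e).2)

theorem ordMon_monomial (e : (I ⊕ I) →₀ ℕ) : ordMon h I (MvPolynomial.monomial e 1) =
    yw h (expList (Finsupp.sumFinsuppEquivProdFinsupp e).1) *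
      xw h (expList (Finsupp.sumFinsuppEquivProdFinsupp e).2) := by
  exact (MvPolynomial.basisMonomials (I ⊕ I) ℂ).constr_basis ℂ _ e

/-- Induction on the number of `x`'s. `expList` picks one word for each multiset, and any other word
with the same letters differs from it by terms with fewer `x`'s. Which word is picked does not
matter. -/
theorem ordMon_surjective : Function.Surjective (ordMon h I) := by
  have key : ∀ q, xFilt h I q ≤ LinearMap.range (ordMon h I) := by
    intro q
    induction q with
    | zero =>
      rw [xFilt, Submodule.span_le]
      rintro _ ⟨l, m, hm, -⟩
      exact absurd hm (Nat.not_lt_zero _)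
    | succ q ih =>
      rw [xFilt, Submodule.span_le]
      rintro _ ⟨l, m, hm, rfl⟩
      obtain ⟨e, he⟩ := exists_expList_perm l
      obtain ⟨d, hd⟩ := exists_expList_perm m
      have e1 : yw h l * xw h m = ordMon h I (MvPolynomial.monomial
          (Finsupp.sumFinsuppEquivProdFinsupp.symm (e, d)) 1) -
          yw h l * (xw h (expList d) - xw h m) := by
        rw [ordMon_monomial, Equiv.apply_symm_apply, yw_perm he, mul_sub]
        abel
      rw [e1]
      refine sub_mem (LinearMap.mem_range_self _ _) (ih (yw_mul_mem_xFilt _ ?_))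
      exact xFilt_mono (by rw [hd.length_eq]; omega) (xw_perm_sub_mem hd)
  intro a
  obtain ⟨q, hq⟩ := exists_mem_xFilt a
  exact key q hq

end PBW
end NCForms

namespace NCForms

/-! ## Realisation of `H_I` by skew Laurent polynomials -/

section Psi

variable {L : Type u} [Field L] [Algebra ℂ L] {h : ℂ}

/-- The element `v y T + r y⁻¹`. -/
noncomputable def xel (h : ℂ) (v r : L) : ShiftAlg (algebraMap ℂ L h) :=
  mono _ 1 (C v * (X - C (algebraMap ℂ L h))) + mono _ (-1) (C r)

/-- The element `v y`. -/
noncomputable def yel (h : ℂ) (v : L) : ShiftAlg (algebraMap ℂ L h) := mono _ 1 (C v)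

theorem complex_smul_mono {H : L} (c : ℂ) (n : ℤ) (p : L[X]) :
    c • mono H n p = mono H n (C (algebraMap ℂ L c) * p) := by
  rw [← algebraMap_smul L c, smul_mono]

theorem yel_mul_yel (v v' : L) : yel h v * yel h v' = yel h v' * yel h v := by
  simp only [yel, mono_mul_mono, shift_C]
  congr 1
  ring

theorem xel_mul_yel (v r v' : L) :
    xel h v r * yel h v' = yel h v' * xel h v r + h • (yel h v * yel h v') := by
  refine ShiftAlg.ext fun n => ?_
  simp only [xel, yel, mul_add, add_mul, mono_mul_mono, shift_C, complex_smul_mono, map_mul,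
    map_sub, shift_X, map_add, cf_mono]
  norm_num only
  split_ifs <;> first | (exfalso; omega) | (simp; try ring)

/-- Together with `xel_mul_yel` and `yel_mul_yel` this holds for arbitrary scalars, so every index
has its own pair `(v, r)` of free parameters. No order of the indices enters. -/
theorem xel_mul_xel (v r v' r' : L) :
    xel h v' r' * xel h v r = xel h v r * xel h v' r' - h • (xel h v r * yel h v')
      + h • (yel h v * xel h v' r') + h ^ 2 • (yel h v * yel h v') := by
  refine ShiftAlg.ext fun n => ?_
  simp only [xel, yel, mul_add, add_mul, mono_mul_mono, shift_C, complex_smul_mono, map_mul,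
    map_sub, shift_X, smul_add, map_add, cf_mono]
  norm_num only
  split_ifs <;> first | (exfalso; omega) | (simp; try ring)

variable {I : Type u} [LinearOrder I]

/-- The homomorphism `x_i ↦ v_i y T + r_i y⁻¹`, `y_i ↦ v_i y`. -/
noncomputable def psi (v r : I → L) : HAlg h I →ₐ[ℂ] ShiftAlg (algebraMap ℂ L h) :=
  lift (fun i => xel h (v i) (r i)) (fun i => yel h (v i))
    (fun _ _ => xel_mul_yel _ _ _) (fun _ _ => yel_mul_yel _ _) (fun _ _ _ => xel_mul_xel _ _ _ _)

@[simp] theorem psi_x (v r : I → L) (i : I) : psi v r (x i : HAlg h I) = xel h (v i) (r i) :=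
  lift_x _ _ _ _ _ _
@[simp] theorem psi_y (v r : I → L) (i : I) : psi v r (y i : HAlg h I) = yel h (v i) :=
  lift_y _ _ _ _ _ _

/-- The skew Laurent polynomials with coefficients in a given subspace. -/
noncomputable def coefIn (H : L) (N : Submodule ℂ L) : Submodule ℂ (ShiftAlg H) where
  carrier := {s | ∀ n j, (cf n s).coeff j ∈ N}
  add_mem' ha hb n j := by
    rw [map_add, coeff_add]; exact add_mem (ha n j) (hb n j)
  zero_mem' n j := by simp
  smul_mem' c s hs n j := by
    rw [LinearMap.map_smul_of_tower, coeff_smul]; exact N.smul_mem c (hs n j)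

/-- The shift by `n h` has complex coefficients, so it preserves any complex subspace `N` of `L`
from which the coefficients are taken. -/
theorem shift_coeff_mem {N : Submodule ℂ L} {q : L[X]} (hq : ∀ j, q.coeff j ∈ N) (n : ℤ) (j : ℕ) :
    (shift (algebraMap ℂ L h) n q).coeff j ∈ N := by
  conv => enter [2, 1, 2]; rw [q.as_sum_range_C_mul_X_pow]
  rw [map_sum, finsetSum_coeff]
  refine Submodule.sum_mem _ fun i _ => ?_
  have e : (X - C ((n : L) * algebraMap ℂ L h)) ^ i =
      ((X - C ((n : ℂ) * h)) ^ i : ℂ[X]).map (algebraMap ℂ L) := by simp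
  rw [map_mul, map_pow, shift_X, shift_C, e, coeff_C_mul, coeff_map, mul_comm, ← Algebra.smul_def]
  exact N.smul_mem _ (hq i)

theorem mono_C_mul_mem_coefIn {N N' : Submodule ℂ L} {s : ShiftAlg (algebraMap ℂ L h)}
    (hs : s ∈ coefIn _ N) (m : ℤ) {l : L} (hl : ∀ a ∈ N, l * a ∈ N') :
    mono _ m (C l) * s ∈ coefIn _ N' := by
  intro n j
  rw [cf_mono_mul, coeff_C_mul]
  exact hl _ (shift_coeff_mem (hs _) _ _)

theorem yT_mul_mem_coefIn {N : Submodule ℂ L} {s : ShiftAlg (algebraMap ℂ L h)}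
    (hs : s ∈ coefIn _ N) (m : ℤ) :
    mono _ m (X - C (algebraMap ℂ L h)) * s ∈ coefIn _ N := by
  intro n j
  rw [cf_mono_mul, sub_mul, coeff_sub, coeff_C_mul, ← Algebra.smul_def]
  refine sub_mem ?_ (N.smul_mem _ (shift_coeff_mem (hs _) _ _))
  cases j with
  | zero => rw [coeff_X_mul_zero]; exact N.zero_mem
  | succ j => rw [coeff_X_mul]; exact shift_coeff_mem (hs _) _ _

theorem yel_mul_mem_coefIn {N N' : Submodule ℂ L} {s : ShiftAlg (algebraMap ℂ L h)}
    (hs : s ∈ coefIn _ N) {v : L} (hv : ∀ a ∈ N, v * a ∈ N') : yel h v * s ∈ coefIn _ N' :=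
  mono_C_mul_mem_coefIn hs 1 hv

theorem mono_C_mul_eq {H : L} (m : ℤ) (l : L) (p : L[X]) :
    mono H m (C l * p) = mono H 0 (C l) * mono H m p := by
  rw [mono_mul_mono, zero_add]
  congr 2
  simp [shift]

theorem xel_mul_mem_coefIn {N N' : Submodule ℂ L} {s : ShiftAlg (algebraMap ℂ L h)}
    (hs : s ∈ coefIn _ N) {v r : L} (hv : ∀ a ∈ N, v * a ∈ N') (hr : ∀ a ∈ N, r * a ∈ N') :
    xel h v r * s ∈ coefIn _ N' := by
  rw [xel, add_mul]
  refine add_mem ?_ (mono_C_mul_mem_coefIn hs _ hr)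
  rw [mono_C_mul_eq, mul_assoc]
  exact mono_C_mul_mem_coefIn (yT_mul_mem_coefIn hs _) _ hv

theorem mono_mem_coefIn {H : L} {N : Submodule ℂ L} (n : ℤ) {p : L[X]} (hp : ∀ j, p.coeff j ∈ N) :
    mono H n p ∈ coefIn H N := by
  intro m j
  rw [cf_mono]
  split_ifs
  · exact hp j
  · simp

theorem C_coeff_mem {N : Submodule ℂ L} {l : L} (hl : l ∈ N) (j : ℕ) : (C l).coeff j ∈ N := by
  rw [coeff_C]
  split_ifs
  · exact hl
  · exact N.zero_mem

/-- The functional `∑ p_n(T) y^n ↦ ∑ p_n(0)`. -/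
noncomputable def aug (H : L) : ShiftAlg H →ₗ[L] L :=
  (Finsupp.lsum L fun _ => Polynomial.lcoeff L 0).comp
    (SkewMonoidAlgebra.coeffLinearEquiv (S := L)).toLinearMap

theorem aug_mono {H : L} (n : ℤ) (p : L[X]) : aug H (mono H n p) = p.coeff 0 := by
  have : (mono H n p).coeff = Finsupp.single (ShiftGroup.of H n) p := rfl
  simp only [aug, LinearMap.comp_apply]
  change (Finsupp.lsum L fun _ => Polynomial.lcoeff L 0) (mono H n p).coeff = _
  rw [this, Finsupp.lsum_single]
  rfl

theorem aug_mem {H : L} {N : Submodule ℂ L} {s : ShiftAlg H} (hs : s ∈ coefIn H N) :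
    aug H s ∈ N := by
  change (Finsupp.lsum L fun _ => Polynomial.lcoeff L 0) s.coeff ∈ N
  rw [Finsupp.lsum_apply]
  exact Submodule.sum_mem _ fun n _ => hs n.exp 0

end Psi

/-! ### Injectivity of the generic realisation -/

section Faithful

variable {L : Type u} [Field L] [Algebra ℂ L] {h : ℂ} {I : Type u} [LinearOrder I]
  [Algebra (PolyGen I) L] [IsScalarTower ℂ (PolyGen I) L]

/-- The generic parameter `v_i`. -/
noncomputable def vpar (L : Type u) [Field L] [Algebra (PolyGen I) L] (i : I) : L :=
  algebraMap (PolyGen I) L (MvPolynomial.X (Sum.inl i))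

/-- The generic parameter `r_i`. -/
noncomputable def rpar (L : Type u) [Field L] [Algebra (PolyGen I) L] (i : I) : L :=
  algebraMap (PolyGen I) L (MvPolynomial.X (Sum.inr i))

/-- The monomial with exponent `e` in the generic parameters. -/
noncomputable def parMon (L : Type u) [Field L] [Algebra (PolyGen I) L] (e : (I ⊕ I) →₀ ℕ) : L :=
  algebraMap (PolyGen I) L (MvPolynomial.monomial e 1)

/-- The degree of a monomial in the `r_i`. -/
noncomputable def rdeg (e : (I ⊕ I) →₀ ℕ) : ℕ :=
  (Finsupp.sumFinsuppEquivProdFinsupp e).2.sum fun _ n => n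

theorem rdeg_add (e d : (I ⊕ I) →₀ ℕ) : rdeg (e + d) = rdeg e + rdeg d := by
  classical
  rw [rdeg, rdeg, rdeg, ← Finsupp.sum_add_index' (h := fun (_ : I) (n : ℕ) => n)
    (fun _ => rfl) (fun _ _ _ => rfl)]
  congr 1
  ext i
  simp

theorem rdeg_inl (i : I) : rdeg (Finsupp.single (Sum.inl i : I ⊕ I) 1) = 0 := by
  have : (Finsupp.sumFinsuppEquivProdFinsupp (Finsupp.single (Sum.inl i : I ⊕ I) 1)).2 = 0 := by
    ext j
    simp
  rw [rdeg, this, Finsupp.sum_zero_index]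

theorem rdeg_inr (i : I) : rdeg (Finsupp.single (Sum.inr i : I ⊕ I) 1) = 1 := by
  have : (Finsupp.sumFinsuppEquivProdFinsupp (Finsupp.single (Sum.inr i : I ⊕ I) 1)).2 =
      Finsupp.single i 1 := by
    ext j
    simp [Finsupp.single_apply]
  rw [rdeg, this, Finsupp.sum_single_index rfl]

theorem vpar_mul_parMon (i : I) (e : (I ⊕ I) →₀ ℕ) :
    vpar L i * parMon L e = parMon L (Finsupp.single (Sum.inl i) 1 + e) := by
  rw [vpar, parMon, parMon, ← map_mul, MvPolynomial.X, MvPolynomial.monomial_mul, one_mul]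

theorem rpar_mul_parMon (i : I) (e : (I ⊕ I) →₀ ℕ) :
    rpar L i * parMon L e = parMon L (Finsupp.single (Sum.inr i) 1 + e) := by
  rw [rpar, parMon, parMon, ← map_mul, MvPolynomial.X, MvPolynomial.monomial_mul, one_mul]

/-- The span of the parameter monomials whose exponents satisfy a predicate. -/
noncomputable def parSpan (L : Type u) [Field L] [Algebra ℂ L] [Algebra (PolyGen I) L]
    (P : ((I ⊕ I) →₀ ℕ) → Prop) : Submodule ℂ L :=
  Submodule.span ℂ {a | ∃ e, P e ∧ a = parMon L e}

theorem parMon_mem {P : ((I ⊕ I) →₀ ℕ) → Prop} {e : (I ⊕ I) →₀ ℕ} (he : P e) :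
    parMon L e ∈ parSpan L P := Submodule.subset_span ⟨e, he, rfl⟩

theorem parSpan_mono {P P' : ((I ⊕ I) →₀ ℕ) → Prop} (H : ∀ e, P e → P' e) :
    parSpan L P ≤ parSpan L P' :=
  Submodule.span_mono fun _ ⟨e, he, ha⟩ => ⟨e, H e he, ha⟩

theorem mul_mem_parSpan {P P' : ((I ⊕ I) →₀ ℕ) → Prop} {l : L}
    (H : ∀ e, P e → l * parMon L e ∈ parSpan L P') (a : L) (ha : a ∈ parSpan L P) :
    l * a ∈ parSpan L P' := by
  refine Submodule.span_induction (p := fun a _ => l * a ∈ parSpan L P') ?_ (by simp)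
    (fun a b _ _ ha hb => by rw [mul_add]; exact add_mem ha hb)
    (fun c a _ ha => by rw [mul_smul_comm]; exact Submodule.smul_mem _ c ha) ha
  rintro _ ⟨e, he, rfl⟩
  exact H e he

/-- The generic realisation of `H_I`. -/
noncomputable def gpsi (L : Type u) [Field L] [Algebra ℂ L] (h : ℂ) (I : Type u) [LinearOrder I]
    [Algebra (PolyGen I) L] : HAlg h I →ₐ[ℂ] ShiftAlg (algebraMap ℂ L h) :=
  psi (vpar L) (rpar L)

theorem gpsi_yw (l : List I) :
    gpsi L h I (yw h l) = mono _ l.length (C (l.map (vpar L)).prod) := by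
  induction l with
  | nil => simp [yw, mono_zero_one]
  | cons i l ih =>
    rw [yw_cons, map_mul, ih, gpsi, psi_y, yel, mono_mul_mono, shift_C, List.map_cons,
      List.prod_cons, ← C_mul, List.length_cons]
    congr 1
    push_cast
    ring

theorem prod_vpar_mul_parMon (l : List I) (e : (I ⊕ I) →₀ ℕ) :
    ∃ d : (I ⊕ I) →₀ ℕ, (l.map (vpar L)).prod * parMon L e = parMon L d ∧ rdeg d = rdeg e := by
  induction l with
  | nil => exact ⟨e, by simp, rfl⟩
  | cons i l ih =>
    obtain ⟨d, hd, hd'⟩ := ih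
    refine ⟨Finsupp.single (Sum.inl i) 1 + d, ?_, by rw [rdeg_add, rdeg_inl, hd', zero_add]⟩
    rw [List.map_cons, List.prod_cons, mul_assoc, hd, vpar_mul_parMon]

theorem prod_rpar (l : List I) :
    ∃ d : (I ⊕ I) →₀ ℕ, (l.map (rpar L)).prod = parMon L d ∧ rdeg d = l.length := by
  induction l with
  | nil => exact ⟨0, by simp [parMon], by simp [rdeg]⟩
  | cons i l ih =>
    obtain ⟨d, hd, hd'⟩ := ih
    refine ⟨Finsupp.single (Sum.inr i) 1 + d, ?_, by
      rw [rdeg_add, rdeg_inr, hd', List.length_cons, add_comm]⟩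
    rw [List.map_cons, List.prod_cons, hd, rpar_mul_parMon]

/-- Expanding a product of factors `v y T + r y⁻¹`, the choice of `r y⁻¹` throughout gives the term
subtracted here; any other choice uses some `v`, so it has smaller degree in the `r_i`. -/
theorem gpsi_xw (l : List I) :
    gpsi L h I (xw h l) - mono _ (-(l.length : ℤ)) (C (l.map (rpar L)).prod) ∈
      coefIn _ (parSpan L fun e : (I ⊕ I) →₀ ℕ => rdeg e < l.length) := by
  induction l with
  | nil => simp [xw, mono_zero_one]
  | cons i l ih =>
    set s := gpsi L h I (xw h l) - mono _ (-(l.length : ℤ)) (C (l.map (rpar L)).prod) with hs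
    obtain ⟨d, hd, hd'⟩ := prod_rpar (L := L) l
    have e : gpsi L h I (xw h (i :: l)) -
        mono _ (-((i :: l).length : ℤ)) (C ((i :: l).map (rpar L)).prod) =
        xel h (vpar L i) (rpar L i) * s +
          mono _ 1 (C (vpar L i) * (X - C (algebraMap ℂ L h))) *
            mono _ (-(l.length : ℤ)) (C (l.map (rpar L)).prod) := by
      rw [xw_cons, map_mul, hs, mul_sub, gpsi, psi_x]
      have : mono (algebraMap ℂ L h) (-((i :: l).length : ℤ)) (C ((i :: l).map (rpar L)).prod) =
          mono _ (-1) (C (rpar L i)) * mono _ (-(l.length : ℤ)) (C (l.map (rpar L)).prod) := by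
        rw [mono_mul_mono, shift_C, ← C_mul, List.map_cons, List.prod_cons, List.length_cons]
        congr 1
        push_cast
        ring
      rw [this]
      conv_rhs => enter [1, 2, 1]; rw [xel]
      rw [add_mul]
      abel
    rw [e]
    refine add_mem (xel_mul_mem_coefIn ih (mul_mem_parSpan fun e he => ?_)
      (mul_mem_parSpan fun e he => ?_)) ?_
    · rw [vpar_mul_parMon]
      exact parMon_mem (by rw [rdeg_add, rdeg_inl, List.length_cons]; omega)
    · rw [rpar_mul_parMon]
      exact parMon_mem (by rw [rdeg_add, rdeg_inr, List.length_cons]; omega)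
    · rw [mono_mul_mono, shift_C, mul_assoc, mul_comm, mul_assoc, ← C_mul, mul_comm]
      refine mono_mem_coefIn _ fun j => ?_
      rw [coeff_C_mul, mul_comm]
      rw [hd, mul_comm (parMon L d), vpar_mul_parMon, coeff_sub]
      have hmem : parMon L (Finsupp.single (Sum.inl i) 1 + d) ∈
          parSpan L fun e : (I ⊕ I) →₀ ℕ => rdeg e < (i :: l).length :=
        parMon_mem (by rw [rdeg_add, rdeg_inl, List.length_cons]; omega)
      rw [coeff_X, coeff_C]
      have hz : ∀ c : ℂ, algebraMap ℂ L c * parMon L (Finsupp.single (Sum.inl i) 1 + d) ∈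
          parSpan L fun e : (I ⊕ I) →₀ ℕ => rdeg e < (i :: l).length := fun c => by
        rw [← Algebra.smul_def]; exact Submodule.smul_mem _ _ hmem
      -- The polynomial `X - h` has complex coefficients, so the remaining term only contributes
      -- complex multiples of one parameter monomial.
      have e3 : ((if 1 = j then (1 : L) else 0) - if j = 0 then algebraMap ℂ L h else 0) =
          algebraMap ℂ L ((if 1 = j then (1 : ℂ) else 0) - if j = 0 then h else 0) := by
        split_ifs <;> simp
      rw [e3]
      exact hz _

theorem parMon_eq_prod (e : (I ⊕ I) →₀ ℕ) : parMon L e =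
    ((expList (Finsupp.sumFinsuppEquivProdFinsupp e).1).map (vpar L)).prod *
      ((expList (Finsupp.sumFinsuppEquivProdFinsupp e).2).map (rpar L)).prod := by
  classical
  rw [prod_expList, prod_expList]
  induction e using Finsupp.induction_linear with
  | zero =>
    have : Finsupp.sumFinsuppEquivProdFinsupp (0 : (I ⊕ I) →₀ ℕ) = (0, 0) := by
      ext <;> simp
    rw [this]
    simp [parMon]
  | add e d he hd =>
    have h1 : (Finsupp.sumFinsuppEquivProdFinsupp (e + d)) =
        Finsupp.sumFinsuppEquivProdFinsupp e + Finsupp.sumFinsuppEquivProdFinsupp d := by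
      ext <;> simp
    have h2 : parMon L (e + d) = parMon L e * parMon L d := by
      rw [parMon, parMon, parMon, ← map_mul, MvPolynomial.monomial_mul, one_mul]
    rw [h1, h2, he, hd, Prod.fst_add, Prod.snd_add,
      Finsupp.prod_add_index' (by simp) (by intros; rw [pow_add]),
      Finsupp.prod_add_index' (by simp) (by intros; rw [pow_add])]
    ring
  | single i n =>
    have hX : parMon L (Finsupp.single i n) = algebraMap (PolyGen I) L (MvPolynomial.X i) ^ n := by
      rw [parMon, ← map_pow, MvPolynomial.X_pow_eq_monomial]
    rw [hX]
    rcases i with i | i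
    · have : Finsupp.sumFinsuppEquivProdFinsupp (Finsupp.single (Sum.inl i : I ⊕ I) n) =
          (Finsupp.single i n, 0) := by
        ext <;> simp [Finsupp.single_apply]
      simp [this, vpar]
    · have : Finsupp.sumFinsuppEquivProdFinsupp (Finsupp.single (Sum.inr i : I ⊕ I) n) =
          (0, Finsupp.single i n) := by
        ext <;> simp [Finsupp.single_apply]
      simp [this, rpar]

/-- Triangularity with respect to the degree in the `r_i`: at `T = 0`, `y = 1` the leading term of
an ordered monomial is the parameter monomial with the same exponent. -/
theorem aug_gpsi_ordMon (e : (I ⊕ I) →₀ ℕ) :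
    aug _ (gpsi L h I (ordMon h I (MvPolynomial.monomial e 1))) - parMon L e ∈
      parSpan L fun d : (I ⊕ I) →₀ ℕ => rdeg d < rdeg e := by
  classical
  rw [ordMon_monomial, map_mul, gpsi_yw]
  set l := expList (Finsupp.sumFinsuppEquivProdFinsupp e).1 with hl
  set m := expList (Finsupp.sumFinsuppEquivProdFinsupp e).2 with hm
  have hlen : rdeg e = m.length := by rw [hm, length_expList, rdeg]
  have hprod : parMon L e = (l.map (vpar L)).prod * (m.map (rpar L)).prod :=
    parMon_eq_prod e
  have h1 := gpsi_xw (L := L) (h := h) m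
  set s := gpsi L h I (xw h m) - mono _ (-(m.length : ℤ)) (C (m.map (rpar L)).prod) with hs
  have h2 : gpsi L h I (xw h m) = s + mono _ (-(m.length : ℤ)) (C (m.map (rpar L)).prod) := by
    rw [hs]; abel
  rw [h2, mul_add, map_add, mono_mul_mono, aug_mono, shift_C, ← C_mul, coeff_C_zero, ← hprod,
    add_sub_cancel_right]
  refine aug_mem (mono_C_mul_mem_coefIn h1 _ (mul_mem_parSpan fun d hd => ?_))
  obtain ⟨d', hd', hr⟩ := prod_vpar_mul_parMon (L := L) l d
  rw [hd']
  exact parMon_mem (by rw [hr, hlen]; exact hd)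

/-- Write `a` as the image of a polynomial `p` under `ordMon`. If the functional vanishes on it,
triangularity expresses `p` through monomials of degree in the `r_i` below the largest one in `p`,
which is absurd. That a functional with values in `L` already detects `a` is also what bounds
dimensions in `HAlg.polyGrowth`. -/
theorem aug_gpsi_injective (hL : Function.Injective (algebraMap (PolyGen I) L)) {a : HAlg h I}
    (ha : aug _ (gpsi L h I a) = 0) : a = 0 := by
  classical
  obtain ⟨p, rfl⟩ := ordMon_surjective a
  by_contra hne
  have hp : p ≠ 0 := by rintro rfl; exact hne (map_zero _)
  obtain ⟨e, he, hmax⟩ := p.support.exists_max_image rdeg (MvPolynomial.support_nonempty.mpr hp)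
  have hsum : algebraMap (PolyGen I) L p ∈ parSpan L fun d : (I ⊕ I) →₀ ℕ => rdeg d < rdeg e := by
    have e1 : algebraMap (PolyGen I) L p = - ∑ d ∈ p.support, p.coeff d •
        (aug _ (gpsi L h I (ordMon h I (MvPolynomial.monomial d 1))) - parMon L d) := by
      have e2 : p = ∑ d ∈ p.support, p.coeff d • MvPolynomial.monomial d (1 : ℂ) := by
        conv_lhs => rw [p.as_sum]
        refine Finset.sum_congr rfl fun d _ => ?_
        rw [MvPolynomial.smul_monomial, smul_eq_mul, mul_one]
      have e3 : ∑ d ∈ p.support, p.coeff d •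
          aug _ (gpsi L h I (ordMon h I (MvPolynomial.monomial d 1))) = 0 := by
        rw [← ha]
        conv_rhs => rw [e2]
        simp only [map_sum, map_smul, LinearMap.map_smul_of_tower]
      have e4 : ∑ d ∈ p.support, p.coeff d • parMon L d = algebraMap (PolyGen I) L p := by
        conv_rhs => rw [e2]
        rw [map_sum]
        refine Finset.sum_congr rfl fun d _ => ?_
        rw [parMon, Algebra.smul_def, Algebra.smul_def (p.coeff d) (MvPolynomial.monomial d 1),
          map_mul, ← IsScalarTower.algebraMap_apply]
      simp only [smul_sub, Finset.sum_sub_distrib]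
      rw [e3, e4, zero_sub, neg_neg]
    rw [e1]
    exact neg_mem (Submodule.sum_mem _ fun d hd => Submodule.smul_mem _ _
      (parSpan_mono (fun d' hd' => hd'.trans_le (hmax d hd)) (aug_gpsi_ordMon d)))
  -- Elements of this span come from polynomials without the monomial `e`, while `p` contains it.
  have key : ∀ b ∈ parSpan L (fun d : (I ⊕ I) →₀ ℕ => rdeg d < rdeg e),
      ∃ q : PolyGen I, algebraMap _ L q = b ∧ q.coeff e = 0 := by
    intro b hb
    refine Submodule.span_induction (p := fun b _ => ∃ q : PolyGen I, algebraMap _ L q = b ∧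
      q.coeff e = 0) ?_ ⟨0, by simp⟩ ?_ ?_ hb
    · rintro _ ⟨d, hd, rfl⟩
      refine ⟨MvPolynomial.monomial d 1, rfl, ?_⟩
      rw [MvPolynomial.coeff_monomial, if_neg]
      rintro rfl
      exact lt_irrefl _ hd
    · rintro _ _ _ _ ⟨q, rfl, hq⟩ ⟨q', rfl, hq'⟩
      exact ⟨q + q', map_add _ _ _, by rw [MvPolynomial.coeff_add, hq, hq', add_zero]⟩
    · rintro c _ _ ⟨q, rfl, hq⟩
      refine ⟨c • q, ?_, by rw [MvPolynomial.coeff_smul, hq, smul_zero]⟩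
      rw [Algebra.smul_def, map_mul, ← IsScalarTower.algebraMap_apply, ← Algebra.smul_def]
  obtain ⟨q, hq, hq0⟩ := key _ hsum
  rw [hL hq] at hq0
  exact MvPolynomial.mem_support_iff.mp he hq0

theorem gpsi_injective (hL : Function.Injective (algebraMap (PolyGen I) L)) :
    Function.Injective (gpsi L h I) := by
  rw [injective_iff_map_eq_zero]
  intro a ha
  exact aug_gpsi_injective hL (by rw [ha, map_zero])

end Faithful
end NCForms

namespace NCForms

/-! ## `H_I` is a domain of polynomial growth -/

section Domain

variable {h : ℂ} {I : Type u} [LinearOrder I]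

theorem gpsi_fractionRing_injective :
    Function.Injective (gpsi (FractionRing (PolyGen I)) h I) :=
  gpsi_injective (IsFractionRing.injective _ _)

instance : Nontrivial (HAlg h I) :=
  (gpsi (FractionRing (PolyGen I)) h I).toRingHom.domain_nontrivial

instance : IsDomain (HAlg h I) :=
  (gpsi_fractionRing_injective (h := h) (I := I)).isDomain
    (gpsi (FractionRing (PolyGen I)) h I).toRingHom

/-- The span of `1` and the generators with index in `J`. -/
noncomputable def genSpan (h : ℂ) (J : Finset I) : Submodule ℂ (HAlg h I) :=
  Submodule.span ℂ ({1} ∪ (x '' (J : Set I) ∪ y '' (J : Set I)))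

theorem one_mem_genSpan (J : Finset I) : (1 : HAlg h I) ∈ genSpan h J :=
  Submodule.subset_span (by simp)

theorem x_mem_genSpan {J : Finset I} {i : I} (hi : i ∈ J) : (x i : HAlg h I) ∈ genSpan h J :=
  Submodule.subset_span (Or.inr (Or.inl ⟨i, hi, rfl⟩))

theorem y_mem_genSpan {J : Finset I} {i : I} (hi : i ∈ J) : (y i : HAlg h I) ∈ genSpan h J :=
  Submodule.subset_span (Or.inr (Or.inr ⟨i, hi, rfl⟩))

theorem genSpan_pow_mono {J K : Finset I} (hJ : J ⊆ K) {m n : ℕ} (hmn : m ≤ n) :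
    genSpan h J ^ m ≤ genSpan h K ^ n := by
  refine (pow_le_pow_left' (a := genSpan h J) (b := genSpan h K) ?_ m).trans ?_
  · refine Submodule.span_mono (Set.union_subset_union_right _ ?_)
    exact Set.union_subset_union (Set.image_mono (by simpa using hJ))
      (Set.image_mono (by simpa using hJ))
  · exact pow_le_pow_right₀ (Submodule.one_le.mpr (one_mem_genSpan K)) hmn

theorem exists_mem_genSpan_pow (a : HAlg h I) : ∃ (J : Finset I) (d : ℕ), a ∈ genSpan h J ^ d := by
  classical
  induction a using induction with
  | hx i => exact ⟨{i}, 1, by rw [pow_one]; exact x_mem_genSpan (by simp)⟩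
  | hy i => exact ⟨{i}, 1, by rw [pow_one]; exact y_mem_genSpan (by simp)⟩
  | hc c => exact ⟨∅, 0, by rw [pow_zero]; exact Submodule.algebraMap_mem c⟩
  | hadd a b ha hb =>
    obtain ⟨J, d, hJ⟩ := ha
    obtain ⟨K, e, hK⟩ := hb
    exact ⟨J ∪ K, max d e, add_mem
      (genSpan_pow_mono Finset.subset_union_left (le_max_left _ _) hJ)
      (genSpan_pow_mono Finset.subset_union_right (le_max_right _ _) hK)⟩
  | hmul a b ha hb =>
    obtain ⟨J, d, hJ⟩ := ha
    obtain ⟨K, e, hK⟩ := hb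
    refine ⟨J ∪ K, d + e, ?_⟩
    rw [pow_add]
    exact Submodule.mul_mem_mul (genSpan_pow_mono Finset.subset_union_left le_rfl hJ)
      (genSpan_pow_mono Finset.subset_union_right le_rfl hK)

/-- The exponents which are supported on `J` and bounded by `m`. -/
def BddExp (J : Finset I) (m : ℕ) (e : (I ⊕ I) →₀ ℕ) : Prop :=
  ∀ i, e i ≤ m ∧ (e i ≠ 0 → i.elim id id ∈ J)

section

variable {L : Type u} [Field L] [Algebra ℂ L] [Algebra (PolyGen I) L]
  [IsScalarTower ℂ (PolyGen I) L]

theorem BddExp.single_add {J : Finset I} {m : ℕ} {e : (I ⊕ I) →₀ ℕ} (he : BddExp J m e)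
    {k : I ⊕ I} (hk : k.elim id id ∈ J) : BddExp J (m + 1) (Finsupp.single k 1 + e) := by
  classical
  intro i
  obtain ⟨h1, h2⟩ := he i
  rw [Finsupp.add_apply, Finsupp.single_apply]
  split_ifs with hki
  · subst hki
    exact ⟨by omega, fun _ => hk⟩
  · exact ⟨by omega, fun hne => h2 (by simpa using hne)⟩

/-- The image of a generator involves the parameters linearly, so one more factor raises each
exponent by at most one. Powers of `T` and `y` are not counted, since `coefIn` constrains only the
scalars in `L`. -/
theorem gpsi_mul_mem_coefIn {J : Finset I} {m : ℕ} {a : HAlg h I} (ha : a ∈ genSpan h J)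
    {s : ShiftAlg (algebraMap ℂ L h)} (hs : s ∈ coefIn _ (parSpan L (BddExp J m))) :
    gpsi L h I a * s ∈ coefIn _ (parSpan L (BddExp J (m + 1))) := by
  have hle : parSpan L (BddExp J m) ≤ parSpan L (BddExp J (m + 1)) :=
    parSpan_mono fun e he i => ⟨(he i).1.trans (Nat.le_succ m), (he i).2⟩
  refine Submodule.span_induction
    (p := fun a _ => gpsi L h I a * s ∈ coefIn _ (parSpan L (BddExp J (m + 1)))) ?_ (by simp)
    (fun a b _ _ ha hb => by rw [map_add, add_mul]; exact add_mem ha hb)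
    (fun c a _ ha => by rw [map_smul, smul_mul_assoc]; exact Submodule.smul_mem _ c ha) ha
  rintro _ (rfl | ⟨i, hi, rfl⟩ | ⟨i, hi, rfl⟩)
  · rw [map_one, one_mul]
    exact fun n j => hle (hs n j)
  · rw [gpsi, psi_x]
    refine xel_mul_mem_coefIn hs (mul_mem_parSpan fun e he => ?_) (mul_mem_parSpan fun e he => ?_)
    · rw [vpar_mul_parMon]
      exact parMon_mem (he.single_add hi)
    · rw [rpar_mul_parMon]
      exact parMon_mem (he.single_add hi)
  · rw [gpsi, psi_y]
    refine yel_mul_mem_coefIn hs (mul_mem_parSpan fun e he => ?_)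
    rw [vpar_mul_parMon]
    exact parMon_mem (he.single_add hi)

theorem gpsi_mem_coefIn {J : Finset I} {m : ℕ} {a : HAlg h I} (ha : a ∈ genSpan h J ^ m) :
    gpsi L h I a ∈ coefIn _ (parSpan L (BddExp J m)) := by
  induction m generalizing a with
  | zero =>
    rw [pow_zero, Submodule.mem_one] at ha
    obtain ⟨c, rfl⟩ := ha
    rw [AlgHom.commutes, ← mul_one (algebraMap ℂ (ShiftAlg (algebraMap ℂ L h)) c), ← Algebra.smul_def,
      ← mono_zero_one]
    refine Submodule.smul_mem _ _ (mono_mem_coefIn _ fun j => ?_)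
    refine C_coeff_mem ?_ j
    have : (1 : L) = parMon L (0 : (I ⊕ I) →₀ ℕ) := by simp [parMon]
    rw [this]
    exact parMon_mem fun i => by simp
  | succ m ih =>
    rw [pow_succ'] at ha
    refine Submodule.mul_induction_on ha (fun b hb c hc => ?_) fun b c hb hc => ?_
    · rw [map_mul]
      exact gpsi_mul_mem_coefIn hb (ih hc)
    · rw [map_add]
      exact add_mem hb hc

/-- A bounded exponent supported on `J` is a function from `J ⊕ J` to `{0, …, m}`. -/
theorem parSpan_bddExp_finite (J : Finset I) (m : ℕ) :
    Module.Finite ℂ (parSpan L (BddExp J m)) ∧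
      Module.finrank ℂ (parSpan L (BddExp J m)) ≤ (m + 1) ^ (2 * J.card) := by
  classical
  let g : (J ⊕ J → Fin (m + 1)) → L := fun t => parMon L
    (Finsupp.onFinset (J.disjSum J) (fun i => i.elim
      (fun j => if hj : j ∈ J then (t (Sum.inl ⟨j, hj⟩) : ℕ) else 0)
      (fun j => if hj : j ∈ J then (t (Sum.inr ⟨j, hj⟩) : ℕ) else 0)) (by
        rintro (i | i) hi <;> simp at hi <;> simpa using hi.1))
  have hle : parSpan L (BddExp J m) ≤ Submodule.span ℂ (Set.range g) := by
    rw [parSpan, Submodule.span_le]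
    rintro _ ⟨e, he, rfl⟩
    refine Submodule.subset_span ⟨fun i => ⟨e (Sum.map Subtype.val Subtype.val i),
      Nat.lt_succ_of_le (he _).1⟩, ?_⟩
    refine congrArg (parMon L) ?_
    ext (i | i)
    · simp only [Finsupp.onFinset_apply, Sum.elim_inl, Sum.map_inl]
      split_ifs with hi
      · rfl
      · by_contra hne
        exact hi ((he (Sum.inl i)).2 (Ne.symm hne))
    · simp only [Finsupp.onFinset_apply, Sum.elim_inr, Sum.map_inr]
      split_ifs with hi
      · rfl
      · by_contra hne
        exact hi ((he (Sum.inr i)).2 (Ne.symm hne))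
  have hfin : Module.Finite ℂ (Submodule.span ℂ (Set.range g)) :=
    Module.Finite.span_of_finite ℂ (Set.finite_range g)
  refine ⟨Submodule.finiteDimensional_of_le hle, (Submodule.finrank_mono hle).trans ?_⟩
  refine (finrank_range_le_card g).trans ?_
  simp [two_mul]

end

/-- The filtration consists of the powers of a span of finitely many generators. The injective
functional of `aug_gpsi_injective` embeds each power in a space of bounded parameter monomials,
whose dimension is at most `(m + 1) ^ (2 |J ∪ K|)`. -/
theorem HAlg.polyGrowth : PolyGrowth ℂ (HAlg h I) := by
  classical
  intro a b
  obtain ⟨J, d, ha⟩ := exists_mem_genSpan_pow a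
  obtain ⟨K, e, hb⟩ := exists_mem_genSpan_pow b
  refine ⟨fun m => genSpan h (J ∪ K) ^ m, max d e, 1, 2 * (J ∪ K).card,
    genSpan_pow_mono Finset.subset_union_left (le_max_left _ _) ha,
    genSpan_pow_mono Finset.subset_union_right (le_max_right _ _) hb, ?_,
    fun i j => (pow_add _ i j).ge, fun m => ⟨?_, ?_⟩⟩
  · exact (pow_zero (genSpan h (J ∪ K))).ge (Submodule.one_le.mp le_rfl)
  · refine Module.Finite.iff_fg.mpr (Submodule.FG.pow (Submodule.fg_span ?_) m)
    exact (Set.finite_singleton 1).union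
      (((Finset.finite_toSet _).image _).union ((Finset.finite_toSet _).image _))
  · let L := FractionRing (PolyGen I)
    obtain ⟨h1, h2⟩ := parSpan_bddExp_finite (L := L) (J ∪ K) m
    rw [one_mul]
    refine le_trans ?_ h2
    let Ψ : HAlg h I →ₗ[ℂ] L :=
      ((aug (algebraMap ℂ L h)).restrictScalars ℂ).comp (gpsi L h I).toLinearMap
    have hmem : ∀ c : (genSpan h (J ∪ K) ^ m : Submodule ℂ (HAlg h I)),
        (Ψ.domRestrict _) c ∈ parSpan L (BddExp (J ∪ K) m) := fun c =>
      aug_mem (gpsi_mem_coefIn c.2)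
    refine LinearMap.finrank_le_finrank_of_injective
      (f := LinearMap.codRestrict _ (Ψ.domRestrict _) hmem) ?_
    rw [← LinearMap.ker_eq_bot, LinearMap.ker_eq_bot']
    intro c hc
    exact Subtype.ext (aug_gpsi_injective (L := L) (IsFractionRing.injective _ _)
      (congrArg Subtype.val hc))

noncomputable instance : OreLocalization.OreSet (nonZeroDivisors (HAlg h I)) :=
  HAlg.polyGrowth.nonempty_oreSet.some

end Domain
end NCForms

namespace NCForms

/-! ## The action on skew Laurent polynomials -/

section Action

variable {L : Type u} [Field L] [Algebra ℂ L] {h : ℂ}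

/-- A derivation of `L` applied to the coefficients of a polynomial. -/
noncomputable def polyDer (d : Derivation ℂ L L) : L[X] →ₗ[ℂ] L[X] :=
  Polynomial.lsum fun n => ((monomial n).restrictScalars ℂ).comp (d : L →ₗ[ℂ] L)

theorem polyDer_monomial (d : Derivation ℂ L L) (n : ℕ) (a : L) :
    polyDer d (monomial n a) = monomial n (d a) := by
  simp [polyDer, Polynomial.sum_monomial_index]

theorem polyDer_C (d : Derivation ℂ L L) (a : L) : polyDer d (C a) = C (d a) :=
  polyDer_monomial d 0 a

theorem polyDer_X (d : Derivation ℂ L L) : polyDer d X = 0 := by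
  rw [X, polyDer_monomial]
  simp

theorem polyDer_mul (d : Derivation ℂ L L) (p q : L[X]) :
    polyDer d (p * q) = polyDer d p * q + p * polyDer d q := by
  induction p using Polynomial.induction_on' with
  | add p p' hp hp' => simp only [add_mul, map_add, hp, hp']; abel
  | monomial m a =>
    induction q using Polynomial.induction_on' with
    | add q q' hq hq' => simp only [mul_add, map_add, hq, hq']; abel
    | monomial n b =>
      simp only [monomial_mul_monomial, polyDer_monomial, Derivation.leibniz, smul_eq_mul, map_add]
      rw [add_comm, mul_comm b]

/-- The amount of the shift is a complex number, hence a constant of `d`. -/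
theorem polyDer_shift (d : Derivation ℂ L L) (n : ℤ) (p : L[X]) :
    polyDer d (shift (algebraMap ℂ L h) n p) = shift (algebraMap ℂ L h) n (polyDer d p) := by
  have hX : polyDer d (X - C ((n : L) * algebraMap ℂ L h)) = 0 := by
    have : (n : L) * algebraMap ℂ L h = algebraMap ℂ L (n * h) := by simp
    rw [map_sub, polyDer_X, polyDer_C, this, d.map_algebraMap, C_0, sub_zero]
  induction p using Polynomial.induction_on with
  | C a => rw [shift_C, polyDer_C, shift_C]
  | add p q hp hq => simp only [map_add, hp, hq]
  | monomial k a ih =>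
    rw [pow_succ, ← mul_assoc, map_mul, polyDer_mul, ih, shift_X, hX,
      polyDer_mul d (C a * X ^ k) X, polyDer_X, map_add, map_mul (shift _ n) _ X, shift_X, mul_zero,
      mul_zero, map_zero]

theorem derivative_shift (H : L) (n : ℤ) (p : L[X]) :
    derivative (shift H n p) = shift H n (derivative p) := by
  induction p using Polynomial.induction_on with
  | C a => simp
  | add p q hp hq => simp only [map_add, hp, hq]
  | monomial k a ih =>
    rw [pow_succ, ← mul_assoc, map_mul, derivative_mul, ih, shift_X,
      derivative_mul (f := C a * X ^ k) (g := X), map_add, map_mul (shift _ n) _ X, map_mul (shift _ n), shift_X]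
    simp

/-- The derivation `d/dT`. -/
noncomputable def derF (H : L) : ShiftAlg H →ₗ[ℂ] ShiftAlg H :=
  coeffMap ((derivative : L[X] →ₗ[L] L[X]).restrictScalars ℂ)

/-- The element `-h⁻¹ y² T - y² / 2`. -/
noncomputable def elH (H : L) : ShiftAlg H := mono H 2 (C (-H⁻¹) * X + C (3 / 2))

/-- The element `(2 h)⁻¹ y² T (T + h)`. -/
noncomputable def elE (H : L) : ShiftAlg H := mono H 2 (C (2 * H)⁻¹ * ((X - C (2 * H)) * (X - C H)))

/-- The inner derivation given by an element. -/
noncomputable def commMap {H : L} (c : ShiftAlg H) : ShiftAlg H →ₗ[ℂ] ShiftAlg H :=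
  (⟨⟨fun a => c * a - a * c, fun a b => by noncomm_ring⟩, fun l a => by
    have e (b : ShiftAlg H) : l • b = algebraMap L _ l * b := Algebra.smul_def l b
    change c * (l • a) - l • a * c = l • (c * a - a * c)
    rw [e, e, mul_sub, ← mul_assoc, ← Algebra.commutes l c, mul_assoc, mul_assoc]⟩ :
    ShiftAlg H →ₗ[L] ShiftAlg H).restrictScalars ℂ

theorem commMap_apply {H : L} (c a : ShiftAlg H) : commMap c a = c * a - a * c := rfl

theorem commMap_mul {H : L} (c a b : ShiftAlg H) :
    commMap c (a * b) = commMap c a * b + a * commMap c b := by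
  simp only [commMap_apply, mul_sub, sub_mul, mul_assoc]
  abel

/-- The derivation `a ↦ y H(a) y`. -/
noncomputable def derH (H : L) : ShiftAlg H →ₗ[ℂ] ShiftAlg H :=
  commMap (elH H)

/-- The derivation `a ↦ y E(a) y`. -/
noncomputable def derE (H : L) (d : Derivation ℂ L L) : ShiftAlg H →ₗ[ℂ] ShiftAlg H :=
  coeffMap (polyDer d) + commMap (elE H)

theorem derF_mul {H : L} (a b : ShiftAlg H) : derF H (a * b) = derF H a * b + a * derF H b :=
  coeffMap_mul ((derivative : L[X] →ₗ[L] L[X]).restrictScalars ℂ)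
    (fun p q => derivative_mul (f := p) (g := q)) (fun n p => derivative_shift H n p) a b

theorem derH_mul {H : L} (a b : ShiftAlg H) : derH H (a * b) = derH H a * b + a * derH H b :=
  commMap_mul _ a b

theorem derE_mul (d : Derivation ℂ L L) (a b : ShiftAlg (algebraMap ℂ L h)) :
    derE _ d (a * b) = derE _ d a * b + a * derE _ d b := by
  simp only [derE, LinearMap.add_apply]
  rw [coeffMap_mul _ (polyDer_mul d) (polyDer_shift d), commMap_mul, add_mul, mul_add]
  abel

theorem derF_algebraMap {H : L} (l : L) : derF H (algebraMap L _ l) = 0 := by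
  rw [algebraMap_eq_mono, derF, coeffMap_mono]
  simp [mono_zero]

theorem derH_algebraMap {H : L} (l : L) : derH H (algebraMap L _ l) = 0 := by
  rw [derH, commMap_apply, Algebra.commutes, sub_self]

theorem derE_algebraMap {H : L} (d : Derivation ℂ L L) (l : L) :
    derE H d (algebraMap L _ l) = algebraMap L _ (d l) := by
  rw [derE, LinearMap.add_apply, commMap_apply, ← Algebra.commutes, sub_self, add_zero]
  rw [algebraMap_eq_mono, coeffMap_mono, polyDer_C, algebraMap_eq_mono]

theorem yel_ne_zero {v : L} (hv : v ≠ 0) : yel h v ≠ 0 := fun H => by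
  have := congrArg (cf 1) H
  rw [yel, cf_mono, if_pos rfl, map_zero, C_eq_zero] at this
  exact hv this

variable {I : Type u} [LinearOrder I]

/-- Passing `y` shifts `T` by `h`, which changes the image of `x_i` by `h` times that of `y_i`:
conjugation by `y` is `e^{hF}`. The free parameter `t` gives both `psi_mul_yel_right` (`t = h`) and
`psi_mul_yel_left` (`t = 0`). -/
theorem psi_mul_yel (v r : I → L) (l : L) (t : ℂ) (a : HAlg h I) :
    psi v r (expF (t - h) a) * yel h l = yel h l * psi v r (expF t a) := by
  induction a using induction with
  | hx i =>
    simp only [expF_x, map_add, map_smul, psi_x, psi_y, add_mul, mul_add, xel_mul_yel,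
      smul_mul_assoc, mul_smul_comm, yel_mul_yel (v i) l]
    module
  | hy i => rw [expF_y, expF_y, psi_y, yel_mul_yel]
  | hc c => simp only [AlgHomClass.commutes, Algebra.commutes]
  | hadd a b ha hb => simp only [map_add, add_mul, mul_add, ha, hb]
  | hmul a b ha hb => rw [map_mul, map_mul, mul_assoc, hb, ← mul_assoc, ha, map_mul, map_mul,
      mul_assoc]

theorem psi_mul_yel_right (v r : I → L) (l : L) (a : HAlg h I) :
    psi v r a * yel h l = yel h l * psi v r (expF h a) := by
  rw [← psi_mul_yel, sub_self, expF_zero]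

theorem psi_mul_yel_left (v r : I → L) (l : L) (a : HAlg h I) :
    psi v r (expF (-h) a) * yel h l = yel h l * psi v r a := by
  have := psi_mul_yel v r l 0 a
  rwa [zero_sub, expF_zero] at this

/-- A derivation which agrees on the generators with `a ↦ y W(a) y`, for a skew derivation `W`,
agrees with it everywhere. -/
theorem der_psi_of_gen {v r : I → L} {D : ShiftAlg (algebraMap ℂ L h) →ₗ[ℂ] _}
    (hD : ∀ a b, D (a * b) = D a * b + a * D b) {W : HAlg h I →ₗ[ℂ] HAlg h I} (hW1 : W 1 = 0)
    (hW : ∀ a b, W (a * b) = W a * expF (-h) b + expF h a * W b)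
    (hx : ∀ i, D (psi v r (x i)) = yel h 1 * psi v r (W (x i)) * yel h 1)
    (hy : ∀ i, D (psi v r (y i)) = yel h 1 * psi v r (W (y i)) * yel h 1) (a : HAlg h I) :
    D (psi v r a) = yel h 1 * psi v r (W a) * yel h 1 := by
  induction a using induction with
  | hx i => exact hx i
  | hy i => exact hy i
  | hc c =>
    have h1 : D 1 = 0 := by
      have := hD 1 1
      simpa using this
    have hc : algebraMap ℂ (HAlg h I) c = c • 1 := Algebra.algebraMap_eq_smul_one c
    rw [hc, map_smul, map_smul, map_smul, map_one, h1, hW1]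
    simp
  | hadd a b ha hb => simp only [map_add, ha, hb, mul_add, add_mul]
  | hmul a b ha hb =>
    rw [map_mul, hD, ha, hb, hW, map_add, map_mul, map_mul, mul_add, add_mul]
    -- The two twists in the rule for `W` are exactly what appears when the outer factor `y` is
    -- moved across `b`, respectively across `a`.
    congr 1
    · simp only [mul_assoc]
      rw [psi_mul_yel_left]
    · simp only [← mul_assoc]
      rw [psi_mul_yel_right]

theorem derF_psi (v r : I → L) (a : HAlg h I) :
    derF _ (psi v r a) = psi v r (actF a) := by
  induction a using induction with
  | hx i =>
    rw [psi_x, actF_x, psi_y, xel, map_add, derF, coeffMap_mono, coeffMap_mono]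
    simp [mono_zero, yel]
  | hy i =>
    rw [psi_y, actF_y, yel, derF, coeffMap_mono]
    simp [mono_zero]
  | hc c =>
    have hc : algebraMap ℂ (HAlg h I) c = c • 1 := Algebra.algebraMap_eq_smul_one c
    have h1 : derF (algebraMap ℂ L h) 1 = 0 := by
      rw [← map_one (algebraMap L (ShiftAlg (algebraMap ℂ L h))), derF_algebraMap]
    rw [hc, map_smul, map_smul, map_smul, map_one, actF_one, h1, smul_zero, smul_zero,
      map_zero]
  | hadd a b ha hb => simp only [map_add, ha, hb]
  | hmul a b ha hb => simp only [map_mul, derF_mul, ha, hb, actF_mul, map_add]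

/-- Both sides obey the same product rule by `der_psi_of_gen`, so only generators matter. The
quadratic element `elH` is chosen so that its commutators with them come out right. -/
theorem derH_psi (hh : h ≠ 0) (v r : I → L) (a : HAlg h I) :
    derH _ (psi v r a) = yel h 1 * psi v r (actH a) * yel h 1 := by
  have hH : algebraMap ℂ L h ≠ 0 := (_root_.map_ne_zero _).mpr hh
  have : CharZero L := charZero_of_injective_algebraMap (algebraMap ℂ L).injective
  refine der_psi_of_gen derH_mul actH_one actH_mul (fun i => ?_) (fun i => ?_) a
  · refine ShiftAlg.ext fun n => ?_
    simp only [actH_x, psi_x, derH, commMap_apply, elH, xel, yel, mul_add, add_mul, mono_mul_mono,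
      shift_C, map_mul, map_sub, shift_X, map_add, cf_mono]
    norm_num only
    split_ifs <;> first
      | (exfalso; omega)
      | (refine Polynomial.funext fun t => ?_; simp; try field_simp; try ring)
  · have hy : actH (y i : HAlg h I) = (-1 : ℂ) • y i := by rw [actH_y, neg_one_smul]
    refine ShiftAlg.ext fun n => ?_
    simp only [hy, map_smul, complex_smul_mono, psi_y, derH, commMap_apply, elH, yel, mul_add, add_mul,
      mono_mul_mono, shift_C, map_mul, map_sub, shift_X, map_add, cf_mono]
    norm_num only
    split_ifs <;>
      (refine Polynomial.funext fun t => ?_; simp; try field_simp; try ring)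

/-- The derivation `d` turns `v_i` into `r_i`, and the commutator with `elE` supplies the terms in
`T`. As in `derH_psi`, it suffices to compare on generators. -/
theorem derE_psi (hh : h ≠ 0) {d : Derivation ℂ L L} {v r : I → L} (hv : ∀ i, d (v i) = r i)
    (hr : ∀ i, d (r i) = 0) (a : HAlg h I) :
    derE _ d (psi v r a) = yel h 1 * psi v r (actE a) * yel h 1 := by
  have hH : algebraMap ℂ L h ≠ 0 := (_root_.map_ne_zero _).mpr hh
  have : CharZero L := charZero_of_injective_algebraMap (algebraMap ℂ L).injective
  refine der_psi_of_gen (derE_mul d) actE_one actE_mul (fun i => ?_) (fun i => ?_) a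
  · have hX : polyDer d (X - C (algebraMap ℂ L h)) = 0 := by
      rw [map_sub, polyDer_X, polyDer_C, d.map_algebraMap, C_0, sub_zero]
    refine ShiftAlg.ext fun n => ?_
    simp only [actE_x, psi_x, derE, LinearMap.add_apply, commMap_apply, elE, xel, mul_add,
      add_mul, mono_mul_mono, shift_C, map_mul, map_sub, shift_X, map_add, coeffMap_mono,
      polyDer_mul, polyDer_C, hX, hv, hr, cf_mono]
    norm_num only
    split_ifs <;> first
      | (exfalso; omega)
      | (refine Polynomial.funext fun t => ?_; simp; try field_simp; try ring)
  · refine ShiftAlg.ext fun n => ?_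
    simp only [actE_y, psi_x, psi_y, derE, LinearMap.add_apply, commMap_apply, elE, xel, yel,
      mul_add, add_mul, mono_mul_mono, shift_C, map_mul, map_sub, shift_X, map_add, coeffMap_mono,
      polyDer_C, hv, cf_mono]
    norm_num only
    split_ifs <;> first
      | (exfalso; omega)
      | (refine Polynomial.funext fun t => ?_; simp; try field_simp; try ring)

/-- Invariant elements are realised by scalars. -/
theorem IsInvariant.exists_psi_eq (hh : h ≠ 0) {a : HAlg h I} (ha : IsInvariant a) (v r : I → L) :
    ∃ l : L, psi v r a = algebraMap L _ l := by
  have hH : algebraMap ℂ L h ≠ 0 := (_root_.map_ne_zero _).mpr hh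
  have : CharZero L := charZero_of_injective_algebraMap (algebraMap ℂ L).injective
  have hF := derF_psi v r a
  have hh' := derH_psi hh v r a
  rw [ha.2.1, map_zero] at hF
  rw [ha.2.2, map_zero, mul_zero, zero_mul] at hh'
  set s := psi v r a
  -- Being killed by `d/dT` makes every coefficient constant in `T`, in characteristic zero.
  have hc : ∀ n, ∃ l, cf n s = C l := fun n => by
    have h1 := congrArg (cf n) hF
    rw [derF, cf_coeffMap, map_zero] at h1
    exact ⟨_, eq_C_of_natDegree_eq_zero (derivative_eq_zero.mp h1)⟩
  choose l hl using hc
  refine ⟨l 0, ShiftAlg.ext fun n => ?_⟩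
  rw [algebraMap_eq_mono, cf_mono]
  split_ifs with hn
  · rw [← hn, hl]
  -- The commutator with `elH` sends `l y^n` to `-n l y^(n + 2)`, so only the coefficient with `n =
  -- 0` survives.
  · have h1 := congrArg (cf (n + 2)) hh'
    rw [derH, commMap_apply, map_sub, elH, cf_mono_mul, cf_mul_mono, map_zero,
      add_sub_cancel_right, hl, shift_C, map_add, map_mul, shift_X, shift_C, shift_C] at h1
    have h2 := congrArg (eval 0) h1
    simp only [eval_mul, eval_add, eval_sub, eval_C, eval_X, eval_zero] at h2
    have h3 : (n : L) * l n = 0 := by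
      refine (mul_eq_zero.mp ?_).resolve_left hH
      field_simp at h2
      linear_combination -h2 / 2
    rw [hl]
    rcases mul_eq_zero.mp h3 with h4 | h4
    · exact absurd (Int.cast_eq_zero.mp h4).symm hn
    · rw [h4, C_0]

/-- Invariant elements are realised by constants of the derivation. -/
theorem IsInvariant.der_eq_zero (hh : h ≠ 0) {a : HAlg h I} (ha : IsInvariant a)
    {d : Derivation ℂ L L} {v r : I → L} (hv : ∀ i, d (v i) = r i) (hr : ∀ i, d (r i) = 0) {l : L}
    (hl : psi v r a = algebraMap L _ l) : d l = 0 := by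
  have h1 := derE_psi hh hv hr a
  rw [ha.1, map_zero, mul_zero, zero_mul, hl, derE_algebraMap] at h1
  exact (map_eq_zero_iff _ (FaithfulSMul.algebraMap_injective L _)).mp h1

section Generic

variable [Algebra (PolyGen I) L] [IsScalarTower ℂ (PolyGen I) L]

/-- The converse of the two preceding facts for the generic realisation: the three derivations kill
the scalar, the outer factors `y` cancel in a domain, and the realisation is injective. -/
theorem isInvariant_of_gpsi (hh : h ≠ 0) (hL : Function.Injective (algebraMap (PolyGen I) L))
    {d : Derivation ℂ L L} (hv : ∀ i : I, d (vpar L i) = rpar L i)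
    (hr : ∀ i : I, d (rpar L i) = 0) {a : HAlg h I} {l : L} (hl : gpsi L h I a = algebraMap L _ l)
    (hd : d l = 0) : IsInvariant a := by
  have h1 := derE_psi hh hv hr a
  have h2 := derF_psi (vpar L) (rpar L) a
  have h3 := derH_psi hh (vpar L) (rpar L) a
  have hy : yel h (1 : L) ≠ 0 := yel_ne_zero one_ne_zero
  have key : ∀ b : HAlg h I, yel h 1 * psi (vpar L) (rpar L) b * yel h 1 = 0 → b = 0 :=
    fun b hb => by
      rcases mul_eq_zero.mp hb with hb | hb
      · rcases mul_eq_zero.mp hb with hb | hb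
        · exact absurd hb hy
        · exact gpsi_injective hL (hb.trans (map_zero _).symm)
      · exact absurd hb hy
  change psi (vpar L) (rpar L) a = _ at hl
  rw [hl] at h1 h2 h3
  rw [derE_algebraMap, hd, map_zero] at h1
  rw [derH_algebraMap] at h3
  rw [derF_algebraMap] at h2
  exact ⟨key _ h1.symm, gpsi_injective hL (h2.symm.trans (map_zero _).symm), key _ h3.symm⟩

/-- Scalars commute with `y`, and conjugation by `y` is `e^{hF}`. -/
theorem expF_eq_of_gpsi (hL : Function.Injective (algebraMap (PolyGen I) L))
    {a : HAlg h I} {l : L} (hl : gpsi L h I a = algebraMap L _ l) : expF h a = a := by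
  have h1 := psi_mul_yel_right (vpar L) (rpar L) 1 a
  change psi (vpar L) (rpar L) a = _ at hl
  rw [hl, Algebra.commutes, ← hl] at h1
  exact gpsi_injective hL (mul_left_cancel₀ (yel_ne_zero one_ne_zero) h1).symm

end Generic

theorem psi_congr {S : Set I} {v r v' r' : I → L} (hv : ∀ i ∈ S, v i = v' i)
    (hr : ∀ i ∈ S, r i = r' i) {a : HAlg h I} (ha : a ∈ sub h S) : psi v r a = psi v' r' a := by
  refine Algebra.adjoin_induction (p := fun a _ => psi v r a = psi v' r' a) ?_ ?_ ?_ ?_ ha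
  · rintro _ (⟨i, hi, rfl⟩ | ⟨i, hi, rfl⟩)
    · rw [psi_x, psi_x, hv i hi, hr i hi]
    · rw [psi_y, psi_y, hv i hi]
  · intro c; rw [AlgHomClass.commutes, AlgHomClass.commutes]
  · intro a b _ _ ha hb; rw [map_add, map_add, ha, hb]
  · intro a b _ _ ha hb; rw [map_mul, map_mul, ha, hb]

end Action
end NCForms

namespace NCForms

/-! ## The action of skew Laurent polynomials on functions -/

section Operators

variable {L : Type u} [Field L] {H : L}

/-- The operator `g ↦ (t ↦ z ^ n p(t) g(t - n H))` attached to `p(T) y^n`. -/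
noncomputable def opMono (H z : L) (n : ℤ) : L[X] →ₗ[L] Module.End L (L → L) where
  toFun p :=
    { toFun := fun g t => z ^ n * p.eval t * g (t - n * H)
      map_add' := fun g g' => by funext t; simp [mul_add]
      map_smul' := fun c g => by funext t; simp; ring }
  map_add' p q := by ext g t; simp; ring
  map_smul' c p := by ext g t; simp; ring

theorem opMono_apply (z : L) (n : ℤ) (p : L[X]) (g : L → L) (t : L) :
    opMono H z n p g t = z ^ n * p.eval t * g (t - n * H) := rfl

/-- The action of skew Laurent polynomials on functions, as a linear map. -/
noncomputable def opLin (H z : L) : ShiftAlg H →ₗ[L] Module.End L (L → L) :=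
  (Finsupp.lsum L fun n : ShiftGroup H => opMono H z n.exp).comp
    (SkewMonoidAlgebra.coeffLinearEquiv (S := L)).toLinearMap

theorem opLin_mono (z : L) (n : ℤ) (p : L[X]) : opLin H z (mono H n p) = opMono H z n p := by
  have : (mono H n p).coeff = Finsupp.single (ShiftGroup.of H n) p := rfl
  change (Finsupp.lsum L fun n : ShiftGroup H => opMono H z n.exp) (mono H n p).coeff = _
  rw [this, Finsupp.lsum_single]
  rfl

theorem eval_shift (n : ℤ) (p : L[X]) (t : L) : (shift H n p).eval t = p.eval (t - n * H) := by
  induction p using Polynomial.induction_on' with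
  | add p q hp hq => simp only [map_add, eval_add, hp, hq]
  | monomial k a =>
    rw [← C_mul_X_pow_eq_monomial, map_mul, map_pow, shift_C, shift_X]
    simp

/-- The action of skew Laurent polynomials on functions. -/
noncomputable def op {z : L} (H : L) (hz : z ≠ 0) : ShiftAlg H →ₐ[L] Module.End L (L → L) :=
  AlgHom.ofLinearMap (opLin H z)
    (by
      rw [← mono_zero_one, opLin_mono]
      ext g t
      simp [opMono_apply])
    (fun a b => by
      induction a using ShiftAlg.induction with
      | hadd a a' ha ha' => simp only [add_mul, map_add, ha, ha']
      | hm m p =>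
        induction b using ShiftAlg.induction with
        | hadd b b' hb hb' => simp only [mul_add, map_add, hb, hb']
        | hm n q =>
          rw [mono_mul_mono, opLin_mono, opLin_mono, opLin_mono]
          ext g t
          simp only [opMono_apply, Module.End.mul_apply, eval_mul, eval_shift, zpow_add₀ hz]
          rw [show t - ((m + n : ℤ) : L) * H = t - m * H - n * H by push_cast; ring]
          ring)

theorem op_mono {z : L} (hz : z ≠ 0) (n : ℤ) (p : L[X]) (g : L → L) (t : L) :
    op H hz (mono H n p) g t = z ^ n * p.eval t * g (t - n * H) := by
  change opLin H z _ g t = _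
  rw [opLin_mono, opMono_apply]

theorem op_algebraMap {z : L} (hz : z ≠ 0) (l : L) (g : L → L) (t : L) :
    op H hz (algebraMap L _ l) g t = l * g t := by
  rw [AlgHomClass.commutes]
  rfl

theorem zpow_two_injective [CharZero L] : Function.Injective fun n : ℤ => (2 : L) ^ n := by
  intro m n hmn
  have h1 : (algebraMap ℚ L) (2 ^ m) = algebraMap ℚ L (2 ^ n) := by simpa using hmn
  exact zpow_right_injective₀ (by norm_num) (by norm_num) ((algebraMap ℚ L).injective h1)

/-- The action on functions is faithful, already on the constant function `1`. -/
theorem ShiftAlg.eq_of_op [CharZero L] {s s' : ShiftAlg H}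
    (hs : ∀ (z : L) (hz : z ≠ 0) (t : L), op H hz s (fun _ => 1) t = op H hz s' (fun _ => 1) t) :
    s = s' := by
  rw [← sub_eq_zero]
  set r := s - s' with hr
  have h0 : ∀ (z : L) (hz : z ≠ 0) (t : L), op H hz r (fun _ => 1) t = 0 := fun z hz t => by
    rw [hr, map_sub, LinearMap.sub_apply, Pi.sub_apply, hs, sub_self]
  have hinj : Function.Injective fun n : ShiftGroup H =>
      ((zpowGroupHom n.exp : Lˣ →* Lˣ) : Lˣ →* Lˣ) := by
    intro m n hmn
    have := DFunLike.congr_fun hmn (Units.mk0 (2 : L) two_ne_zero)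
    have h2 := congrArg Units.val this
    simp only [zpowGroupHom_apply, Units.val_zpow_eq_zpow_val, Units.val_mk0] at h2
    exact zpow_two_injective (L := L) h2
  -- On the constant function the value is `∑ z^n p_n(t)`. The characters `z ↦ z^n` of `Lˣ` are
  -- distinct, because `2` has infinite order, so Dedekind's lemma makes every `p_n(t)` vanish.
  have hli := (linearIndependent_monoidHom Lˣ L).comp
    (fun n : ShiftGroup H => (Units.coeHom L).comp (zpowGroupHom n.exp : Lˣ →* Lˣ))
    (fun m n hmn => hinj (MonoidHom.ext fun u => Units.ext (DFunLike.congr_fun hmn u)))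
  refine ShiftAlg.ext fun n => Polynomial.funext fun t => ?_
  have h1 : ∑ n ∈ r.coeff.support, (r.coeff n).eval t •
      ((fun f : Lˣ →* L => (f : Lˣ → L)) ∘
        fun n : ShiftGroup H => (Units.coeHom L).comp (zpowGroupHom n.exp : Lˣ →* Lˣ)) n = 0 := by
    funext u
    have h2 := h0 u u.ne_zero t
    change (Finsupp.lsum L fun n : ShiftGroup H => opMono H (u : L) n.exp) r.coeff _ t = 0 at h2
    rw [Finsupp.lsum_apply, Finsupp.sum, LinearMap.sum_apply, Finset.sum_apply] at h2
    rw [Finset.sum_apply, Pi.zero_apply, ← h2]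
    refine Finset.sum_congr rfl fun n _ => ?_
    simp [opMono_apply, mul_comm]
  have h3 := linearIndependent_iff'.mp hli _ _ h1
  rw [map_zero, eval_zero]
  by_cases hn : ShiftGroup.of H n ∈ r.coeff.support
  · exact h3 _ hn
  · have : cf n r = 0 := Finsupp.notMem_support_iff.mp hn
    rw [this, eval_zero]

end Operators
end NCForms

namespace NCForms

/-! ## Coefficients of invariant cubic forms -/

section CubicCoeff

variable {L : Type u} [Field L] [Algebra ℂ L] {h : ℂ}

theorem op_xel {z : L} (hz : z ≠ 0) (v r : L) (g : L → L) (t : L) :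
    op _ hz (xel h v r) g t = z * v * (t - algebraMap ℂ L h) * g (t - algebraMap ℂ L h) +
      z⁻¹ * r * g (t + algebraMap ℂ L h) := by
  rw [xel, map_add, LinearMap.add_apply, Pi.add_apply, op_mono, op_mono]
  simp [mul_assoc]

theorem op_yel {z : L} (hz : z ≠ 0) (v : L) (g : L → L) (t : L) :
    op _ hz (yel h v) g t = z * v * g (t - algebraMap ℂ L h) := by
  rw [yel, op_mono]
  simp

theorem op_smul {z : L} (hz : z ≠ 0) (c : ℂ) (s : ShiftAlg (algebraMap ℂ L h)) (g : L → L) (t : L) :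
    op _ hz (c • s) g t = algebraMap ℂ L c * op _ hz s g t := by
  rw [← algebraMap_smul L c s, map_smul]
  rfl

/-- The realisation of the leading coefficient of an invariant cubic form. -/
noncomputable def cfA (h : ℂ) (α : L) : ShiftAlg (algebraMap ℂ L h) := mono _ 3 (C α)

/-- The realisation of the second coefficient of an invariant cubic form. -/
noncomputable def cfB (h : ℂ) (α β : L) : ShiftAlg (algebraMap ℂ L h) :=
  mono _ 1 (C β) - mono _ 3 (C α * (X - C (algebraMap ℂ L h)))

/-- The realisation of the third coefficient of an invariant cubic form. -/
noncomputable def cfC (h : ℂ) (α β γ : L) : ShiftAlg (algebraMap ℂ L h) :=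
  mono _ (-1) (C γ) - mono _ 1 (C β * (2 * X + C (algebraMap ℂ L h))) +
    mono _ 3 (C α * (X ^ 2 - C (algebraMap ℂ L h) * X - C (algebraMap ℂ L h) ^ 2))

/-- The realisation of the last coefficient of an invariant cubic form. -/
noncomputable def cfD (h : ℂ) (α β γ δ : L) : ShiftAlg (algebraMap ℂ L h) :=
  mono _ (-3) (C δ) - mono _ (-1) (C γ * (3 * X + 6 * C (algebraMap ℂ L h))) +
    mono _ 1 (C β * (3 * X ^ 2 + 6 * C (algebraMap ℂ L h) * X)) +
    mono _ 3 (C α * (4 * C (algebraMap ℂ L h) ^ 2 * X - X ^ 3))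

theorem op_cfA {z : L} (hz : z ≠ 0) (α : L) (g : L → L) (t : L) :
    op _ hz (cfA h α) g t = z ^ 3 * α * g (t - 3 * algebraMap ℂ L h) := by
  rw [cfA, op_mono]
  simp

theorem op_cfB {z : L} (hz : z ≠ 0) (α β : L) (g : L → L) (t : L) :
    op _ hz (cfB h α β) g t = z * β * g (t - algebraMap ℂ L h) -
      z ^ 3 * α * (t - algebraMap ℂ L h) * g (t - 3 * algebraMap ℂ L h) := by
  rw [cfB, map_sub, LinearMap.sub_apply, Pi.sub_apply, op_mono, op_mono]
  simp [mul_assoc]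

theorem op_cfC {z : L} (hz : z ≠ 0) (α β γ : L) (g : L → L) (t : L) :
    op _ hz (cfC h α β γ) g t = z⁻¹ * γ * g (t + algebraMap ℂ L h) -
      z * β * (2 * t + algebraMap ℂ L h) * g (t - algebraMap ℂ L h) +
      z ^ 3 * α * (t ^ 2 - algebraMap ℂ L h * t - algebraMap ℂ L h ^ 2) *
        g (t - 3 * algebraMap ℂ L h) := by
  rw [cfC, map_add, map_sub]
  simp only [LinearMap.sub_apply, Pi.sub_apply, LinearMap.add_apply, Pi.add_apply, op_mono]
  simp [mul_assoc]

theorem op_cfD {z : L} (hz : z ≠ 0) (α β γ δ : L) (g : L → L) (t : L) :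
    op _ hz (cfD h α β γ δ) g t = z⁻¹ ^ 3 * δ * g (t + 3 * algebraMap ℂ L h) -
      z⁻¹ * γ * (3 * t + 6 * algebraMap ℂ L h) * g (t + algebraMap ℂ L h) +
      z * β * (3 * t ^ 2 + 6 * algebraMap ℂ L h * t) * g (t - algebraMap ℂ L h) +
      z ^ 3 * α * (4 * algebraMap ℂ L h ^ 2 * t - t ^ 3) * g (t - 3 * algebraMap ℂ L h) := by
  have h3 : z ^ (-3 : ℤ) = z⁻¹ ^ 3 := by
    rw [zpow_neg, inv_pow]
    norm_cast
  rw [cfD, map_add, map_add, map_sub]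
  simp only [LinearMap.sub_apply, Pi.sub_apply, LinearMap.add_apply, Pi.add_apply, op_mono, h3]
  simp [mul_assoc]

theorem op_ofNat {z : L} (hz : z ≠ 0) (n : ℕ) [n.AtLeastTwo] (g : L → L) (t : L) :
    op (algebraMap ℂ L h) hz ofNat(n) g t = ofNat(n) * g t := by
  rw [map_ofNat, Module.End.ofNat_apply, Pi.smul_apply, ofNat_smul_eq_nsmul, nsmul_eq_mul]
  rfl

/-- The shapes `cfA`, …, `cfD` are made so that `T` and `y` cancel at every `(v, r)` at once. Acting
on the constant function turns such an identity between noncommuting elements into one between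
rational functions of `z` and `t`; the later ones are checked in the same way. -/
theorem cubic_eq_algebraMap (v r α β γ δ : L) :
    xel h v r ^ 3 * cfA h α + 3 * xel h v r ^ 2 * yel h v * cfB h α β +
      3 * xel h v r * yel h v ^ 2 * cfC h α β γ + yel h v ^ 3 * cfD h α β γ δ =
    algebraMap L _ (α * r ^ 3 + 3 * β * r ^ 2 * v + 3 * γ * r * v ^ 2 + δ * v ^ 3) := by
  have : CharZero L := charZero_of_injective_algebraMap (algebraMap ℂ L).injective
  refine ShiftAlg.eq_of_op fun z hz t => ?_
  simp only [pow_succ, pow_zero, one_mul, map_add, map_mul, LinearMap.add_apply, Pi.add_apply,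
    Module.End.mul_apply, op_xel, op_yel, op_cfA, op_cfB, op_cfC, op_cfD, op_ofNat, op_algebraMap]
  field_simp
  ring

/-- The terms with powers of `h` cancel everything that depends on `y` and `T`, which leaves the
classical Hessian. -/
theorem hess_eq_algebraMap (v r α β γ δ : L) :
    xel h v r ^ 2 * (cfA h α * cfC h α β γ - cfB h α β ^ 2 - (2 * h) • (cfA h α * cfB h α β)
      + h ^ 2 • cfA h α ^ 2)
    + xel h v r * yel h v * (cfA h α * cfD h α β γ δ - cfB h α β * cfC h α β γ
      - h • (cfA h α * cfC h α β γ) + (2 * h ^ 2) • (cfA h α * cfB h α β) - h ^ 3 • cfA h α ^ 2)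
    + yel h v ^ 2 * (cfB h α β * cfD h α β γ δ - cfC h α β γ ^ 2
      - (2 * h) • (cfA h α * cfD h α β γ δ) + (3 * h ^ 2) • cfB h α β ^ 2
      - (3 * h ^ 3) • (cfA h α * cfB h α β) + (4 * h ^ 4) • cfA h α ^ 2) =
    algebraMap L _ ((α * γ - β ^ 2) * r ^ 2 + (α * δ - β * γ) * r * v + (β * δ - γ ^ 2) * v ^ 2) := by
  have : CharZero L := charZero_of_injective_algebraMap (algebraMap ℂ L).injective
  refine ShiftAlg.eq_of_op fun z hz t => ?_
  simp only [pow_succ, pow_zero, one_mul, map_add, map_sub, map_mul, LinearMap.add_apply,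
    Pi.add_apply, LinearMap.sub_apply, Pi.sub_apply, Module.End.mul_apply, op_xel, op_yel, op_cfA,
    op_cfB, op_cfC, op_cfD, op_smul, op_algebraMap, map_ofNat (algebraMap ℂ L)]
  field_simp
  ring

set_option maxHeartbeats 1000000 in
theorem disc_eq_algebraMap (α β γ δ : L) :
    -(cfA h α ^ 2 * cfD h α β γ δ ^ 2) + 6 * (cfA h α * cfB h α β * cfC h α β γ * cfD h α β γ δ) - 4 * (cfA h α * cfC h α β γ ^ 3)
    - 4 * (cfB h α β ^ 3 * cfD h α β γ δ) + 3 * (cfB h α β ^ 2 * cfC h α β γ ^ 2)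
  + (9 * h) • (-2 * (cfA h α * cfB h α β ^ 2 * cfD h α β γ δ) + cfA h α * cfB h α β * cfC h α β γ ^ 2 - cfA h α ^ 2 * cfC h α β γ * cfD h α β γ δ)
  + h ^ 2 • (-9 * cfB h α β ^ 4 + 40 * (cfA h α ^ 2 * cfB h α β * cfD h α β γ δ) - 7 * (cfA h α ^ 2 * cfC h α β γ ^ 2)
      + 12 * (cfA h α * cfB h α β ^ 2 * cfC h α β γ))
  + (6 * h ^ 3) • (-12 * (cfA h α ^ 3 * cfD h α β γ δ) - 6 * (cfA h α ^ 2 * cfB h α β * cfC h α β γ) - 11 * (cfA h α * cfB h α β ^ 3))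
  + (2 * h ^ 4) • (75 * (cfA h α ^ 2 * cfB h α β ^ 2) + 38 * (cfA h α ^ 3 * cfC h α β γ))
  - (384 * h ^ 5) • (cfA h α ^ 3 * cfB h α β) + (652 * h ^ 6) • cfA h α ^ 4 =
    algebraMap L _ (-(α ^ 2 * δ ^ 2) + 6 * α * β * γ * δ - 4 * α * γ ^ 3 - 4 * β ^ 3 * δ + 3 * β ^ 2 * γ ^ 2) := by
  have : CharZero L := charZero_of_injective_algebraMap (algebraMap ℂ L).injective
  refine ShiftAlg.eq_of_op fun z hz t => ?_
  rw [op_algebraMap]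
  simp only [pow_succ, pow_zero, one_mul, map_add, map_sub, map_mul, LinearMap.add_apply,
    Pi.add_apply, LinearMap.sub_apply, Pi.sub_apply, Module.End.mul_apply, op_cfA,
    op_cfB, op_cfC, op_cfD, op_ofNat, op_smul, map_ofNat (algebraMap ℂ L), map_neg,
    LinearMap.neg_apply, Pi.neg_apply]
  field_simp
  ring

/-- This and the next three identities show that the coefficients of `j` have again the shape forced
on an invariant cubic form, with the scalars of the classical cubic covariant. Thus `j` is evaluated
by `cubic_eq_algebraMap`. -/
theorem cubicCov_coeff_A (α β γ δ : L) :
    cfA h α ^ 2 * cfD h α β γ δ - 3 * (cfA h α * cfB h α β * cfC h α β γ) + 2 * cfB h α β ^ 3 + (9 * h) • (cfA h α * cfB h α β ^ 2)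
      - (2 * h ^ 2) • (cfA h α ^ 2 * cfB h α β) + (6 * h ^ 3) • cfA h α ^ 3 =
    cfA h (α ^ 2 * δ - 3 * α * β * γ + 2 * β ^ 3) := by
  have : CharZero L := charZero_of_injective_algebraMap (algebraMap ℂ L).injective
  refine ShiftAlg.eq_of_op fun z hz t => ?_
  simp only [pow_succ, pow_zero, one_mul, map_add, map_sub, map_mul, LinearMap.add_apply,
    Pi.add_apply, LinearMap.sub_apply, Pi.sub_apply, Module.End.mul_apply, op_cfA,
    op_cfB, op_cfC, op_cfD, op_ofNat, op_smul, map_ofNat (algebraMap ℂ L), map_neg,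
    LinearMap.neg_apply, Pi.neg_apply]
  field_simp
  ring

theorem cubicCov_coeff_B (α β γ δ : L) :
    3 * (cfA h α * cfB h α β * cfD h α β γ δ) - 6 * (cfA h α * cfC h α β γ ^ 2) + 3 * (cfB h α β ^ 2 * cfC h α β γ)
      - (9 * h) • (cfA h α ^ 2 * cfD h α β γ δ) + (12 * h) • (cfA h α * cfB h α β * cfC h α β γ) - (3 * h) • cfB h α β ^ 3
      - (6 * h ^ 2) • (cfA h α * cfB h α β ^ 2) - (12 * h ^ 3) • (cfA h α ^ 2 * cfB h α β) + (6 * h ^ 4) • cfA h α ^ 3 =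
    3 * cfB h (α ^ 2 * δ - 3 * α * β * γ + 2 * β ^ 3)
      (α * β * δ - 2 * α * γ ^ 2 + β ^ 2 * γ) := by
  have : CharZero L := charZero_of_injective_algebraMap (algebraMap ℂ L).injective
  refine ShiftAlg.eq_of_op fun z hz t => ?_
  simp only [pow_succ, pow_zero, one_mul, map_add, map_sub, map_mul, LinearMap.add_apply,
    Pi.add_apply, LinearMap.sub_apply, Pi.sub_apply, Module.End.mul_apply, op_cfA,
    op_cfB, op_cfC, op_cfD, op_ofNat, op_smul, map_ofNat (algebraMap ℂ L), map_neg,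
    LinearMap.neg_apply, Pi.neg_apply]
  field_simp
  ring

theorem cubicCov_coeff_C (α β γ δ : L) :
    -3 * (cfA h α * cfC h α β γ * cfD h α β γ δ) + 6 * (cfB h α β ^ 2 * cfD h α β γ δ) - 3 * (cfB h α β * cfC h α β γ ^ 2)
      - (6 * h) • (cfA h α * cfB h α β * cfD h α β γ δ) + (9 * h) • (cfA h α * cfC h α β γ ^ 2) - (3 * h) • (cfB h α β ^ 2 * cfC h α β γ)
      + (30 * h ^ 2) • (cfA h α ^ 2 * cfD h α β γ δ) - (12 * h ^ 2) • (cfA h α * cfB h α β * cfC h α β γ)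
      + (12 * h ^ 2) • cfB h α β ^ 3 - (12 * h ^ 3) • (cfA h α * cfB h α β ^ 2)
      + (60 * h ^ 4) • (cfA h α ^ 2 * cfB h α β) - (90 * h ^ 5) • cfA h α ^ 3 =
    3 * cfC h (α ^ 2 * δ - 3 * α * β * γ + 2 * β ^ 3)
      (α * β * δ - 2 * α * γ ^ 2 + β ^ 2 * γ) (-(α * γ * δ) + 2 * β ^ 2 * δ - β * γ ^ 2) := by
  have : CharZero L := charZero_of_injective_algebraMap (algebraMap ℂ L).injective
  refine ShiftAlg.eq_of_op fun z hz t => ?_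
  simp only [pow_succ, pow_zero, one_mul, map_add, map_sub, map_mul, LinearMap.add_apply,
    Pi.add_apply, LinearMap.sub_apply, Pi.sub_apply, Module.End.mul_apply, op_cfA,
    op_cfB, op_cfC, op_cfD, op_ofNat, op_smul, map_ofNat (algebraMap ℂ L), map_neg,
    LinearMap.neg_apply, Pi.neg_apply]
  field_simp
  ring

theorem cubicCov_coeff_D (α β γ δ : L) :
    -(cfA h α * cfD h α β γ δ ^ 2) + 3 * (cfB h α β * cfC h α β γ * cfD h α β γ δ) - 2 * cfC h α β γ ^ 3
      - (15 * h) • (cfB h α β ^ 2 * cfD h α β γ δ) + (6 * h) • (cfB h α β * cfC h α β γ ^ 2)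
      + (36 * h ^ 2) • (cfA h α * cfB h α β * cfD h α β γ δ) - (8 * h ^ 2) • (cfA h α * cfC h α β γ ^ 2)
      + (6 * h ^ 2) • (cfB h α β ^ 2 * cfC h α β γ) - (102 * h ^ 3) • (cfA h α ^ 2 * cfD h α β γ δ)
      - (18 * h ^ 3) • (cfA h α * cfB h α β * cfC h α β γ) - (42 * h ^ 3) • cfB h α β ^ 3
      + (38 * h ^ 4) • (cfA h α ^ 2 * cfC h α β γ) + (126 * h ^ 4) • (cfA h α * cfB h α β ^ 2)
      - (378 * h ^ 5) • (cfA h α ^ 2 * cfB h α β) + (704 * h ^ 6) • cfA h α ^ 3 =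
    cfD h (α ^ 2 * δ - 3 * α * β * γ + 2 * β ^ 3)
      (α * β * δ - 2 * α * γ ^ 2 + β ^ 2 * γ) (-(α * γ * δ) + 2 * β ^ 2 * δ - β * γ ^ 2)
      (-(α * δ ^ 2) + 3 * β * γ * δ - 2 * γ ^ 3) := by
  have : CharZero L := charZero_of_injective_algebraMap (algebraMap ℂ L).injective
  refine ShiftAlg.eq_of_op fun z hz t => ?_
  simp only [pow_succ, pow_zero, one_mul, map_add, map_sub, map_mul, LinearMap.add_apply,
    Pi.add_apply, LinearMap.sub_apply, Pi.sub_apply, Module.End.mul_apply, op_cfA,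
    op_cfB, op_cfC, op_cfD, op_ofNat, op_smul, map_ofNat (algebraMap ℂ L), map_neg,
    LinearMap.neg_apply, Pi.neg_apply]
  field_simp
  ring

end CubicCoeff
end NCForms

namespace NCForms

/-! ## Realisation of an invariant cubic form and its covariants -/

section Realisation

variable {L : Type u} [Field L] [Algebra ℂ L] {h : ℂ} {I : Type u} [LinearOrder I]

theorem polDer_algebraMap (k l : I) (c : ℂ) : polDer k l (algebraMap ℂ (HAlg h I) c) = 0 := by
  have h1 : polDer k l (1 : HAlg h I) = 0 := by
    have := polDer_mul k l (1 : HAlg h I) 1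
    simpa using this
  have hc : algebraMap ℂ (HAlg h I) c = c • 1 := Algebra.algebraMap_eq_smul_one c
  rw [hc, map_smul, h1, smul_zero]

theorem polDer_eq_zero {S : Set I} {k : I} (hk : k ∉ S) (l : I) {a : HAlg h I} (ha : a ∈ sub h S) :
    polDer k l a = 0 := by
  refine Algebra.adjoin_induction (p := fun a _ => polDer k l a = 0) ?_ ?_ ?_ ?_ ha
  · rintro _ (⟨i, hi, rfl⟩ | ⟨i, hi, rfl⟩)
    · rw [polDer_x, if_neg (by rintro rfl; exact hk hi)]
    · rw [polDer_y, if_neg (by rintro rfl; exact hk hi)]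
  · exact polDer_algebraMap k l
  · intro a b _ _ ha hb; rw [map_add, ha, hb, add_zero]
  · intro a b _ _ ha hb; rw [polDer_mul, ha, hb, zero_mul, mul_zero, add_zero]

theorem sub_mono {S S' : Set I} (hS : S ⊆ S') : sub h S ≤ sub h S' :=
  Algebra.adjoin_mono (Set.union_subset_union (Set.image_mono hS) (Set.image_mono hS))

theorem x_mem_sub {S : Set I} {i : I} (hi : i ∈ S) : x i ∈ sub h S :=
  Algebra.subset_adjoin (Or.inl ⟨i, hi, rfl⟩)

theorem y_mem_sub {S : Set I} {i : I} (hi : i ∈ S) : y i ∈ sub h S :=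
  Algebra.subset_adjoin (Or.inr ⟨i, hi, rfl⟩)

/-- The cubic form with given coefficients in the variables with index `i`. -/
noncomputable def cubicAt (i : I) (A B C D : HAlg h I) : HAlg h I :=
  x i ^ 3 * A + 3 * x i ^ 2 * y i * B + 3 * x i * y i ^ 2 * C + y i ^ 3 * D

/-- The quadratic form with given coefficients in the variables with index `i`. -/
noncomputable def quadAt (i : I) (a b c : HAlg h I) : HAlg h I :=
  x i ^ 2 * a + x i * y i * b + y i ^ 2 * c

/-- The form with given coefficients which is linear in the index `o` and quadratic in `p`. -/
noncomputable def mixedAt (o p : I) (A B C D : HAlg h I) : HAlg h I :=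
  (1 / 3 : ℂ) • ((x o * x p * x p + x p * x o * x p + x p * x p * x o) * A) +
    (x o * x p * y p + x p * x o * y p + x p * x p * y o) * B +
    (x o * y p * y p + x p * y o * y p + x p * y p * y o) * C + y o * y p * y p * D

theorem ofNat_mul_eq_smul (n : ℕ) [n.AtLeastTwo] (a : HAlg h I) :
    ofNat(n) * a = (ofNat(n) : ℂ) • a := by
  rw [← map_ofNat (algebraMap ℂ (HAlg h I)), ← Algebra.smul_def]

theorem yy_left (i j : I) (a : HAlg h I) : y i * (y j * a) = y j * (y i * a) := by
  rw [← mul_assoc, yy i j, mul_assoc]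

variable {o p : I} {A B C D : HAlg h I}

/-- The derivation kills coefficients free of the index `o`, so only the explicit variables are
polarised. The `x`'s do not commute, whence `mixedAt` keeps all positions of `x o`. -/
theorem polar_polar_cubicAt (hop : o ≠ p) (hA : A ∈ sub h {o}ᶜ) (hB : B ∈ sub h {o}ᶜ)
    (hC : C ∈ sub h {o}ᶜ) (hD : D ∈ sub h {o}ᶜ) :
    polar 2 o p (polar 3 o p (cubicAt o A B C D)) = mixedAt o p A B C D := by
  have ho : o ∉ ({o}ᶜ : Set I) := fun H => H rfl
  simp only [polar, cubicAt, mixedAt, map_add, map_smul, polDer_mul, polDer_x, polDer_y,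
    pow_succ, pow_zero, one_mul, if_true, hop.symm, if_false, polDer_eq_zero ho _ hA,
    polDer_eq_zero ho _ hB, polDer_eq_zero ho _ hC, polDer_eq_zero ho _ hD,
    zero_mul, mul_zero, zero_add, add_zero, add_mul, mul_add, mul_assoc, ofNat_mul_eq_smul,
    smul_mul_assoc, mul_smul_comm, smul_add, yy o p, yy_left o p]
  push_cast
  module

theorem polar_mixedAt (hop : o ≠ p) (hA : A ∈ sub h {o}ᶜ) (hB : B ∈ sub h {o}ᶜ)
    (hC : C ∈ sub h {o}ᶜ) (hD : D ∈ sub h {o}ᶜ) :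
    polar 1 o p (mixedAt o p A B C D) = cubicAt p A B C D := by
  have ho : o ∉ ({o}ᶜ : Set I) := fun H => H rfl
  simp only [polar, cubicAt, mixedAt, map_add, map_smul, polDer_mul, polDer_x, polDer_y,
    pow_succ, pow_zero, one_mul, if_true, hop.symm, if_false, polDer_eq_zero ho _ hA,
    polDer_eq_zero ho _ hB, polDer_eq_zero ho _ hC, polDer_eq_zero ho _ hD,
    zero_mul, mul_zero, zero_add, add_zero, add_mul, mul_add, mul_assoc, ofNat_mul_eq_smul,
    smul_mul_assoc, mul_smul_comm, smul_add]
  push_cast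
  module

/-- Polarising once from `p` and twice from `o` gives the same sum over positions; this is why `ξ`
is recovered from `f₁`. -/
theorem polar_cubicAt (hA : A ∈ sub h {p}ᶜ) (hB : B ∈ sub h {p}ᶜ)
    (hC : C ∈ sub h {p}ᶜ) (hD : D ∈ sub h {p}ᶜ) :
    polar 3 p o (cubicAt p A B C D) = mixedAt o p A B C D := by
  have ho : p ∉ ({p}ᶜ : Set I) := fun H => H rfl
  simp only [polar, cubicAt, mixedAt, map_add, map_smul, polDer_mul, polDer_x, polDer_y,
    pow_succ, pow_zero, one_mul, if_true, polDer_eq_zero ho _ hA,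
    polDer_eq_zero ho _ hB, polDer_eq_zero ho _ hC, polDer_eq_zero ho _ hD,
    zero_mul, mul_zero, zero_add, add_zero, add_mul, mul_add, mul_assoc, ofNat_mul_eq_smul,
    smul_mul_assoc, mul_smul_comm, smul_add, yy o p, yy_left o p]
  push_cast
  module

theorem polar_polar_quadAt (hop : o ≠ p) (hA : A ∈ sub h {o}ᶜ) (hB : B ∈ sub h {o}ᶜ)
    (hC : C ∈ sub h {o}ᶜ) :
    polar 1 o p (polar 2 o p (quadAt o A B C)) = quadAt p A B C := by
  have ho : o ∉ ({o}ᶜ : Set I) := fun H => H rfl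
  simp only [polar, quadAt, map_add, map_smul, polDer_mul, polDer_x, polDer_y,
    pow_succ, pow_zero, one_mul, if_true, hop.symm, if_false, polDer_eq_zero ho _ hA,
    polDer_eq_zero ho _ hB, polDer_eq_zero ho _ hC, zero_mul, mul_zero, zero_add, add_zero,
    add_mul, mul_add, mul_assoc]
  push_cast
  module

/-- The values of the polarised cubic form. -/
theorem mixed_eq_algebraMap (v r v' r' α β γ δ : L) :
    (1 / 3 : ℂ) • ((xel h v r * xel h v' r' * xel h v' r' + xel h v' r' * xel h v r * xel h v' r' +
        xel h v' r' * xel h v' r' * xel h v r) * cfA h α) +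
      (xel h v r * xel h v' r' * yel h v' + xel h v' r' * xel h v r * yel h v' +
        xel h v' r' * xel h v' r' * yel h v) * cfB h α β +
      (xel h v r * yel h v' * yel h v' + xel h v' r' * yel h v * yel h v' +
        xel h v' r' * yel h v' * yel h v) * cfC h α β γ +
      yel h v * yel h v' * yel h v' * cfD h α β γ δ =
    algebraMap L _ (r * (α * r' ^ 2 + 2 * β * r' * v' + γ * v' ^ 2) +
      v * (β * r' ^ 2 + 2 * γ * r' * v' + δ * v' ^ 2)) := by
  have : CharZero L := charZero_of_injective_algebraMap (algebraMap ℂ L).injective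
  refine ShiftAlg.eq_of_op fun z hz t => ?_
  rw [op_algebraMap]
  simp only [map_add, map_sub, map_mul, LinearMap.add_apply, Pi.add_apply,
    Module.End.mul_apply, op_xel, op_yel, op_cfA, op_cfB, op_cfC, op_cfD, op_smul, map_div₀,
    map_one, map_ofNat (algebraMap ℂ L)]
  field_simp
  ring

/-- This and `gamma_eq_xel` explain the terms in `h` in `δ` and `γ`: the pair `(γ, δ)` is realised
with the same shape as `(x_i, y_i)`, its parameters being the two coefficients of the polarised form
up to sign. -/
theorem delta_eq_yel (v r α β γ : L) :
    xel h v r ^ 2 * cfA h α + xel h v r * yel h v * (2 * cfB h α β - h • cfA h α)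
      + yel h v ^ 2 * (cfC h α β γ - h • cfB h α β + h ^ 2 • cfA h α) =
    yel h (α * r ^ 2 + 2 * β * r * v + γ * v ^ 2) := by
  have : CharZero L := charZero_of_injective_algebraMap (algebraMap ℂ L).injective
  refine ShiftAlg.eq_of_op fun z hz t => ?_
  simp only [pow_succ, pow_zero, one_mul, map_add, map_sub, map_mul, LinearMap.add_apply,
    Pi.add_apply, LinearMap.sub_apply, Pi.sub_apply, Module.End.mul_apply, op_xel, op_yel, op_cfA,
    op_cfB, op_cfC, op_smul, op_ofNat, map_ofNat (algebraMap ℂ L)]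
  field_simp
  ring

theorem gamma_eq_xel (v r α β γ δ : L) :
    -(xel h v r ^ 2 * (cfB h α β + (2 * h) • cfA h α)) -
        xel h v r * yel h v * (2 * cfC h α β γ + (5 * h) • cfB h α β)
      - yel h v ^ 2 * (cfD h α β γ δ + (3 * h) • cfC h α β γ) =
    xel h (α * r ^ 2 + 2 * β * r * v + γ * v ^ 2) (-(β * r ^ 2 + 2 * γ * r * v + δ * v ^ 2)) := by
  have : CharZero L := charZero_of_injective_algebraMap (algebraMap ℂ L).injective
  refine ShiftAlg.eq_of_op fun z hz t => ?_
  simp only [pow_succ, pow_zero, one_mul, map_add, map_sub, map_mul, LinearMap.add_apply,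
    Pi.add_apply, LinearMap.sub_apply, Pi.sub_apply, Module.End.mul_apply, op_xel, op_yel, op_cfA,
    op_cfB, op_cfC, op_cfD, op_smul, op_ofNat, map_ofNat (algebraMap ℂ L), map_neg,
    LinearMap.neg_apply, Pi.neg_apply]
  field_simp
  ring

theorem bracket_eq_algebraMap (v r v' r' : L) :
    xel h v r * yel h v' - yel h v * xel h v' r' - h • (yel h v * yel h v') =
      algebraMap L _ (r * v' - v * r') := by
  have : CharZero L := charZero_of_injective_algebraMap (algebraMap ℂ L).injective
  refine ShiftAlg.eq_of_op fun z hz t => ?_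
  rw [op_algebraMap]
  simp only [map_sub, map_mul, LinearMap.sub_apply, Pi.sub_apply, Module.End.mul_apply, op_xel,
    op_yel, op_smul]
  field_simp
  ring

theorem cfA_injective : Function.Injective (cfA (L := L) h) := fun a b hab => by
  have := congrArg (cf 3) hab
  rwa [cfA, cfA, cf_mono, cf_mono, if_pos rfl, if_pos rfl, C_inj] at this

/-- Interpolation without commutativity. Once `A = 0`, the combination `H3 - H4 - 2 H2` isolates `6
W² Y B`; then `H3 - H2` isolates `3 W Y² C`, and `H2` is left with `Y³ D`. -/
theorem cubic_coeff_eq_zero {R : Type u} [Ring R] [NoZeroDivisors R] {V W Y A B C D : R}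
    (h2 : (2 : R) ≠ 0) (h3 : (3 : R) ≠ 0) (hW : W ≠ 0) (hY : Y ≠ 0) (H1 : W ^ 3 * A = 0)
    (H2 : V ^ 3 * A + 3 * V ^ 2 * Y * B + 3 * V * Y ^ 2 * C + Y ^ 3 * D = 0)
    (H3 : (V + W) ^ 3 * A + 3 * (V + W) ^ 2 * Y * B + 3 * (V + W) * Y ^ 2 * C + Y ^ 3 * D = 0)
    (H4 : (-V + W) ^ 3 * A + 3 * (-V + W) ^ 2 * -Y * B + 3 * (-V + W) * (-Y) ^ 2 * C +
      (-Y) ^ 3 * D = 0) : A = 0 ∧ B = 0 ∧ C = 0 ∧ D = 0 := by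
  have hA : A = 0 := (mul_eq_zero.mp H1).resolve_left (pow_ne_zero _ hW)
  subst hA
  have hB : B = 0 := by
    have : 3 * (2 * (W * (W * (Y * B)))) = 0 := by
      linear_combination (norm := noncomm_ring) H3 - H4 - 2 * H2
    simpa [h2, h3, hW, hY] using this
  subst hB
  have hC : C = 0 := by
    have : 3 * (W * (Y * (Y * C))) = 0 := by
      linear_combination (norm := noncomm_ring) H3 - H2
    simpa [h2, h3, hW, hY] using this
  subst hC
  exact ⟨rfl, rfl, rfl, by simpa [hY] using H2⟩

theorem psi_update (o : I) (v r : I → L) (v' r' : L) {a : HAlg h I} (ha : a ∈ sub h {o}ᶜ) :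
    psi (Function.update v o v') (Function.update r o r') a = psi v r a := by
  classical
  refine psi_congr (S := {o}ᶜ) (fun i hi => ?_) (fun i hi => ?_) ha
  · exact Function.update_of_ne (show i ≠ o from hi) _ _
  · exact Function.update_of_ne (show i ≠ o from hi) _ _

/-- The realisations of the coefficients of an invariant cubic form. -/
theorem exists_coeff (hh : h ≠ 0) (hA : A ∈ sub h {o}ᶜ) (hB : B ∈ sub h {o}ᶜ)
    (hC : C ∈ sub h {o}ᶜ) (hD : D ∈ sub h {o}ᶜ) (hinv : IsInvariant (cubicAt o A B C D))
    (v r : I → L) : ∃ α β γ δ : L, psi v r A = cfA h α ∧ psi v r B = cfB h α β ∧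
      psi v r C = cfC h α β γ ∧ psi v r D = cfD h α β γ δ := by
  classical
  have : CharZero L := charZero_of_injective_algebraMap (algebraMap ℂ L).injective
  have hinj := FaithfulSMul.algebraMap_injective L (ShiftAlg (algebraMap ℂ L h))
  have h3 : (3 : ShiftAlg (algebraMap ℂ L h)) ≠ 0 := by
    rw [← map_ofNat (algebraMap L (ShiftAlg (algebraMap ℂ L h)))]
    exact (_root_.map_ne_zero_iff _ hinj).mpr (by norm_num)
  have h2 : (2 : ShiftAlg (algebraMap ℂ L h)) ≠ 0 := by
    rw [← map_ofNat (algebraMap L (ShiftAlg (algebraMap ℂ L h)))]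
    exact (_root_.map_ne_zero_iff _ hinj).mpr (by norm_num)
  have hR : xel h (0 : L) 1 ≠ 0 := fun e => by
    have := congrArg (cf (-1)) e
    simp [xel, cf_mono, mono_zero] at this
  have hY : yel h (1 : L) ≠ 0 := yel_ne_zero one_ne_zero
  -- Changing the parameters at `o` does not affect the images of the coefficients, and the
  -- invariant form stays a scalar.
  have hval : ∀ v' r' : L, ∃ l : L, xel h v' r' ^ 3 * psi v r A +
      3 * xel h v' r' ^ 2 * yel h v' * psi v r B + 3 * xel h v' r' * yel h v' ^ 2 * psi v r C +
      yel h v' ^ 3 * psi v r D = algebraMap L _ l := fun v' r' => by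
    obtain ⟨l, hl⟩ := hinv.exists_psi_eq hh (Function.update v o v') (Function.update r o r')
    have hc := fun a ha => psi_update (h := h) o v r v' r' (a := a) ha
    refine ⟨l, ?_⟩
    rw [← hl, cubicAt]
    simp only [map_add, map_mul, map_pow, map_ofNat, psi_x, psi_y, Function.update_self, hc _ hA,
      hc _ hB, hc _ hC, hc _ hD]
  choose l hl using hval
  -- The four scalars are interpolated from the values of the form at `(v, r) = (0, 1), (1, 0), (1,
  -- 1), (-1, 1)`. The form with the expected coefficients takes the same values there, so the
  -- differences of the coefficients vanish.
  set α := l 0 1 with hα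
  set δ := l 1 0 with hδ
  set β := (l 1 1 - l (-1) 1 - 2 * δ) / 6 with hβ
  set γ := (l 1 1 + l (-1) 1 - 2 * α) / 6 with hγ
  refine ⟨α, β, γ, δ, ?_⟩
  have hdiff : ∀ v' r' : L, α * r' ^ 3 + 3 * β * r' ^ 2 * v' + 3 * γ * r' * v' ^ 2 + δ * v' ^ 3 =
      l v' r' → xel h v' r' ^ 3 * (psi v r A - cfA h α) +
      3 * xel h v' r' ^ 2 * yel h v' * (psi v r B - cfB h α β) +
      3 * xel h v' r' * yel h v' ^ 2 * (psi v r C - cfC h α β γ) +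
      yel h v' ^ 3 * (psi v r D - cfD h α β γ δ) = 0 := fun v' r' e => by
    have e1 := hl v' r'
    rw [← e, ← cubic_eq_algebraMap] at e1
    rw [← sub_eq_zero] at e1
    rw [← e1]
    simp only [mul_sub]
    abel
  have hx1 : xel h (1 : L) 1 = xel h 1 0 + xel h 0 1 := by simp [xel, mono_zero]
  have hx2 : xel h (-1 : L) 1 = -xel h 1 0 + xel h 0 1 := by
    have e := mono_sub (h := algebraMap ℂ L h) 1 0 (X - Polynomial.C (algebraMap ℂ L h))
    rw [mono_zero, zero_sub, zero_sub, neg_sub] at e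
    simp [xel, mono_zero, e]
  have hy2 : yel h (-1 : L) = -yel h 1 := by
    have e := mono_sub (h := algebraMap ℂ L h) 1 0 (Polynomial.C 1)
    rw [mono_zero, zero_sub, zero_sub, ← C_neg] at e
    exact e
  have hy0 : yel h (0 : L) = 0 := by simp [yel, mono_zero]
  have H1 := hdiff 0 1 (by ring)
  have H2 := hdiff 1 0 (by ring)
  have H3 := hdiff 1 1 (by rw [hβ, hγ]; field_simp; ring)
  have H4 := hdiff (-1) 1 (by rw [hβ, hγ]; field_simp; ring)
  simp only [hy0, ne_eq, OfNat.ofNat_ne_zero, not_false_eq_true, zero_pow, mul_zero, zero_mul,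
    add_zero] at H1
  rw [hx1] at H3
  rw [hx2, hy2] at H4
  obtain ⟨e1, e2, e3, e4⟩ := cubic_coeff_eq_zero h2 h3 hR hY H1 H2 H3 H4
  exact ⟨sub_eq_zero.mp e1, sub_eq_zero.mp e2, sub_eq_zero.mp e3, sub_eq_zero.mp e4⟩

end Realisation
end NCForms

namespace NCForms

/-! ### Commutative values of a cubic form and its covariants -/

section CubicReal

variable {L : Type u} [Field L]

/-- The value of the cubic form with coefficients `α, 3 β, 3 γ, δ`. -/
def cubicVal (α β γ δ v r : L) : L :=
  α * r ^ 3 + 3 * β * r ^ 2 * v + 3 * γ * r * v ^ 2 + δ * v ^ 3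

/-- The value of the Hessian. -/
def hessVal (α β γ δ v r : L) : L :=
  (α * γ - β ^ 2) * r ^ 2 + (α * δ - β * γ) * r * v + (β * δ - γ ^ 2) * v ^ 2

/-- The value of the discriminant. -/
def discVal (α β γ δ : L) : L :=
  -(α ^ 2 * δ ^ 2) + 6 * α * β * γ * δ - 4 * α * γ ^ 3 - 4 * β ^ 3 * δ + 3 * β ^ 2 * γ ^ 2

/-- The value of the cubic covariant. -/
def covVal (α β γ δ v r : L) : L :=
  cubicVal (α ^ 2 * δ - 3 * α * β * γ + 2 * β ^ 3) (α * β * δ - 2 * α * γ ^ 2 + β ^ 2 * γ)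
    (-(α * γ * δ) + 2 * β ^ 2 * δ - β * γ ^ 2) (-(α * δ ^ 2) + 3 * β * γ * δ - 2 * γ ^ 3) v r

/-- The first coefficient of the polarised form. -/
def polVal₁ (α β γ v r : L) : L := α * r ^ 2 + 2 * β * r * v + γ * v ^ 2

variable [Algebra ℂ L] {h : ℂ} {I : Type u} [LinearOrder I] {o p : I}

namespace CubicForm

variable (f : CubicForm h o p)

/-- The coefficients of a cubic form are realised with the scalars `α, β, γ, δ`. -/
structure Real (v r : I → L) (α β γ δ : L) : Prop where
  hA : psi v r f.A = cfA h α
  hB : psi v r f.B = cfB h α β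
  hC : psi v r f.C = cfC h α β γ
  hD : psi v r f.D = cfD h α β γ δ

theorem mem_left {a : HAlg h I} (ha : a ∈ sub h {o, p}ᶜ) : a ∈ sub h {o}ᶜ :=
  sub_mono (Set.compl_subset_compl.mpr (by simp)) ha

theorem mem_right {a : HAlg h I} (ha : a ∈ sub h {o, p}ᶜ) : a ∈ sub h {p}ᶜ :=
  sub_mono (Set.compl_subset_compl.mpr (by simp)) ha

theorem form_eq : f.form = cubicAt o f.A f.B f.C f.D := rfl

theorem exists_real (hh : h ≠ 0) (v r : I → L) : ∃ α β γ δ, f.Real v r α β γ δ := by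
  obtain ⟨α, β, γ, δ, h1, h2, h3, h4⟩ := exists_coeff hh (mem_left f.A_mem) (mem_left f.B_mem)
    (mem_left f.C_mem) (mem_left f.D_mem) f.invariant v r
  exact ⟨α, β, γ, δ, h1, h2, h3, h4⟩

theorem xi_eq (hop : o ≠ p) : f.xi = mixedAt o p f.A f.B f.C f.D :=
  polar_polar_cubicAt hop (mem_left f.A_mem) (mem_left f.B_mem) (mem_left f.C_mem)
    (mem_left f.D_mem)

theorem f₁_eq (hop : o ≠ p) : f.f₁ = cubicAt p f.A f.B f.C f.D := by
  rw [f₁, f.xi_eq hop]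
  exact polar_mixedAt hop (mem_left f.A_mem) (mem_left f.B_mem) (mem_left f.C_mem)
    (mem_left f.D_mem)

theorem polar_f₁ (hop : o ≠ p) : polar 3 p o f.f₁ = f.xi := by
  rw [f.xi_eq hop, f.f₁_eq hop]
  exact polar_cubicAt (mem_right f.A_mem) (mem_right f.B_mem) (mem_right f.C_mem)
    (mem_right f.D_mem)

/-- The point `(v', r')` is independent of the parameters used for the coefficients, so the same
coefficients serve for the Hessian at `o` and for its polarisation at `p`. -/
theorem hess_coeffs : ∃ a b c : HAlg h I, a ∈ sub h {o}ᶜ ∧ b ∈ sub h {o}ᶜ ∧ c ∈ sub h {o}ᶜ ∧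
    f.hessian = quadAt o a b c ∧ ∀ (v r : I → L) (α β γ δ : L), f.Real v r α β γ δ →
      ∀ v' r' : L, xel h v' r' ^ 2 * psi v r a + xel h v' r' * yel h v' * psi v r b +
        yel h v' ^ 2 * psi v r c = algebraMap L _ (hessVal α β γ δ v' r') := by
  have hA := mem_left f.A_mem
  have hB := mem_left f.B_mem
  have hC := mem_left f.C_mem
  have hD := mem_left f.D_mem
  refine ⟨_, _, _, ?_, ?_, ?_, rfl, fun v r α β γ δ hr v' r' => ?_⟩
  case refine_4 =>
    simp only [map_add, map_sub, map_mul, map_pow, map_smul, hr.hA, hr.hB, hr.hC, hr.hD]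
    exact hess_eq_algebraMap v' r' α β γ δ
  all_goals repeat first
    | assumption
    | apply Subalgebra.add_mem
    | apply Subalgebra.sub_mem
    | apply Subalgebra.smul_mem
    | apply Subalgebra.neg_mem
    | apply Subalgebra.pow_mem
    | apply Subalgebra.mul_mem
    | exact ofNat_mem _ _

theorem cov_coeffs : ∃ a b c d : HAlg h I, a ∈ sub h {o}ᶜ ∧ b ∈ sub h {o}ᶜ ∧ c ∈ sub h {o}ᶜ ∧
    d ∈ sub h {o}ᶜ ∧ f.cubicCov = cubicAt o a b c d ∧ ∀ (v r : I → L) (α β γ δ : L),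
      f.Real v r α β γ δ → ∀ v' r' : L, xel h v' r' ^ 3 * psi v r a +
        3 * xel h v' r' ^ 2 * yel h v' * psi v r b + 3 * xel h v' r' * yel h v' ^ 2 * psi v r c +
        yel h v' ^ 3 * psi v r d = algebraMap L _ (covVal α β γ δ v' r') := by
  have hA := mem_left f.A_mem
  have hB := mem_left f.B_mem
  have hC := mem_left f.C_mem
  have hD := mem_left f.D_mem
  -- The middle coefficients of `j` are given with their binomial factor included. Dividing by `3`
  -- brings `j` to the normal form `cubicAt`, and `key'` undoes this after realisation.
  have key : ∀ u w a : HAlg h I, u * w * a = 3 * u * w * ((1 / 3 : ℂ) • a) := fun u w a => by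
    rw [mul_smul_comm, mul_assoc 3, mul_assoc 3, ← map_ofNat (algebraMap ℂ (HAlg h I)),
      ← Algebra.smul_def, smul_smul]
    norm_num
  have key' : ∀ a : ShiftAlg (algebraMap ℂ L h), (1 / 3 : ℂ) • (3 * a) = a := fun a => by
    rw [← map_ofNat (algebraMap L (ShiftAlg (algebraMap ℂ L h))),
      ← map_ofNat (algebraMap ℂ L), ← IsScalarTower.algebraMap_apply, ← Algebra.smul_def, smul_smul]
    norm_num
  unfold cubicCov
  rw [key (x o ^ 2) (y o), key (x o) (y o ^ 2)]
  refine ⟨_, _, _, _, ?_, ?_, ?_, ?_, rfl, fun v r α β γ δ hr v' r' => ?_⟩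
  case refine_5 =>
    simp only [map_add, map_sub, map_mul, map_pow, map_smul, map_ofNat, map_neg, hr.hA, hr.hB,
      hr.hC, hr.hD]
    rw [cubicCov_coeff_A, cubicCov_coeff_B, cubicCov_coeff_C, cubicCov_coeff_D, key', key']
    exact cubic_eq_algebraMap v' r' _ _ _ _
  all_goals repeat first
    | assumption
    | apply Subalgebra.add_mem
    | apply Subalgebra.sub_mem
    | apply Subalgebra.smul_mem
    | apply Subalgebra.neg_mem
    | apply Subalgebra.pow_mem
    | apply Subalgebra.mul_mem
    | exact ofNat_mem _ _

section Values

variable {f} {v r : I → L} {α β γ δ : L} (hr : f.Real v r α β γ δ)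

include hr

theorem Real.form : psi v r f.form = algebraMap L _ (cubicVal α β γ δ (v o) (r o)) := by
  simp only [form_eq, cubicAt, map_add, map_mul, map_pow, map_ofNat, psi_x, psi_y, hr.hA, hr.hB,
    hr.hC, hr.hD]
  exact cubic_eq_algebraMap _ _ _ _ _ _

theorem Real.f₁ (hop : o ≠ p) :
    psi v r f.f₁ = algebraMap L _ (cubicVal α β γ δ (v p) (r p)) := by
  simp only [f.f₁_eq hop, cubicAt, map_add, map_mul, map_pow, map_ofNat, psi_x, psi_y, hr.hA,
    hr.hB, hr.hC, hr.hD]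
  exact cubic_eq_algebraMap _ _ _ _ _ _

theorem Real.xi (hop : o ≠ p) :
    psi v r f.xi = algebraMap L _ (r o * polVal₁ α β γ (v p) (r p) +
      v o * polVal₁ β γ δ (v p) (r p)) := by
  refine Eq.trans ?_ (mixed_eq_algebraMap _ _ _ _ _ _ _ _)
  simp only [f.xi_eq hop, mixedAt, map_add, map_mul, map_smul, psi_x, psi_y, hr.hA,
    hr.hB, hr.hC, hr.hD]

theorem Real.eta : psi v r f.eta = algebraMap L _ (r o * v p - v o * r p) := by
  refine Eq.trans ?_ (bracket_eq_algebraMap _ _ _ _)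
  simp only [CubicForm.eta, bracket, map_sub, map_mul, map_smul, psi_x, psi_y]

theorem Real.delta : psi v r f.delta = yel h (polVal₁ α β γ (v p) (r p)) := by
  simp only [CubicForm.delta, map_add, map_sub, map_mul, map_pow, map_smul, map_ofNat, psi_x, psi_y,
    hr.hA, hr.hB, hr.hC]
  exact delta_eq_yel (L := L) _ _ _ _ _

theorem Real.gamma : psi v r f.gamma =
    xel h (polVal₁ α β γ (v p) (r p)) (-polVal₁ β γ δ (v p) (r p)) := by
  simp only [CubicForm.gamma, map_add, map_sub, map_neg, map_mul, map_pow, map_smul, map_ofNat,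
    psi_x, psi_y, hr.hA, hr.hB, hr.hC, hr.hD]
  exact gamma_eq_xel (L := L) _ _ _ _ _ _

theorem Real.disc : psi v r f.disc = algebraMap L _ (discVal α β γ δ) := by
  simp only [CubicForm.disc, map_add, map_sub, map_neg, map_mul, map_pow, map_smul, map_ofNat,
    hr.hA, hr.hB, hr.hC, hr.hD]
  exact disc_eq_algebraMap _ _ _ _

theorem Real.hessian :
    psi v r f.hessian = algebraMap L _ (hessVal α β γ δ (v o) (r o)) := by
  obtain ⟨a, b, c, -, -, -, e, H⟩ := f.hess_coeffs (L := L)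
  rw [← H v r α β γ δ hr, e]
  simp only [quadAt, map_add, map_mul, map_pow, psi_x, psi_y]

theorem Real.hessian₁ (hop : o ≠ p) :
    psi v r f.hessian₁ = algebraMap L _ (hessVal α β γ δ (v p) (r p)) := by
  obtain ⟨a, b, c, ha, hb, hc, e, H⟩ := f.hess_coeffs (L := L)
  rw [← H v r α β γ δ hr, CubicForm.hessian₁, e, polar_polar_quadAt hop ha hb hc]
  simp only [quadAt, map_add, map_mul, map_pow, psi_x, psi_y]

theorem Real.cubicCov :
    psi v r f.cubicCov = algebraMap L _ (covVal α β γ δ (v o) (r o)) := by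
  obtain ⟨a, b, c, d, -, -, -, -, e, H⟩ := f.cov_coeffs (L := L)
  rw [← H v r α β γ δ hr, e]
  simp only [cubicAt, map_add, map_mul, map_pow, map_ofNat, psi_x, psi_y]

theorem Real.cubicCov₁ (hop : o ≠ p) :
    psi v r f.cubicCov₁ = algebraMap L _ (covVal α β γ δ (v p) (r p)) := by
  obtain ⟨a, b, c, d, ha, hb, hc, hd, e, H⟩ := f.cov_coeffs (L := L)
  rw [← H v r α β γ δ hr, CubicForm.cubicCov₁, e, polar_polar_cubicAt hop ha hb hc hd,
    polar_mixedAt hop ha hb hc hd]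
  simp only [cubicAt, map_add, map_mul, map_pow, map_ofNat, psi_x, psi_y]

end Values

/-- This and the four facts after it are needed for substitutions: a homomorphism which changes only
`x_o` and `y_o` fixes these elements. -/
theorem f₁_mem (hop : o ≠ p) : f.f₁ ∈ sub h {o}ᶜ := by
  have hA := mem_left f.A_mem
  have hB := mem_left f.B_mem
  have hC := mem_left f.C_mem
  have hD := mem_left f.D_mem
  have hx : x p ∈ sub h {o}ᶜ := x_mem_sub hop.symm
  have hy : y p ∈ sub h {o}ᶜ := y_mem_sub hop.symm
  rw [f.f₁_eq hop, cubicAt]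
  all_goals repeat first
    | assumption
    | apply Subalgebra.add_mem
    | apply Subalgebra.sub_mem
    | apply Subalgebra.smul_mem
    | apply Subalgebra.neg_mem
    | apply Subalgebra.pow_mem
    | apply Subalgebra.mul_mem
    | exact ofNat_mem _ _

theorem hessian₁_mem (hop : o ≠ p) : f.hessian₁ ∈ sub h {o}ᶜ := by
  obtain ⟨a, b, c, ha, hb, hc, e, -⟩ := f.hess_coeffs (L := FractionRing (PolyGen I))
  have hx : x p ∈ sub h {o}ᶜ := x_mem_sub hop.symm
  have hy : y p ∈ sub h {o}ᶜ := y_mem_sub hop.symm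
  rw [hessian₁, e, polar_polar_quadAt hop ha hb hc, quadAt]
  all_goals repeat first
    | assumption
    | apply Subalgebra.add_mem
    | apply Subalgebra.sub_mem
    | apply Subalgebra.smul_mem
    | apply Subalgebra.neg_mem
    | apply Subalgebra.pow_mem
    | apply Subalgebra.mul_mem
    | exact ofNat_mem _ _

theorem cubicCov₁_mem (hop : o ≠ p) : f.cubicCov₁ ∈ sub h {o}ᶜ := by
  obtain ⟨a, b, c, d, ha, hb, hc, hd, e, -⟩ := f.cov_coeffs (L := FractionRing (PolyGen I))
  have hx : x p ∈ sub h {o}ᶜ := x_mem_sub hop.symm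
  have hy : y p ∈ sub h {o}ᶜ := y_mem_sub hop.symm
  rw [cubicCov₁, e, polar_polar_cubicAt hop ha hb hc hd, polar_mixedAt hop ha hb hc hd, cubicAt]
  all_goals repeat first
    | assumption
    | apply Subalgebra.add_mem
    | apply Subalgebra.sub_mem
    | apply Subalgebra.smul_mem
    | apply Subalgebra.neg_mem
    | apply Subalgebra.pow_mem
    | apply Subalgebra.mul_mem
    | exact ofNat_mem _ _

theorem gamma_mem (hop : o ≠ p) : f.gamma ∈ sub h {o}ᶜ := by
  have hA := mem_left f.A_mem
  have hB := mem_left f.B_mem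
  have hC := mem_left f.C_mem
  have hD := mem_left f.D_mem
  have hx : x p ∈ sub h {o}ᶜ := x_mem_sub hop.symm
  have hy : y p ∈ sub h {o}ᶜ := y_mem_sub hop.symm
  rw [gamma]
  all_goals repeat first
    | assumption
    | apply Subalgebra.add_mem
    | apply Subalgebra.sub_mem
    | apply Subalgebra.smul_mem
    | apply Subalgebra.neg_mem
    | apply Subalgebra.pow_mem
    | apply Subalgebra.mul_mem
    | exact ofNat_mem _ _

theorem delta_mem (hop : o ≠ p) : f.delta ∈ sub h {o}ᶜ := by
  have hA := mem_left f.A_mem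
  have hB := mem_left f.B_mem
  have hC := mem_left f.C_mem
  have hx : x p ∈ sub h {o}ᶜ := x_mem_sub hop.symm
  have hy : y p ∈ sub h {o}ᶜ := y_mem_sub hop.symm
  rw [delta]
  all_goals repeat first
    | assumption
    | apply Subalgebra.add_mem
    | apply Subalgebra.sub_mem
    | apply Subalgebra.smul_mem
    | apply Subalgebra.neg_mem
    | apply Subalgebra.pow_mem
    | apply Subalgebra.mul_mem
    | exact ofNat_mem _ _

end CubicForm
end CubicReal
end NCForms

namespace NCForms

/-! ## Covariants of an invariant cubic form -/

section Covariants

variable {L : Type u} [Field L] [Algebra ℂ L] {h : ℂ} {I : Type u} [LinearOrder I] {o p : I}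
  [Algebra (PolyGen I) L] [IsScalarTower ℂ (PolyGen I) L]

/-- The derivation `v_i ↦ r_i`, `r_i ↦ 0` of the parameters. -/
structure ParDer (I : Type u) [LinearOrder I] [Algebra (PolyGen I) L] (d : Derivation ℂ L L) :
    Prop where
  injective : Function.Injective (algebraMap (PolyGen I) L)
  vpar : ∀ i : I, d (vpar L i) = rpar L i
  rpar : ∀ i : I, d (rpar L i) = 0

theorem rpar_ne_zero (hL : Function.Injective (algebraMap (PolyGen I) L)) (i : I) :
    rpar L i ≠ 0 := (_root_.map_ne_zero_iff _ hL).mpr (MvPolynomial.X_ne_zero _)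

/-- The coefficients of a cubic form transform under the derivation as those of a classical
form. -/
structure CoeffDer (d : Derivation ℂ L L) (α β γ δ : L) : Prop where
  hα : d α = -(3 * β)
  hβ : d β = -(2 * γ)
  hγ : d γ = -δ
  hδ : d δ = 0

theorem der_ofNat (d : Derivation ℂ L L) (n : ℕ) [n.AtLeastTwo] : d (ofNat(n) : L) = 0 := by
  have := d.map_natCast n
  rwa [← Nat.cast_ofNat]

/-- Infinitesimal invariance of the classical binary cubic: the action on the coefficients is
contragredient to `v ↦ r ↦ 0`. -/
theorem CoeffDer.cubicVal {d : Derivation ℂ L L} {α β γ δ : L} (H : CoeffDer d α β γ δ) {v r : L}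
    (hv : d v = r) (hr : d r = 0) : d (cubicVal α β γ δ v r) = 0 := by
  simp only [NCForms.cubicVal, pow_succ, pow_zero, one_mul, map_add, Derivation.leibniz, smul_eq_mul, H.hα, H.hβ,
    H.hγ, H.hδ, hv, hr, der_ofNat]
  ring

theorem CoeffDer.hessVal {d : Derivation ℂ L L} {α β γ δ : L} (H : CoeffDer d α β γ δ) {v r : L}
    (hv : d v = r) (hr : d r = 0) : d (hessVal α β γ δ v r) = 0 := by
  simp only [NCForms.hessVal, pow_succ, pow_zero, one_mul, map_add, map_sub, Derivation.leibniz, smul_eq_mul, H.hα,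
    H.hβ, H.hγ, H.hδ, hv, hr, der_ofNat]
  ring

theorem CoeffDer.discVal {d : Derivation ℂ L L} {α β γ δ : L} (H : CoeffDer d α β γ δ) :
    d (discVal α β γ δ) = 0 := by
  simp only [NCForms.discVal, pow_succ, pow_zero, one_mul, map_add, map_sub, map_neg, Derivation.leibniz, smul_eq_mul,
    H.hα, H.hβ, H.hγ, H.hδ, der_ofNat]
  ring

theorem CoeffDer.covVal {d : Derivation ℂ L L} {α β γ δ : L} (H : CoeffDer d α β γ δ) {v r : L}
    (hv : d v = r) (hr : d r = 0) : d (covVal α β γ δ v r) = 0 := by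
  refine CoeffDer.cubicVal ⟨?_, ?_, ?_, ?_⟩ hv hr <;>
  · simp only [pow_succ, pow_zero, one_mul, map_add, map_sub, map_neg, Derivation.leibniz, smul_eq_mul,
      H.hα, H.hβ, H.hγ, H.hδ, der_ofNat]
    ring

theorem commute_of_gpsi (hL : Function.Injective (algebraMap (PolyGen I) L)) {a : HAlg h I} {l : L}
    (ha : psi (vpar L) (rpar L) a = algebraMap L _ l) (b : HAlg h I) : a * b = b * a := by
  refine gpsi_injective hL ?_
  rw [map_mul, map_mul, gpsi, ha, Algebra.commutes]

/-- The pairs `(a, b)` and `(a', b')` satisfy the relations of the pairs of generators of `H_I`. -/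
structure Compat {R : Type w} [Ring R] [Algebra ℂ R] (h : ℂ) (a b a' b' : R) : Prop where
  ab : a * b' = b' * a + h • (b * b')
  ba : a' * b = b * a' + h • (b' * b)
  bb : b * b' = b' * b
  aa : a' * a = a * a' - h • (a * b') + h • (b * a') + h ^ 2 • (b * b')

/-- The relations hold for all pairs of the shape `(v y T + r y⁻¹, v y)`, and injectivity carries
them back to `H_I`. -/
theorem compat_of_gpsi (hL : Function.Injective (algebraMap (PolyGen I) L)) {a b a' b' : HAlg h I}
    {v r v' r' : L} (ha : psi (vpar L) (rpar L) a = xel h v r)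
    (hb : psi (vpar L) (rpar L) b = yel h v) (ha' : psi (vpar L) (rpar L) a' = xel h v' r')
    (hb' : psi (vpar L) (rpar L) b' = yel h v') : Compat h a b a' b' := by
  refine ⟨gpsi_injective hL ?_, gpsi_injective hL ?_, gpsi_injective hL ?_,
    gpsi_injective hL ?_⟩ <;>
    simp only [map_add, map_sub, map_mul, map_smul, gpsi, ha, hb, ha', hb']
  · exact xel_mul_yel _ _ _
  · exact xel_mul_yel _ _ _
  · exact yel_mul_yel _ _
  · exact xel_mul_xel _ _ _ _

namespace CubicForm

variable {f : CubicForm h o p} {d : Derivation ℂ L L} {α β γ δ : L}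

theorem Real.update {v r : I → L} (hr : f.Real v r α β γ δ) (v' r' : L) :
    f.Real (Function.update v o v') (Function.update r o r') α β γ δ :=
  ⟨(psi_update o v r v' r' (mem_left f.A_mem)).trans hr.hA,
    (psi_update o v r v' r' (mem_left f.B_mem)).trans hr.hB,
    (psi_update o v r v' r' (mem_left f.C_mem)).trans hr.hC,
    (psi_update o v r v' r' (mem_left f.D_mem)).trans hr.hD⟩

/-- New parameters at `o` are allowed as soon as `d` acts on them in the same way; invariance of the
form then applies to the changed realisation. -/
theorem Real.der_cubicVal (hh : h ≠ 0) {v r : I → L} (hr : f.Real v r α β γ δ)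
    (hdv : ∀ i, d (v i) = r i) (hdr : ∀ i, d (r i) = 0) {v' r' : L} (h1 : d v' = r')
    (h2 : d r' = 0) : d (cubicVal α β γ δ v' r') = 0 := by
  have hl := (hr.update v' r').form
  rw [Function.update_self, Function.update_self] at hl
  refine f.invariant.der_eq_zero hh (fun i => ?_) (fun i => ?_) hl
  · by_cases hi : i = o
    · subst hi; simp [h1]
    · simp [hi, hdv]
  · by_cases hi : i = o
    · subst hi; simp [h2]
    · simp [hi, hdr]

theorem Real.coeffDer (hh : h ≠ 0) (hd : ParDer I d) (hr : f.Real (vpar L) (rpar L) α β γ δ) :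
    CoeffDer d α β γ δ := by
  have : CharZero L := charZero_of_injective_algebraMap (algebraMap ℂ L).injective
  have hp := rpar_ne_zero hd.injective p
  have hv := hd.vpar p
  have hrp := hd.rpar p
  generalize vpar L p = v at hv
  generalize rpar L p = r at hp hv hrp
  have h1 : d (1 : L) = 0 := d.map_one_eq_zero
  -- Invariance is used at `(1, 0)`, `(v, r)`, `(v + 1, r)` and `(v - 1, r)`. Finite differences in
  -- `v` separate the four coefficient equations, and powers of `r ≠ 0` are cancelled.
  have H1 := hr.der_cubicVal hh hd.vpar hd.rpar (v' := 1) (r' := 0) h1 (map_zero d)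
  have H2 := hr.der_cubicVal hh hd.vpar hd.rpar hv hrp
  have H3 := hr.der_cubicVal hh hd.vpar hd.rpar (v' := v + 1) (r' := r) (by rw [map_add, h1, hv, add_zero]) hrp
  have H4 := hr.der_cubicVal hh hd.vpar hd.rpar (v' := v - 1) (r' := r) (by rw [map_sub, h1, hv, sub_zero]) hrp
  simp only [cubicVal, pow_succ, pow_zero, one_mul, map_add, map_sub, Derivation.leibniz, smul_eq_mul, hv, hrp, h1,
    der_ofNat, mul_zero, zero_mul, add_zero, zero_add, map_zero, mul_one] at H1 H2 H3 H4
  have e2 : d γ + δ = 0 := by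
    have : r * (d γ + δ) = 0 := by linear_combination (H3 + H4 - 2 * H2 - 6 * v * H1) / 6
    exact (mul_eq_zero.mp this).resolve_left hp
  have e1 : d β + 2 * γ = 0 := by
    have : r ^ 2 * (d β + 2 * γ) = 0 := by
      linear_combination (H3 - H4 - (6 * v ^ 2 + 2) * H1 - 12 * r * v * e2) / 6
    exact (mul_eq_zero.mp this).resolve_left (pow_ne_zero _ hp)
  have e0 : d α + 3 * β = 0 := by
    have : r ^ 3 * (d α + 3 * β) = 0 := by
      linear_combination H2 - v ^ 3 * H1 - 3 * r * v ^ 2 * e2 - 3 * r ^ 2 * v * e1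
    exact (mul_eq_zero.mp this).resolve_left (pow_ne_zero _ hp)
  exact ⟨by linear_combination e0, by linear_combination e1, by linear_combination e2,
    by linear_combination H1⟩

section Main

variable (hh : h ≠ 0) (hd : ParDer I d)

include hh hd

theorem isInvariant_hessian : IsInvariant f.hessian := by
  obtain ⟨α, β, γ, δ, hr⟩ := f.exists_real hh (vpar L) (rpar L)
  exact isInvariant_of_gpsi hh hd.injective hd.vpar hd.rpar hr.hessian
    ((hr.coeffDer hh hd).hessVal (hd.vpar o) (hd.rpar o))

theorem isInvariant_cubicCov : IsInvariant f.cubicCov := by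
  obtain ⟨α, β, γ, δ, hr⟩ := f.exists_real hh (vpar L) (rpar L)
  exact isInvariant_of_gpsi hh hd.injective hd.vpar hd.rpar hr.cubicCov
    ((hr.coeffDer hh hd).covVal (hd.vpar o) (hd.rpar o))

theorem isInvariant_disc : IsInvariant f.disc := by
  obtain ⟨α, β, γ, δ, hr⟩ := f.exists_real hh (vpar L) (rpar L)
  exact isInvariant_of_gpsi hh hd.injective hd.vpar hd.rpar hr.disc (hr.coeffDer hh hd).discVal

theorem isInvariant_f₁ (hop : o ≠ p) : IsInvariant f.f₁ := by
  obtain ⟨α, β, γ, δ, hr⟩ := f.exists_real hh (vpar L) (rpar L)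
  exact isInvariant_of_gpsi hh hd.injective hd.vpar hd.rpar (hr.f₁ hop)
    ((hr.coeffDer hh hd).cubicVal (hd.vpar p) (hd.rpar p))

theorem isInvariant_xi (hop : o ≠ p) : IsInvariant f.xi := by
  obtain ⟨α, β, γ, δ, hr⟩ := f.exists_real hh (vpar L) (rpar L)
  have H := hr.coeffDer hh hd
  refine isInvariant_of_gpsi hh hd.injective hd.vpar hd.rpar (hr.xi hop) ?_
  simp only [polVal₁, pow_succ, pow_zero, one_mul, map_add, Derivation.leibniz, smul_eq_mul,
    H.hα, H.hβ, H.hγ, H.hδ, hd.vpar, hd.rpar, der_ofNat]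
  ring

theorem isInvariant_eta : IsInvariant f.eta := by
  obtain ⟨α, β, γ, δ, hr⟩ := f.exists_real hh (vpar L) (rpar L)
  refine isInvariant_of_gpsi hh hd.injective hd.vpar hd.rpar hr.eta ?_
  simp only [map_sub, Derivation.leibniz, smul_eq_mul, hd.vpar, hd.rpar]
  ring

/-- The classical syzygy of the binary cubic, valid identically in `α, β, γ, δ, v, r`, is
transported back along the injective realisation. -/
theorem syzygy : 4 * f.hessian ^ 3 + f.cubicCov ^ 2 + f.disc * f.form ^ 2 = 0 := by
  obtain ⟨α, β, γ, δ, hr⟩ := f.exists_real hh (vpar L) (rpar L)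
  refine gpsi_injective hd.injective ?_
  have e : 4 * hessVal α β γ δ (vpar L o) (rpar L o) ^ 3 +
      covVal α β γ δ (vpar L o) (rpar L o) ^ 2 +
      discVal α β γ δ * cubicVal α β γ δ (vpar L o) (rpar L o) ^ 2 = 0 := by
    simp only [hessVal, covVal, discVal, cubicVal]
    ring
  have e' := congrArg (algebraMap L (ShiftAlg (algebraMap ℂ L h))) e
  simp only [map_add, map_mul, map_pow, map_ofNat, ← hr.hessian, ← hr.cubicCov, ← hr.disc,
    ← hr.form] at e'
  simp only [map_add, map_mul, map_pow, map_ofNat, map_zero]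
  exact e'.trans (map_zero _)

theorem typical_representation (hop : o ≠ p) : f.form * f.f₁ ^ 2 =
    f.xi ^ 3 + 3 * f.hessian₁ * f.eta ^ 2 * f.xi - f.cubicCov₁ * f.eta ^ 3 := by
  obtain ⟨α, β, γ, δ, hr⟩ := f.exists_real hh (vpar L) (rpar L)
  refine gpsi_injective hd.injective ?_
  have key : ∀ a b c d e j : L, a * b ^ 2 = c ^ 3 + 3 * d * e ^ 2 * c - j * e ^ 3 →
      algebraMap L (ShiftAlg (algebraMap ℂ L h)) a * algebraMap L _ b ^ 2 =
        algebraMap L _ c ^ 3 + 3 * algebraMap L _ d * algebraMap L _ e ^ 2 * algebraMap L _ c -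
          algebraMap L _ j * algebraMap L _ e ^ 3 := fun a b c d e j H => by
    simpa only [map_add, map_sub, map_mul, map_pow, map_ofNat] using
      congrArg (algebraMap L (ShiftAlg (algebraMap ℂ L h))) H
  simp only [map_add, map_sub, map_mul, map_pow, map_ofNat]
  rw [gpsi, hr.form, hr.f₁ hop, hr.xi hop, hr.hessian₁ hop, hr.eta, hr.cubicCov₁ hop]
  refine key _ _ _ _ _ _ ?_
  simp only [hessVal, covVal, polVal₁, cubicVal]
  ring

theorem xi_eq_delta_gamma (hop : o ≠ p) :
    f.xi = x o * f.delta - y o * f.gamma - h • (y o * f.delta) := by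
  obtain ⟨α, β, γ, δ, hr⟩ := f.exists_real hh (vpar L) (rpar L)
  refine gpsi_injective hd.injective ?_
  refine (hr.xi hop).trans ?_
  rw [map_sub, map_sub, map_smul, map_mul, map_mul, map_mul, gpsi, psi_x, psi_y, hr.gamma,
    hr.delta, bracket_eq_algebraMap]
  congr 1
  ring

/-- The leading coefficient in `x_o` of the typical representation, where `ξ` contributes `δ` and
`η` contributes `y_p`. It is what makes `Y_i` nonzero. -/
theorem delta_cubic (hop : o ≠ p) : f.delta ^ 3 + 3 * f.hessian₁ * y p ^ 2 * f.delta -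
    f.cubicCov₁ * y p ^ 3 = f.A * f.f₁ ^ 2 := by
  have : CharZero L := charZero_of_injective_algebraMap (algebraMap ℂ L).injective
  obtain ⟨α, β, γ, δ, hr⟩ := f.exists_real hh (vpar L) (rpar L)
  refine gpsi_injective hd.injective ?_
  rw [map_sub, map_add, map_mul, map_mul, map_mul, map_mul, map_mul, map_pow, map_pow, map_pow,
    map_pow, map_ofNat, gpsi, psi_y, hr.hessian₁ hop, hr.cubicCov₁ hop, hr.f₁ hop, hr.delta, hr.hA]
  refine ShiftAlg.eq_of_op fun z hz t => ?_
  simp only [pow_succ, pow_zero, one_mul, map_add, map_sub, map_mul (op _ hz), LinearMap.add_apply,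
    Pi.add_apply, LinearMap.sub_apply, Pi.sub_apply, Module.End.mul_apply, op_yel, op_cfA,
    op_ofNat, op_algebraMap]
  simp only [hessVal, covVal, polVal₁, cubicVal]
  ring

/-- If `α = 0`, the equations `d α = -3β`, `d β = -2γ`, `d γ = -δ` make all the scalars vanish, and
with them the form. -/
theorem A_ne_zero : f.A ≠ 0 := fun hA => by
  have : CharZero L := charZero_of_injective_algebraMap (algebraMap ℂ L).injective
  obtain ⟨α, β, γ, δ, hr⟩ := f.exists_real hh (vpar L) (rpar L)
  have H := hr.coeffDer hh hd
  have h1 := hr.hA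
  rw [hA, map_zero] at h1
  have hα : α = 0 := cfA_injective (h := h) (by rw [← h1, cfA, map_zero, mono_zero])
  have hβ : β = 0 := by
    have := H.hα
    rw [hα, map_zero] at this
    linear_combination this / 3
  have hγ : γ = 0 := by
    have := H.hβ
    rw [hβ, map_zero] at this
    linear_combination this / 2
  have hδ : δ = 0 := by
    have := H.hγ
    rw [hγ, map_zero] at this
    linear_combination this
  refine f.ne_zero (gpsi_injective hd.injective ?_)
  refine hr.form.trans ?_
  rw [hα, hβ, hγ, hδ, cubicVal, map_zero]
  simp

/-- Exchanging the parameters of `o` and `p` leaves the coefficients alone and turns the value of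
`f₁` into that of the form, which is not zero. -/
theorem f₁_ne_zero (hop : o ≠ p) : f.f₁ ≠ 0 := fun h0 => by
  obtain ⟨α, β, γ, δ, hr⟩ := f.exists_real hh (vpar L) (rpar L)
  let v' : I → L := fun i => vpar L (Equiv.swap o p i)
  let r' : I → L := fun i => rpar L (Equiv.swap o p i)
  have hs : ∀ i ∈ ({o, p}ᶜ : Set I), Equiv.swap o p i = i := fun i hi => by
    simp only [Set.mem_compl_iff, Set.mem_insert_iff, Set.mem_singleton_iff, not_or] at hi
    exact Equiv.swap_apply_of_ne_of_ne hi.1 hi.2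
  have hc : ∀ a ∈ sub h {o, p}ᶜ, psi v' r' a = psi (vpar L) (rpar L) a := fun a ha =>
    psi_congr (S := {o, p}ᶜ) (v := v') (r := r') (v' := vpar L) (r' := rpar L)
      (fun i hi => congrArg (vpar L) (hs i hi)) (fun i hi => congrArg (rpar L) (hs i hi)) ha
  have hr' : f.Real v' r' α β γ δ := ⟨(hc _ f.A_mem).trans hr.hA, (hc _ f.B_mem).trans hr.hB,
    (hc _ f.C_mem).trans hr.hC, (hc _ f.D_mem).trans hr.hD⟩
  have h1 := hr'.f₁ hop
  rw [h0, map_zero] at h1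
  have hv : v' p = vpar L o := congrArg (vpar L) (Equiv.swap_apply_right o p)
  have hrr : r' p = rpar L o := congrArg (rpar L) (Equiv.swap_apply_right o p)
  rw [hv, hrr, ← hr.form] at h1
  exact f.ne_zero (gpsi_injective hd.injective ((map_zero _).trans h1).symm)

theorem commute_xi (hop : o ≠ p) (a : HAlg h I) : f.xi * a = a * f.xi := by
  obtain ⟨α, β, γ, δ, hr⟩ := f.exists_real hh (vpar L) (rpar L)
  exact commute_of_gpsi hd.injective (hr.xi hop) a

theorem commute_eta (a : HAlg h I) : f.eta * a = a * f.eta := by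
  obtain ⟨α, β, γ, δ, hr⟩ := f.exists_real hh (vpar L) (rpar L)
  exact commute_of_gpsi hd.injective hr.eta a

theorem commute_f₁ (hop : o ≠ p) (a : HAlg h I) : f.f₁ * a = a * f.f₁ := by
  obtain ⟨α, β, γ, δ, hr⟩ := f.exists_real hh (vpar L) (rpar L)
  exact commute_of_gpsi hd.injective (hr.f₁ hop) a

theorem expF_xi (hop : o ≠ p) : expF h f.xi = f.xi := by
  obtain ⟨α, β, γ, δ, hr⟩ := f.exists_real hh (vpar L) (rpar L)
  exact expF_eq_of_gpsi hd.injective (hr.xi hop)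

theorem expF_eta : expF h f.eta = f.eta := by
  obtain ⟨α, β, γ, δ, hr⟩ := f.exists_real hh (vpar L) (rpar L)
  exact expF_eq_of_gpsi hd.injective hr.eta

theorem compat_gamma_delta : Compat h f.gamma f.delta f.gamma f.delta := by
  obtain ⟨α, β, γ, δ, hr⟩ := f.exists_real hh (vpar L) (rpar L)
  exact compat_of_gpsi hd.injective hr.gamma hr.delta hr.gamma hr.delta

theorem compat_gamma_delta_coord (i : I) :
    Compat h f.gamma f.delta (x i) (y i) := by
  obtain ⟨α, β, γ, δ, hr⟩ := f.exists_real hh (vpar L) (rpar L)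
  exact compat_of_gpsi hd.injective hr.gamma hr.delta (psi_x _ _ i) (psi_y _ _ i)

end Main

end CubicForm

end Covariants
end NCForms

namespace NCForms

/-! ## Zeros of a cubic form in its Cardano extensions -/

section Compat

variable {R : Type w} [Ring R] [Algebra ℂ R] {h : ℂ} {a b a' b' c d : R}

theorem Compat.symm (H : Compat h a b a' b') : Compat h a' b' a b where
  ab := H.ba
  ba := H.ab
  bb := H.bb.symm
  aa := by
    have e := H.aa
    rw [H.ab] at e
    rw [e, H.ba, H.bb]
    simp only [smul_add]
    module

theorem Compat.map {S : Type v} [Ring S] [Algebra ℂ S] (g : R →ₐ[ℂ] S) (H : Compat h a b a' b') :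
    Compat h (g a) (g b) (g a') (g b') where
  ab := by rw [← map_mul, H.ab]; simp only [map_add, map_mul, map_smul]
  ba := by rw [← map_mul, H.ba]; simp only [map_add, map_mul, map_smul]
  bb := by rw [← map_mul, H.bb, map_mul]
  aa := by rw [← map_mul, H.aa]; simp only [map_add, map_sub, map_mul, map_smul]

/-- For a fixed second pair the relations are linear in the first pair, also over central elements
`σ`. -/
theorem Compat.sub_mul (H : Compat h a b a' b') (H' : Compat h c d a' b') {σ : R}
    (hσ : ∀ r, σ * r = r * σ) : Compat h (a - σ * c) (b - σ * d) a' b' where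
  ab := by
    rw [_root_.sub_mul, _root_.sub_mul, mul_sub, H.ab, mul_assoc, mul_assoc, H'.ab,
      ← mul_assoc b', ← hσ b', mul_assoc σ b', mul_add, mul_smul_comm]
    module
  ba := by
    rw [_root_.sub_mul, mul_sub, mul_sub, H.ba, mul_assoc, ← mul_assoc a', ← hσ a', mul_assoc,
      H'.ba, ← mul_assoc b', ← hσ b', mul_assoc, mul_add, mul_smul_comm]
    module
  bb := by
    rw [_root_.sub_mul, mul_sub, H.bb, mul_assoc, H'.bb, ← mul_assoc, hσ, mul_assoc]
  aa := by
    rw [mul_sub, ← mul_assoc a', ← hσ a', mul_assoc, H.aa, H'.aa]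
    simp only [_root_.sub_mul, mul_sub, mul_add, mul_smul_comm, mul_assoc]
    module

theorem compat_coord {I : Type u} [LinearOrder I] (i j : I) :
    Compat h (x i : HAlg h I) (y i) (x j) (y j) :=
  ⟨xy i j, xy j i, yy i j, xx i j⟩

end Compat

/-! ### Cube roots of unity and the resolvent -/

section Roots

theorem eps_eq : 1 + eps + eps ^ 2 = 0 := by
  have h1 : IsPrimitiveRoot eps 3 := by
    have := Complex.isPrimitiveRoot_exp 3 (by norm_num)
    rwa [Nat.cast_ofNat] at this
  have := h1.geom_sum_eq_zero (by norm_num)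
  simpa [Finset.sum_range_succ] using this

theorem eps_cube : eps ^ 3 = 1 := by
  linear_combination (eps - 1) * eps_eq

variable {R : Type v} [DivisionRing R] [Algebra ℂ R]

theorem sigma_mod (u₁ u₂ : R) (i : ℕ) : sigma u₁ u₂ i = sigma u₁ u₂ (i % 3) := by
  have e : ∀ k, eps ^ (k % 3) = eps ^ k := fun k => by
    conv_rhs => rw [← Nat.mod_add_div k 3, pow_add, pow_mul, eps_cube, one_pow, mul_one]
  rw [sigma, sigma, ← e i, ← e (2 * i), ← e (2 * (i % 3))]
  simp [Nat.mul_mod]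

theorem sigma_comm {u₁ u₂ : R} {r : R} (h1 : u₁ * r = r * u₁) (h2 : u₂ * r = r * u₂) (i : ℕ) :
    sigma u₁ u₂ i * r = r * sigma u₁ u₂ i := by
  simp only [sigma, add_mul, mul_add, smul_mul_assoc, mul_smul_comm, h1, h2]

/-- The factorisation of Cardano's resolvent. -/
theorem prod_sub_sigma {a b u₁ u₂ : R} (hab : a * b = b * a) (h1 : ∀ r, u₁ * r = r * u₁)
    (h2 : ∀ r, u₂ * r = r * u₂) :
    (a - sigma u₁ u₂ 0 * b) * (a - sigma u₁ u₂ 1 * b) * (a - sigma u₁ u₂ 2 * b) =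
      a ^ 3 - 3 * (u₁ * u₂) * b ^ 2 * a - (u₁ ^ 3 + u₂ ^ 3) * b ^ 3 := by
  -- All four elements commute with each other, so the identity can be checked in the commutative
  -- subalgebra which they generate.
  let s : Set R := {a, b, u₁, u₂}
  have hs : ∀ c ∈ s, ∀ d ∈ s, c * d = d * c := by
    rintro c (rfl | rfl | rfl | rfl) d (rfl | rfl | rfl | rfl) <;>
      first | rfl | exact hab | exact hab.symm | exact h1 _ | exact h2 _ | exact (h1 _).symm |
        exact (h2 _).symm
  have hmul := (Algebra.isMulCommutative_adjoin ℂ hs).is_comm.comm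
  let _ : CommRing (Algebra.adjoin ℂ s) :=
    { (inferInstance : Ring (Algebra.adjoin ℂ s)) with mul_comm := hmul }
  let a' : Algebra.adjoin ℂ s := ⟨a, Algebra.subset_adjoin (by simp [s])⟩
  let b' : Algebra.adjoin ℂ s := ⟨b, Algebra.subset_adjoin (by simp [s])⟩
  let v₁ : Algebra.adjoin ℂ s := ⟨u₁, Algebra.subset_adjoin (by simp [s])⟩
  let v₂ : Algebra.adjoin ℂ s := ⟨u₂, Algebra.subset_adjoin (by simp [s])⟩
  let e : Algebra.adjoin ℂ s := algebraMap ℂ _ eps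
  have he : 1 + e + e ^ 2 = 0 := by
    have := congrArg (algebraMap ℂ (Algebra.adjoin ℂ s)) eps_eq
    simpa only [map_add, map_one, map_pow, map_zero] using this
  have hsum : e * v₁ + e ^ 2 * v₂ + (e ^ 2 * v₁ + e ^ 4 * v₂) = -(v₁ + v₂) := by
    linear_combination (v₁ + v₂ * (1 - e + e ^ 2)) * he
  have hprod : (e * v₁ + e ^ 2 * v₂) * (e ^ 2 * v₁ + e ^ 4 * v₂) =
      v₁ ^ 2 + v₂ ^ 2 - v₁ * v₂ := by
    linear_combination (v₁ ^ 2 * (e - 1) + v₂ ^ 2 * (e ^ 3 + 1) * (e - 1) +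
      v₁ * v₂ * (e ^ 3 - e + 1)) * he
  have key : (a' - (v₁ + v₂) * b') * (a' - (e * v₁ + e ^ 2 * v₂) * b') *
      (a' - (e ^ 2 * v₁ + e ^ 4 * v₂) * b') =
      a' ^ 3 - 3 * (v₁ * v₂) * b' ^ 2 * a' - (v₁ ^ 3 + v₂ ^ 3) * b' ^ 3 := by
    linear_combination (a' - (v₁ + v₂) * b') * (-(a' * b') * hsum + b' ^ 2 * hprod)
  have hE : ((e : Algebra.adjoin ℂ s) : R) = algebraMap ℂ R eps := rfl
  have h3 : ((3 : Algebra.adjoin ℂ s) : R) = 3 := rfl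
  have := congrArg Subtype.val key
  simp only [Subalgebra.coe_mul, Subalgebra.coe_sub, Subalgebra.coe_add, Subalgebra.coe_pow, hE, h3,
    ← map_pow, ← Algebra.smul_def] at this
  simpa [sigma, a', b', v₁, v₂] using this

/-- Put `a = σ_i` and `b = 1` in the factorisation: one of the three factors is zero. -/
theorem sigma_root {u₁ u₂ : R} (h1 : ∀ r, u₁ * r = r * u₁) (h2 : ∀ r, u₂ * r = r * u₂) (i : ℕ) :
    sigma u₁ u₂ i ^ 3 - 3 * (u₁ * u₂) * sigma u₁ u₂ i - (u₁ ^ 3 + u₂ ^ 3) = 0 := by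
  have H := prod_sub_sigma (a := sigma u₁ u₂ i) (b := 1) (by simp) h1 h2
  simp only [one_pow, mul_one] at H
  rw [← H]
  have hi : i % 3 < 3 := Nat.mod_lt _ (by norm_num)
  rw [sigma_mod u₁ u₂ i]
  interval_cases i % 3 <;> simp

end Roots

/-- Homomorphisms which agree on the generators with index in `S` agree on `H_S`. -/
theorem eqOn_sub {I : Type u} [LinearOrder I] {h : ℂ} {R : Type w} [Ring R] [Algebra ℂ R]
    {G g : HAlg h I →ₐ[ℂ] R} {S : Set I} (hG : ∀ i ∈ S, G (x i) = g (x i) ∧ G (y i) = g (y i))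
    {a : HAlg h I} (ha : a ∈ sub h S) : G a = g a := by
  refine Algebra.adjoin_induction (p := fun a _ => G a = g a) ?_ ?_ ?_ ?_ ha
  · rintro _ (⟨i, hi, rfl⟩ | ⟨i, hi, rfl⟩)
    · exact (hG i hi).1
    · exact (hG i hi).2
  · intro c; rw [AlgHomClass.commutes, AlgHomClass.commutes]
  · intro a b _ _ ha hb; rw [map_add, map_add, ha, hb]
  · intro a b _ _ ha hb; rw [map_mul, map_mul, ha, hb]

/-! ### Factorisation over a Cardano extension -/

section Cardano

variable {I : Type u} [LinearOrder I] {h : ℂ} {o p : I} {f : CubicForm h o p}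
  {Q : Type v} [DivisionRing Q] [Algebra ℂ Q] {ι : HAlg h I →ₐ[ℂ] Q}
  {R : Type w} [DivisionRing R] [Algebra ℂ R] {κ : Q →ₐ[ℂ] R} {s u₁ u₂ : R}

namespace IsCardanoExtension

variable (E : IsCardanoExtension f ι κ s u₁ u₂)

include E

theorem u₁_comm (r : R) : u₁ * r = r * u₁ :=
  (Subalgebra.mem_center_iff.mp E.u₁_central r).symm

theorem u₂_comm (r : R) : u₂ * r = r * u₂ :=
  (Subalgebra.mem_center_iff.mp E.u₂_central r).symm

theorem s_comm (r : R) : s * r = r * s :=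
  (Subalgebra.mem_center_iff.mp E.s_central r).symm

theorem sigma_comm (i : ℕ) (r : R) : sigma u₁ u₂ i * r = r * sigma u₁ u₂ i :=
  NCForms.sigma_comm (E.u₁_comm r) (E.u₂_comm r) i

/-- Central elements of `H_I` remain central. -/
theorem map_comm (hq : IsQuotientDivisionRing ι) {a : HAlg h I} (ha : ∀ b, a * b = b * a) (r : R) :
    κ (ι a) * r = r * κ (ι a) := by
  have hr : r ∈ Algebra.adjoin ℂ (Set.range κ ∪ {s, u₁, u₂}) := by rw [E.generate]; trivial
  have hc : ∀ b, κ (ι a) * κ (ι b) = κ (ι b) * κ (ι a) := fun b => by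
    rw [← map_mul, ← map_mul, ha, map_mul, map_mul]
  -- Commuting with `H_I` passes to quotients, and the other generators of `R` are central.
  refine Algebra.adjoin_induction (p := fun r _ => κ (ι a) * r = r * κ (ι a)) ?_ ?_ ?_ ?_ hr
  · rintro _ (⟨q, rfl⟩ | rfl | rfl | rfl)
    · obtain ⟨b, c, hc0, rfl⟩ := hq.exists_quotient q
      rw [map_mul, map_inv₀, ← mul_assoc, hc, mul_assoc, mul_assoc]
      congr 1
      exact (Commute.inv_right₀ (hc c)).eq
    · exact (E.s_comm _).symm
    · exact (E.u₁_comm _).symm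
    · exact (E.u₂_comm _).symm
  · intro c; rw [Algebra.commutes]
  · intro a b _ _ ha hb; rw [mul_add, add_mul, ha, hb]
  · intro a b _ _ ha hb; rw [← mul_assoc, ha, mul_assoc, hb, mul_assoc]

theorem cube_add_cube : u₁ ^ 3 + u₂ ^ 3 = κ (ι f.cubicCov₁) := by
  rw [E.u₁_cube, E.u₂_cube]
  module

/-- The factorisation of the resolvent cubic. -/
theorem prod_eq {a b : R} (hab : a * b = b * a) :
    (a - sigma u₁ u₂ 0 * b) * (a - sigma u₁ u₂ 1 * b) * (a - sigma u₁ u₂ 2 * b) =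
      a ^ 3 + 3 * κ (ι f.hessian₁) * b ^ 2 * a - κ (ι f.cubicCov₁) * b ^ 3 := by
  rw [prod_sub_sigma hab E.u₁_comm E.u₂_comm, E.u₁_mul_u₂, E.cube_add_cube]
  simp only [mul_neg, neg_mul, sub_neg_eq_add]

theorem sigma_root (i : ℕ) : sigma u₁ u₂ i ^ 3 + 3 * κ (ι f.hessian₁) * sigma u₁ u₂ i =
    κ (ι f.cubicCov₁) := by
  have := NCForms.sigma_root E.u₁_comm E.u₂_comm i
  rw [E.u₁_mul_u₂, E.cube_add_cube] at this
  simpa only [mul_neg, neg_mul, sub_neg_eq_add, sub_eq_zero] using this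

/-- Common zeros of a homogeneous resolvent. -/
theorem resolvent_eq_zero (i : ℕ) (w : R) : (sigma u₁ u₂ i * w) ^ 3 +
    3 * κ (ι f.hessian₁) * w ^ 2 * (sigma u₁ u₂ i * w) - κ (ι f.cubicCov₁) * w ^ 3 = 0 := by
  have h1 : Commute (sigma u₁ u₂ i) w := E.sigma_comm i w
  rw [h1.mul_pow, ← E.sigma_root i, ← mul_assoc, mul_assoc _ (w ^ 2), ← E.sigma_comm i (w ^ 2),
    ← mul_assoc, add_mul, mul_assoc _ (w ^ 2) w, ← pow_succ, sub_self]

section Facts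

variable {L : Type u} [Field L] [Algebra ℂ L] [Algebra (PolyGen I) L]
  [IsScalarTower ℂ (PolyGen I) L] {d : Derivation ℂ L L}
  (hh : h ≠ 0) (hd : ParDer I d) (hop : o ≠ p) (hq : IsQuotientDivisionRing ι)

include hh hd hop hq

theorem map_f₁_ne_zero : κ (ι f.f₁) ≠ 0 := by
  rw [Ne, map_eq_zero, map_eq_zero_iff _ hq.injective]
  exact CubicForm.f₁_ne_zero hh hd hop

/-- The right side of the typical representation is the resolvent in `ξ` and `η`, which splits over
`R`; the central element `f₁²` is then divided out. -/
theorem form_eq_prod : κ (ι f.form) = κ ((ι f.f₁ ^ 2)⁻¹) *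
    ((κ (ι f.xi) - sigma u₁ u₂ 0 * κ (ι f.eta)) * (κ (ι f.xi) - sigma u₁ u₂ 1 * κ (ι f.eta)) *
      (κ (ι f.xi) - sigma u₁ u₂ 2 * κ (ι f.eta))) := by
  have hc : κ (ι f.xi) * κ (ι f.eta) = κ (ι f.eta) * κ (ι f.xi) :=
    E.map_comm hq (CubicForm.commute_xi hh hd hop) _
  have hT := congrArg (fun a => κ (ι a)) (CubicForm.typical_representation (f := f) hh hd hop)
  simp only [map_mul, map_add, map_sub, map_pow, map_ofNat] at hT
  have h1 : Commute (κ (ι f.f₁)) (κ (ι f.form)) := E.map_comm hq (CubicForm.commute_f₁ hh hd hop) _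
  rw [E.prod_eq hc, ← hT, ← (h1.pow_left 2).eq, map_inv₀, map_pow,
    inv_mul_cancel_left₀ (pow_ne_zero _ (E.map_f₁_ne_zero hh hd hop hq))]

theorem factor_comm (i : ℕ) (r : R) : (κ (ι f.xi) - sigma u₁ u₂ i * κ (ι f.eta)) * r =
    r * (κ (ι f.xi) - sigma u₁ u₂ i * κ (ι f.eta)) := by
  rw [_root_.sub_mul, mul_sub, E.map_comm hq (CubicForm.commute_xi hh hd hop), mul_assoc,
    E.map_comm hq (CubicForm.commute_eta hh hd), ← mul_assoc, E.sigma_comm, mul_assoc]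

omit hq in
theorem factor_eq (i : ℕ) : κ (ι f.xi) - sigma u₁ u₂ i * κ (ι f.eta) =
    κ (ι (x o)) * (κ (ι f.delta) - sigma u₁ u₂ i * κ (ι (y p))) -
      κ (ι (y o)) * (κ (ι f.gamma) - sigma u₁ u₂ i * κ (ι (x p))) -
      h • (κ (ι (y o)) * (κ (ι f.delta) - sigma u₁ u₂ i * κ (ι (y p)))) := by
  rw [CubicForm.xi_eq_delta_gamma hh hd hop, CubicForm.eta, bracket]
  simp only [map_mul, map_sub, map_smul, mul_sub, ← mul_assoc, ← E.sigma_comm i (κ (ι (x o))),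
    ← E.sigma_comm i (κ (ι (y o))), smul_sub, mul_smul_comm]
  abel

/-- If `δ = σ_i y_p`, the left side of `delta_cubic` is the homogeneous resolvent at one of its
roots, so `A f₁²` would be zero. -/
theorem Y_ne_zero (i : ℕ) : κ (ι f.delta) - sigma u₁ u₂ i * κ (ι (y p)) ≠ 0 := fun H => by
  rw [sub_eq_zero] at H
  have hT := congrArg (fun a => κ (ι a)) (CubicForm.delta_cubic (f := f) hh hd hop)
  simp only [map_mul, map_add, map_sub, map_pow, map_ofNat] at hT
  rw [H, E.resolvent_eq_zero] at hT
  have h1 : κ (ι f.A) ≠ 0 := by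
    rw [Ne, map_eq_zero, map_eq_zero_iff _ hq.injective]
    exact CubicForm.A_ne_zero hh hd
  exact mul_ne_zero h1 (pow_ne_zero 2 (E.map_f₁_ne_zero hh hd hop hq)) hT.symm

/-- The value of a form at a point in terms of the resolvent. -/
theorem map_form_mul {G : HAlg h I →ₐ[ℂ] R}
    (hG : ∀ i, i ≠ o → G (x i) = κ (ι (x i)) ∧ G (y i) = κ (ι (y i))) :
    G f.form * κ (ι f.f₁) ^ 2 = G f.xi ^ 3 + 3 * κ (ι f.hessian₁) * G f.eta ^ 2 * G f.xi -
      κ (ι f.cubicCov₁) * G f.eta ^ 3 := by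
  have hT := congrArg G (CubicForm.typical_representation (f := f) hh hd hop)
  simp only [map_mul, map_add, map_sub, map_pow, map_ofNat] at hT
  have hs := fun a ha => eqOn_sub (g := κ.comp ι) (S := {o}ᶜ) (a := a) hG ha
  rwa [hs _ (f.f₁_mem hop), hs _ (f.hessian₁_mem hop), hs _ (f.cubicCov₁_mem hop)] at hT

end Facts

end IsCardanoExtension

end Cardano
end NCForms

namespace NCForms

/-! ### Zeros of the form -/

section CardanoZeros

variable {I : Type u} [LinearOrder I] {h : ℂ} {o p : I} {f : CubicForm h o p}
  {Q : Type v} [DivisionRing Q] [Algebra ℂ Q] {ι : HAlg h I →ₐ[ℂ] Q}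
  {R : Type w} [DivisionRing R] [Algebra ℂ R] {κ : Q →ₐ[ℂ] R} {s u₁ u₂ : R}
  {L : Type u} [Field L] [Algebra ℂ L] [Algebra (PolyGen I) L]
  [IsScalarTower ℂ (PolyGen I) L] {d : Derivation ℂ L L}

/-- Substitution of a pair which is compatible with the generators. -/
theorem exists_subst (o : I) (φ : HAlg h I →ₐ[ℂ] R) {X Y : R} (h1 : Compat h X Y X Y)
    (h2 : ∀ i, Compat h X Y (φ (x i)) (φ (y i))) : ∃ G : HAlg h I →ₐ[ℂ] R, G (x o) = X ∧
      G (y o) = Y ∧ ∀ i, i ≠ o → G (x i) = φ (x i) ∧ G (y i) = φ (y i) := by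
  classical
  let a : I → R := Function.update (fun i => φ (x i)) o X
  let b : I → R := Function.update (fun i => φ (y i)) o Y
  have ha : a o = X := Function.update_self _ _ _
  have hb : b o = Y := Function.update_self _ _ _
  have ha' : ∀ i, i ≠ o → a i = φ (x i) := fun i hi => Function.update_of_ne hi _ _
  have hb' : ∀ i, i ≠ o → b i = φ (y i) := fun i hi => Function.update_of_ne hi _ _
  have hc : ∀ i j, Compat h (a i) (b i) (a j) (b j) := fun i j => by
    by_cases hi : i = o <;> by_cases hj : j = o
    · rw [hi, hj, ha, hb]; exact h1
    · rw [hi, ha, hb, ha' j hj, hb' j hj]; exact h2 j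
    · rw [hj, ha, hb, ha' i hi, hb' i hi]; exact (h2 i).symm
    · rw [ha' i hi, hb' i hi, ha' j hj, hb' j hj]; exact (compat_coord i j).map φ
  refine ⟨lift a b (fun i j => (hc i j).ab) (fun i j => (hc i j).bb) (fun i j _ => (hc i j).aa),
    ?_, ?_, fun i hi => ⟨?_, ?_⟩⟩
  · rw [lift_x, ha]
  · rw [lift_y, hb]
  · rw [lift_x, ha' i hi]
  · rw [lift_y, hb' i hi]

namespace IsCardanoExtension

variable (E : IsCardanoExtension f ι κ s u₁ u₂) (hh : h ≠ 0) (hd : ParDer I d) (hop : o ≠ p)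

include E hh hd hop

omit E in
theorem map_xi {G : HAlg h I →ₐ[ℂ] R}
    (hG : ∀ i, i ≠ o → G (x i) = κ (ι (x i)) ∧ G (y i) = κ (ι (y i))) :
    G f.xi = G (x o) * κ (ι f.delta) - G (y o) * κ (ι f.gamma) -
      h • (G (y o) * κ (ι f.delta)) := by
  have hs := fun a ha => eqOn_sub (g := κ.comp ι) (S := {o}ᶜ) (a := a) hG ha
  rw [CubicForm.xi_eq_delta_gamma hh hd hop]
  simp only [map_sub, map_mul, map_smul, hs _ (f.delta_mem hop), hs _ (f.gamma_mem hop)]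
  rfl

omit E hh hd in
theorem map_eta {G : HAlg h I →ₐ[ℂ] R}
    (hG : ∀ i, i ≠ o → G (x i) = κ (ι (x i)) ∧ G (y i) = κ (ι (y i))) :
    G f.eta = G (x o) * κ (ι (y p)) - G (y o) * κ (ι (x p)) -
      h • (G (y o) * κ (ι (y p))) := by
  rw [CubicForm.eta, bracket]
  simp only [map_sub, map_mul, map_smul, (hG p hop.symm).1, (hG p hop.symm).2]

variable (hq : IsQuotientDivisionRing ι)

include hq

/-- Both `(γ, δ)` and `(x_p, y_p)` satisfy the relations of a coordinate pair, hence so does their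
combination with central `σ`. At this point `ξ = σ η`, so the resolvent vanishes and `f₁²` can be
cancelled. -/
theorem isZero (i : ℕ) : IsZero (κ.comp ι) o f.form
    (κ (ι f.gamma) - sigma u₁ u₂ i * κ (ι (x p))) (κ (ι f.delta) - sigma u₁ u₂ i * κ (ι (y p))) := by
  set φ := κ.comp ι with hφ
  set σ := sigma u₁ u₂ i with hσ
  have hσc : ∀ r, σ * r = r * σ := E.sigma_comm i
  have hgx : ∀ j, Compat h (κ (ι f.gamma)) (κ (ι f.delta)) (κ (ι (x j))) (κ (ι (y j))) := fun j =>
    (CubicForm.compat_gamma_delta_coord hh hd j).map φ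
  have hgg : Compat h (κ (ι f.gamma)) (κ (ι f.delta)) (κ (ι f.gamma)) (κ (ι f.delta)) :=
    (CubicForm.compat_gamma_delta hh hd).map φ
  have hxx : ∀ j, Compat h (κ (ι (x p))) (κ (ι (y p))) (κ (ι (x j))) (κ (ι (y j))) := fun j =>
    (compat_coord p j).map φ
  have hcx := fun j => (hgx j).sub_mul (hxx j) hσc
  -- Linearity is applied in each of the two arguments in turn, for the relations of `(X_i, Y_i)`
  -- with itself.
  have hcc := (hgg.sub_mul (hgx p).symm hσc).symm.sub_mul (hcx p).symm hσc
  obtain ⟨G, hX, hY, hG⟩ := exists_subst o φ hcc hcx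
  refine ⟨Or.inr (E.Y_ne_zero hh hd hop hq i), G, hX, hY, hG, ?_⟩
  have hT := E.map_form_mul hh hd hop hq hG
  have hw : G f.eta = κ (ι (y p)) * κ (ι f.gamma) - κ (ι f.delta) * κ (ι (x p)) := by
    rw [map_eta hop hG, hX, hY]
    simp only [_root_.sub_mul, mul_assoc, (hgx p).ab, (hxx p).ab, smul_sub, mul_add, mul_smul_comm]
    abel
  have hxi : G f.xi = σ * G f.eta := by
    rw [hw, map_xi hh hd hop hG, hX, hY]
    simp only [_root_.sub_mul, mul_assoc, hgg.ab, (hgx p).ba, smul_sub, mul_add, mul_sub,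
      mul_smul_comm]
    abel
  rw [hxi, E.resolvent_eq_zero] at hT
  exact (mul_eq_zero.mp hT).resolve_right (pow_ne_zero 2 (E.map_f₁_ne_zero hh hd hop hq))

/-- At a zero the product of the three factors is `0`, so one of them vanishes in the division ring.
It is linear in `(X, Y)`, which fixes `Y⁻¹ X`; the relation between `X` and `Y` turns this into `X
Y⁻¹`, and the terms `h` cancel. -/
theorem zero_classification {X Y : R} (H : IsZero (κ.comp ι) o f.form X Y) :
    Y ≠ 0 ∧ ∃ i < 3, X * Y⁻¹ = (κ (ι f.gamma) - sigma u₁ u₂ i * κ (ι (x p))) *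
      (κ (ι f.delta) - sigma u₁ u₂ i * κ (ι (y p)))⁻¹ := by
  obtain ⟨h0, G, hX, hY, hG, hGf⟩ := H
  have hT := E.map_form_mul hh hd hop hq hG
  have hc : G f.xi * G f.eta = G f.eta * G f.xi := by
    rw [← map_mul, CubicForm.commute_xi hh hd hop, map_mul]
  rw [hGf, zero_mul, ← E.prod_eq hc] at hT
  have hex : ∃ i < 3, G f.xi - sigma u₁ u₂ i * G f.eta = 0 := by
    rcases mul_eq_zero.mp hT.symm with h1 | h1
    · rcases mul_eq_zero.mp h1 with h1 | h1
      · exact ⟨0, by norm_num, h1⟩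
      · exact ⟨1, by norm_num, h1⟩
    · exact ⟨2, by norm_num, h1⟩
  obtain ⟨i, hi, h1⟩ := hex
  set σ := sigma u₁ u₂ i with hσ
  have hσc : ∀ r, σ * r = r * σ := E.sigma_comm i
  set X' := κ (ι f.gamma) - σ * κ (ι (x p)) with hX'
  set Y' := κ (ι f.delta) - σ * κ (ι (y p)) with hY'
  have hY0 : Y' ≠ 0 := E.Y_ne_zero hh hd hop hq i
  -- This is the vanishing of `ξ - σ η` after the substitution, with `ξ` written through `γ` and
  -- `δ`.
  have h2 : X * Y' = Y * (X' + h • Y') := by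
    rw [map_xi hh hd hop hG, map_eta hop hG, hX, hY] at h1
    rw [← sub_eq_zero, ← h1, hX', hY']
    simp only [mul_sub, mul_add, smul_sub, mul_smul_comm, ← mul_assoc, hσc X, hσc Y]
    abel
  have hYne : Y ≠ 0 := by
    rintro rfl
    rw [zero_mul] at h2
    rcases mul_eq_zero.mp h2 with h3 | h3
    · simp [h3] at h0
    · exact hY0 h3
  refine ⟨hYne, i, hi, ?_⟩
  have hrel : X * Y = Y * X + h • (Y * Y) := by
    have := congrArg G (xy_self (h := h) o)
    simpa only [map_mul, map_add, map_smul, hX, hY] using this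
  have h3 : Y⁻¹ * X = X * Y⁻¹ + h • (1 : R) := by
    have : Y⁻¹ * (X * Y) * Y⁻¹ = Y⁻¹ * (Y * X + h • (Y * Y)) * Y⁻¹ := by rw [hrel]
    simpa [mul_add, add_mul, mul_assoc, hYne] using this
  have h4 : Y⁻¹ * X = X' * Y'⁻¹ + h • (1 : R) := by
    have : Y⁻¹ * (X * Y') * Y'⁻¹ = Y⁻¹ * (Y * (X' + h • Y')) * Y'⁻¹ := by rw [h2]
    simpa [mul_add, add_mul, mul_assoc, hYne, hY0] using this
  exact add_right_cancel (h3.symm.trans h4)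

theorem isInvariant_factor (act : ExtendedAction (κ.comp ι)) (h1 : act.IsInvariant u₁)
    (h2 : act.IsInvariant u₂) (i : ℕ) :
    act.IsInvariant (κ (ι f.xi) - sigma u₁ u₂ i * κ (ι f.eta)) := by
  have hx := CubicForm.isInvariant_xi (f := f) hh hd hop
  have he := CubicForm.isInvariant_eta (f := f) hh hd
  have hσE : act.E (sigma u₁ u₂ i) = 0 := by simp [sigma, h1.1, h2.1]
  have hσF : act.F (sigma u₁ u₂ i) = 0 := by simp [sigma, h1.2.1, h2.2.1]
  have hσH : act.H (sigma u₁ u₂ i) = 0 := by simp [sigma, h1.2.2.1, h2.2.2.1]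
  have hσT : act.T (sigma u₁ u₂ i) = sigma u₁ u₂ i := by simp [sigma, h1.2.2.2, h2.2.2.2]
  have e1 : act.E (κ (ι f.xi)) = 0 ∧ act.E (κ (ι f.eta)) = 0 := by
    refine ⟨(act.E_coe _).trans ?_, (act.E_coe _).trans ?_⟩
    · rw [hx.1, map_zero]
    · rw [he.1, map_zero]
  have e2 : act.F (κ (ι f.xi)) = 0 ∧ act.F (κ (ι f.eta)) = 0 := by
    refine ⟨(act.F_coe _).trans ?_, (act.F_coe _).trans ?_⟩
    · rw [hx.2.1, map_zero]
    · rw [he.2.1, map_zero]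
  have e3 : act.H (κ (ι f.xi)) = 0 ∧ act.H (κ (ι f.eta)) = 0 := by
    refine ⟨(act.H_coe _).trans ?_, (act.H_coe _).trans ?_⟩
    · rw [hx.2.2, map_zero]
    · rw [he.2.2, map_zero]
  have e4 : act.T (κ (ι f.xi)) = κ (ι f.xi) ∧ act.T (κ (ι f.eta)) = κ (ι f.eta) := by
    refine ⟨(act.T_coe _).trans ?_, (act.T_coe _).trans ?_⟩
    · rw [CubicForm.expF_xi hh hd hop]; rfl
    · rw [CubicForm.expF_eta hh hd]; rfl
  refine ⟨?_, ?_, ?_, ?_⟩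
  · rw [map_sub, act.E_mul, e1.1, e1.2, hσE]; simp
  · rw [map_sub, act.F_mul, e2.1, e2.2, hσF]; simp
  · rw [map_sub, act.H_mul, e3.1, e3.2, hσH]; simp
  · rw [map_sub, map_mul, e4.1, e4.2, hσT]

end IsCardanoExtension

end CardanoZeros
end NCForms

namespace NCForms

/-! ## Quotient division rings -/

section Quotient

open OreLocalization nonZeroDivisors

section Frac

variable {S : Type u} [Ring S] [Algebra ℂ S] [IsDomain S] [OreSet S⁰]

/-- The embedding of a domain in its division ring of fractions. -/
noncomputable def toFrac (S : Type u) [Ring S] [Algebra ℂ S] [IsDomain S] [OreSet S⁰] :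
    S →ₐ[ℂ] OreLocalization S⁰ S where
  __ := (numeratorRingHom : S →+* OreLocalization S⁰ S)
  commutes' _ := rfl

theorem toFrac_injective : Function.Injective (toFrac S) :=
  numeratorHom_inj inf_le_left

theorem exists_frac (q : OreLocalization S⁰ S) :
    ∃ a b : S, b ≠ 0 ∧ q = (toFrac S b)⁻¹ * toFrac S a := by
  induction q using OreLocalization.ind with
  | _ r s =>
    have hs : (s : S) ≠ 0 := nonZeroDivisors.coe_ne_zero s
    refine ⟨r, s, hs, ?_⟩
    have hs' : toFrac S s ≠ 0 := (_root_.map_ne_zero_iff _ toFrac_injective).mpr hs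
    rw [eq_inv_mul_iff_mul_eq₀ hs']
    change (s : S) /ₒ (1 : S⁰) * (r /ₒ s) = r /ₒ 1
    simp

variable {T : Type v} [Ring T] [Algebra ℂ T]

/-- The extension of a homomorphism which maps nonzero elements to units to the division ring of
fractions. -/
noncomputable def fracLift (g : S →ₐ[ℂ] T) (hg : ∀ s, s ≠ 0 → IsUnit (g s)) :
    OreLocalization S⁰ S →ₐ[ℂ] T where
  __ := universalHom (g : S →+* T)
    (IsUnit.liftRight ((g : S →* T).comp S⁰.subtype)
      (fun s => by exact hg s (nonZeroDivisors.coe_ne_zero s)))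
    (fun s => rfl)
  commutes' c := (universalHom_commutes _ _ _).trans (AlgHomClass.commutes g c)

theorem fracLift_toFrac (g : S →ₐ[ℂ] T) (hg : ∀ s, s ≠ 0 → IsUnit (g s)) (s : S) :
    fracLift g hg (toFrac S s) = g s :=
  universalHom_commutes _ _ _

theorem frac_hom_ext {g g' : OreLocalization S⁰ S →ₐ[ℂ] T}
    (H : ∀ s, g (toFrac S s) = g' (toFrac S s)) : g = g' := by
  refine AlgHom.ext fun q => ?_
  obtain ⟨a, b, hb, rfl⟩ := exists_frac q
  have hb' : toFrac S b ≠ 0 := (_root_.map_ne_zero_iff _ toFrac_injective).mpr hb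
  have hu : IsUnit (g (toFrac S b)) := (isUnit_iff_ne_zero.mpr hb').map g
  refine hu.mul_left_cancel ?_
  rw [← map_mul, mul_inv_cancel_left₀ hb', H b, ← map_mul, mul_inv_cancel_left₀ hb', H]

/-- A derivation extends to the division ring of fractions. -/
theorem exists_frac_derivation (δ : S →ₗ[ℂ] S) (hδ : ∀ a b, δ (a * b) = δ a * b + a * δ b) :
    ∃ δ' : OreLocalization S⁰ S →ₗ[ℂ] OreLocalization S⁰ S,
      (∀ a b, δ' (a * b) = δ' a * b + a * δ' b) ∧ ∀ s, δ' (toFrac S s) = toFrac S (δ s) := by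
  have h1 : δ 1 = 0 := by
    have := hδ 1 1
    simpa using this
  let D := OreLocalization S⁰ S
  -- A derivation is an algebra homomorphism `s ↦ s + ε δ(s)` to the dual numbers, where an element
  -- with nonzero first component is a unit. Hence it extends to fractions.
  let g : S →ₐ[ℂ] TrivSqZeroExt D D :=
    { toFun := fun s => (toFrac S s, toFrac S (δ s))
      map_one' := by rw [h1, map_one, map_zero]; rfl
      map_mul' := fun a b => by
        refine TrivSqZeroExt.ext (map_mul _ _ _) ?_
        change toFrac S (δ (a * b)) = toFrac S a * toFrac S (δ b) + toFrac S (δ a) * toFrac S b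
        rw [hδ, map_add, map_mul, map_mul, add_comm]
      map_zero' := TrivSqZeroExt.ext (map_zero _) (by
        change toFrac S (δ 0) = 0
        rw [map_zero, map_zero])
      map_add' := fun a b => by rw [map_add, map_add, map_add]; rfl
      commutes' := fun c => by
        have hc : algebraMap ℂ S c = c • 1 := Algebra.algebraMap_eq_smul_one c
        refine TrivSqZeroExt.ext (AlgHomClass.commutes (toFrac S) c) ?_
        change toFrac S (δ _) = 0
        rw [hc, map_smul, h1, smul_zero, map_zero] }
  have hg : ∀ s, s ≠ 0 → IsUnit (g s) := fun s hs => by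
    rw [TrivSqZeroExt.isUnit_iff_isUnit_fst]
    exact isUnit_iff_ne_zero.mpr ((_root_.map_ne_zero_iff _ toFrac_injective).mpr hs)
  let G := fracLift g hg
  have hfst : ∀ q, (G q).fst = q := fun q => by
    have : (TrivSqZeroExt.fstHom ℂ D D).comp G = AlgHom.id ℂ D := frac_hom_ext fun s => by
      change (G (toFrac S s)).fst = toFrac S s
      rw [fracLift_toFrac]
      rfl
    exact DFunLike.congr_fun this q
  refine ⟨⟨⟨fun q => (G q).snd, fun a b => by rw [map_add]; rfl⟩, fun c a => ?_⟩, fun a b => ?_,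
    fun s => ?_⟩
  · change (G (c • a)).snd = c • (G a).snd
    rw [map_smul]
    rfl
  · change (G (a * b)).snd = (G a).snd * b + a * (G b).snd
    rw [map_mul, TrivSqZeroExt.snd_mul, hfst, hfst, add_comm]
    rfl
  · change (G (toFrac S s)).snd = _
    rw [fracLift_toFrac]
    rfl

end Frac

variable {I : Type u} [LinearOrder I] {h : ℂ}

/-- Elements of the localisation are left fractions `b⁻¹ a`; the right Ore condition `a c = b d`
rewrites them as `d c⁻¹`. -/
theorem isQuotientDivisionRing_toFrac : IsQuotientDivisionRing (toFrac (HAlg h I)) where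
  injective := toFrac_injective
  exists_quotient q := by
    obtain ⟨a, b, hb, rfl⟩ := exists_frac q
    obtain ⟨c, d, hcd, hc⟩ := HAlg.polyGrowth.right_ore a hb
    have hb' : toFrac (HAlg h I) b ≠ 0 := (_root_.map_ne_zero_iff _ toFrac_injective).mpr hb
    have hc' : toFrac (HAlg h I) c ≠ 0 := (_root_.map_ne_zero_iff _ toFrac_injective).mpr hc
    refine ⟨d, c, hc, ?_⟩
    rw [eq_mul_inv_iff_mul_eq₀ hc', mul_assoc, ← map_mul, hcd, map_mul, inv_mul_cancel_left₀ hb']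

/-- An injective homomorphism to a division ring extends to the quotient division ring. -/
theorem IsQuotientDivisionRing.exists_extension {Q : Type v} [DivisionRing Q] [Algebra ℂ Q]
    {ι : HAlg h I →ₐ[ℂ] Q} (hq : IsQuotientDivisionRing ι) {D : Type w} [DivisionRing D]
    [Algebra ℂ D] {g : HAlg h I →ₐ[ℂ] D} (hg : Function.Injective g) :
    ∃ κ : Q →ₐ[ℂ] D, ∀ a, κ (ι a) = g a := by
  have hu : ∀ {D : Type w} [DivisionRing D] [Algebra ℂ D] {g : HAlg h I →ₐ[ℂ] D},
      Function.Injective g → ∀ s, s ≠ 0 → IsUnit (g s) := fun hg s hs =>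
    isUnit_iff_ne_zero.mpr ((_root_.map_ne_zero_iff _ hg).mpr hs)
  have hu' : ∀ s, s ≠ 0 → IsUnit (ι s) := fun s hs =>
    isUnit_iff_ne_zero.mpr ((_root_.map_ne_zero_iff _ hq.injective).mpr hs)
  -- The division ring of Ore fractions maps isomorphically onto `Q`, so its universal property
  -- becomes available for `Q`.
  let e := fracLift ι hu'
  have he : Function.Bijective e := by
    refine ⟨e.toRingHom.injective, fun q => ?_⟩
    obtain ⟨a, b, -, rfl⟩ := hq.exists_quotient q
    refine ⟨toFrac _ a * (toFrac _ b)⁻¹, ?_⟩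
    rw [map_mul, map_inv₀, fracLift_toFrac, fracLift_toFrac]
  let e' := AlgEquiv.ofBijective e he
  refine ⟨(fracLift g (hu hg)).comp e'.symm.toAlgHom, fun a => ?_⟩
  have : e'.symm (ι a) = toFrac _ a := by
    rw [AlgEquiv.symm_apply_eq]
    exact (fracLift_toFrac ι hu' a).symm
  change fracLift g (hu hg) (e'.symm (ι a)) = _
  rw [this, fracLift_toFrac]

end Quotient
end NCForms

namespace NCForms

/-! ## An algebraically closed field with a derivation -/

/-- Derivations extend along formally étale algebras. -/
theorem exists_derivation_extension {A : Type u} {L : Type v} [CommRing A] [CommRing L]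
    [Algebra ℂ A] [Algebra ℂ L] [Algebra A L] [IsScalarTower ℂ A L] [Algebra.FormallyEtale A L]
    (d₀ : Derivation ℂ A L) : ∃ d : Derivation ℂ L L, ∀ a, d (algebraMap A L a) = d₀ a := by
  let φ : TensorProduct A L (Ω[A⁄ℂ]) →ₗ[L] L := d₀.liftKaehlerDifferential.liftBaseChange L
  let e := KaehlerDifferential.tensorKaehlerEquivOfFormallyEtale ℂ A L
  refine ⟨(φ ∘ₗ e.symm.toLinearMap).compDer (KaehlerDifferential.D ℂ L), fun a => ?_⟩
  change φ (e.symm (KaehlerDifferential.D ℂ L (algebraMap A L a))) = _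
  rw [KaehlerDifferential.tensorKaehlerEquivOfFormallyEtale_symm_D_algebraMap]
  simp [φ]

/-- The algebraic closure of the field of fractions of the ring of parameters. -/
abbrev ParField (I : Type u) [LinearOrder I] : Type u := AlgebraicClosure (FractionRing (PolyGen I))

variable (I : Type u) [LinearOrder I]

/-- Localisation is formally étale, and so is a separable algebraic field extension; hence the
derivation of the polynomial ring extends to the algebraic closure of its field of fractions. -/
theorem exists_parDer : ∃ d : Derivation ℂ (ParField I) (ParField I), ParDer I d := by
  have : Algebra.FormallyEtale (PolyGen I) (FractionRing (PolyGen I)) :=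
    Algebra.FormallyEtale.of_isLocalization (nonZeroDivisors (PolyGen I))
  have : Algebra.FormallyEtale (FractionRing (PolyGen I)) (ParField I) :=
    Algebra.FormallyEtale.of_isSeparable _ _
  have : Algebra.FormallyEtale (PolyGen I) (ParField I) :=
    Algebra.FormallyEtale.comp _ (FractionRing (PolyGen I)) _
  obtain ⟨d, hd⟩ := exists_derivation_extension (A := PolyGen I) (L := ParField I)
    (MvPolynomial.mkDerivation ℂ (Sum.elim (rpar (ParField I)) 0))
  refine ⟨d, ⟨?_, fun i => ?_, fun i => ?_⟩⟩
  · rw [IsScalarTower.algebraMap_eq (PolyGen I) (FractionRing (PolyGen I)) (ParField I)]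
    exact (algebraMap (FractionRing (PolyGen I)) (ParField I)).injective.comp
      (IsFractionRing.injective _ _)
  · rw [vpar, hd, MvPolynomial.mkDerivation_X]
    rfl
  · rw [rpar, hd, MvPolynomial.mkDerivation_X]
    rfl

end NCForms

namespace NCForms

/-! ## Division subalgebras -/

section DivisionSubalgebra

variable {D : Type u} [DivisionRing D] [Algebra ℂ D]

theorem exists_divisionRing (K : Subalgebra ℂ D) (hK : ∀ a ∈ K, a⁻¹ ∈ K) :
    ∃ (R : Type u) (_ : DivisionRing R) (_ : Algebra ℂ R) (j : R →ₐ[ℂ] D), j.range = K := by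
  have hu : ∀ a : K, IsUnit a ∨ a = 0 := fun a => by
    by_cases ha : a = 0
    · exact Or.inr ha
    · have ha' : (a : D) ≠ 0 := fun H => ha (Subtype.ext H)
      exact Or.inl ⟨⟨a, ⟨_, hK a a.2⟩, Subtype.ext (mul_inv_cancel₀ ha'),
        Subtype.ext (inv_mul_cancel₀ ha')⟩, rfl⟩
  let dK : DivisionRing K := DivisionRing.ofIsUnitOrEqZero hu
  exact ⟨K, dK, inferInstance, K.val, K.range_val⟩

/-- Adjoining a central root of an element to a division subalgebra gives a division
subalgebra. -/
theorem inv_mem_adjoin_insert {A : Set D} (hA : ∀ a ∈ Algebra.adjoin ℂ A, a⁻¹ ∈ Algebra.adjoin ℂ A)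
    {c : D} (hc : ∀ r, c * r = r * c) {n : ℕ} (hn : n ≠ 0) (hcn : c ^ n ∈ Algebra.adjoin ℂ A) :
    ∀ a ∈ Algebra.adjoin ℂ (insert c A), a⁻¹ ∈ Algebra.adjoin ℂ (insert c A) := by
  obtain ⟨R, _, _, j, hj⟩ := exists_divisionRing _ hA
  have hcp : ∀ i r, c ^ i * r = r * c ^ i := fun i r => (Commute.pow_left (hc r) i)
  let _ : Module R D := Module.compHom D j.toRingHom
  have hsmul : ∀ (r : R) (x : D), r • x = j r * x := fun _ _ => rfl
  have : IsScalarTower R D D := ⟨fun r x z => by rw [hsmul, smul_eq_mul, mul_assoc]; rfl⟩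
  -- The left span of `1, c, …, c^(n-1)` over the smaller division ring is finite-dimensional, and
  -- it coincides with the algebra generated after adjoining `c`.
  let M : Submodule R D := Submodule.span R (Set.range fun i : Fin n => c ^ (i : ℕ))
  have hfin : FiniteDimensional R M := FiniteDimensional.span_of_finite R (Set.finite_range _)
  have hM : ∀ i, c ^ i ∈ M := fun i => by
    induction i using Nat.strong_induction_on with
    | _ i ih =>
      rcases lt_or_ge i n with hi | hi
      · exact Submodule.subset_span ⟨⟨i, hi⟩, rfl⟩
      · rw [← hj] at hcn
        obtain ⟨r, hr⟩ := hcn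
        have : c ^ i = r • c ^ (i - n) := by
          rw [hsmul]
          change _ = j.toRingHom r * _
          rw [hr, ← pow_add, Nat.add_sub_cancel' hi]
        rw [this]
        exact M.smul_mem _ (ih _ (by omega))
  have hmul : ∀ a ∈ M, ∀ b ∈ M, a * b ∈ M := fun a ha b hb => by
    induction ha using Submodule.span_induction with
    | zero => rw [zero_mul]; exact M.zero_mem
    | add a a' _ _ h1 h2 => rw [add_mul]; exact M.add_mem h1 h2
    | smul r a _ h1 => rw [smul_mul_assoc]; exact M.smul_mem _ h1
    | mem a ha =>
      obtain ⟨i, rfl⟩ := ha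
      induction hb using Submodule.span_induction with
      | zero => rw [mul_zero]; exact M.zero_mem
      | add b b' _ _ h1 h2 => rw [mul_add]; exact M.add_mem h1 h2
      | smul r b _ h1 =>
        rw [hsmul, ← mul_assoc, hcp, mul_assoc, ← hsmul]
        exact M.smul_mem _ h1
      | mem b hb =>
        obtain ⟨k, rfl⟩ := hb
        simp only [← pow_add]
        exact hM _
  have h1M : (1 : D) ∈ M := by simpa using hM 0
  have hle : ∀ a ∈ Algebra.adjoin ℂ (insert c A), a ∈ M := fun a ha => by
    have hj' : ∀ b ∈ Algebra.adjoin ℂ A, b ∈ M := fun b hb => by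
      rw [← hj] at hb
      obtain ⟨r, rfl⟩ := hb
      have : j.toRingHom r = r • (1 : D) := by rw [hsmul, mul_one]; rfl
      rw [this]
      exact M.smul_mem _ h1M
    induction ha using Algebra.adjoin_induction with
    | mem b hb =>
      rcases hb with rfl | hb
      · simpa using hM 1
      · exact hj' b (Algebra.subset_adjoin hb)
    | algebraMap z => exact hj' _ (Subalgebra.algebraMap_mem _ z)
    | add a b _ _ h1 h2 => exact M.add_mem h1 h2
    | mul a b _ _ h1 h2 => exact hmul a h1 b h2
  have hge : ∀ a ∈ M, a ∈ Algebra.adjoin ℂ (insert c A) := fun a ha => by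
    induction ha using Submodule.span_induction with
    | zero => exact Subalgebra.zero_mem _
    | add a a' _ _ h1 h2 => exact Subalgebra.add_mem _ h1 h2
    | smul r a _ h1 =>
      refine Subalgebra.mul_mem _ (Algebra.adjoin_mono (Set.subset_insert c A) ?_) h1
      rw [← hj]
      exact ⟨r, rfl⟩
    | mem a ha =>
      obtain ⟨i, rfl⟩ := ha
      exact Subalgebra.pow_mem _ (Algebra.subset_adjoin (Set.mem_insert c A)) _
  intro a ha
  by_cases ha0 : a = 0
  · rw [ha0, inv_zero]
    exact Subalgebra.zero_mem _
  -- Right multiplication by `a ≠ 0` is an injective endomorphism of a finite-dimensional space, so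
  -- it is surjective and `1` is attained.
  let g : M →ₗ[R] M :=
    { toFun := fun m => ⟨m * a, hmul m m.2 a (hle a ha)⟩
      map_add' := fun m m' => Subtype.ext (add_mul _ _ _)
      map_smul' := fun r m => Subtype.ext (smul_mul_assoc r (m : D) a) }
  have hg : Function.Injective g := fun m m' H =>
    Subtype.ext (mul_right_cancel₀ ha0 (congrArg Subtype.val H))
  obtain ⟨m, hm⟩ := (LinearMap.injective_iff_surjective.mp hg) ⟨1, h1M⟩
  have hma : (m : D) * a = 1 := congrArg Subtype.val hm
  rw [← eq_inv_of_mul_eq_one_left hma]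
  exact hge m m.2

theorem map_mem_of_twisted {τ τ' P : D →ₗ[ℂ] D} (hP : ∀ a b, P (a * b) = P a * τ b + τ' a * P b)
    {A : Set D} (hP1 : P 1 = 0) (hτ : ∀ a ∈ Algebra.adjoin ℂ A, τ a ∈ Algebra.adjoin ℂ A)
    (hτ' : ∀ a ∈ Algebra.adjoin ℂ A, τ' a ∈ Algebra.adjoin ℂ A)
    (hA : ∀ a ∈ A, P a ∈ Algebra.adjoin ℂ A) :
    ∀ a ∈ Algebra.adjoin ℂ A, P a ∈ Algebra.adjoin ℂ A := fun a ha => by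
  induction ha using Algebra.adjoin_induction with
  | mem b hb => exact hA b hb
  | algebraMap z =>
    rw [Algebra.algebraMap_eq_smul_one, map_smul, hP1, smul_zero]
    exact Subalgebra.zero_mem _
  | add a b _ _ h1 h2 => rw [map_add]; exact Subalgebra.add_mem _ h1 h2
  | mul a b ha hb h1 h2 =>
    rw [hP]
    exact Subalgebra.add_mem _ (Subalgebra.mul_mem _ h1 (hτ b hb))
      (Subalgebra.mul_mem _ (hτ' a ha) h2)

theorem exists_restrict_linearMap {R : Type v} [DivisionRing R] [Algebra ℂ R] (j : R →ₐ[ℂ] D)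
    {P : D →ₗ[ℂ] D} (hP : ∀ a ∈ j.range, P a ∈ j.range) :
    ∃ P' : R →ₗ[ℂ] R, ∀ r, j (P' r) = P (j r) := by
  have hj : Function.Injective j := j.toRingHom.injective
  choose g hg using fun r => hP (j r) ⟨r, rfl⟩
  have hg : ∀ r, j (g r) = P (j r) := hg
  refine ⟨⟨⟨g, fun a b => hj ?_⟩, fun c a => hj ?_⟩, hg⟩
  · rw [map_add, hg, hg, hg, map_add, map_add]
  · change j (g (c • a)) = j (c • g a)
    rw [map_smul, hg, hg, map_smul, map_smul]

variable {I : Type u} [LinearOrder I] {h : ℂ}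

theorem ExtendedAction.twisted_one {φ : HAlg h I →ₐ[ℂ] D} (act : ExtendedAction φ) :
    act.E 1 = 0 ∧ act.F 1 = 0 ∧ act.H 1 = 0 := by
  have h1 := act.E_mul 1 1
  have h2 := act.F_mul 1 1
  have h3 := act.H_mul 1 1
  simp only [mul_one, map_one, one_mul] at h1 h2 h3
  exact ⟨left_eq_add.mp h1, left_eq_add.mp h2, left_eq_add.mp h3⟩

/-- An extended action restricts to stable division subalgebras. -/
theorem ExtendedAction.exists_restrict {φ : HAlg h I →ₐ[ℂ] D} (act : ExtendedAction φ)
    {R : Type v} [DivisionRing R] [Algebra ℂ R] (j : R →ₐ[ℂ] D) {φ' : HAlg h I →ₐ[ℂ] R}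
    (hφ : ∀ a, j (φ' a) = φ a) {A : Set D} (hA : j.range = Algebra.adjoin ℂ A)
    (hE : ∀ a ∈ A, act.E a ∈ Algebra.adjoin ℂ A) (hF : ∀ a ∈ A, act.F a ∈ Algebra.adjoin ℂ A)
    (hH : ∀ a ∈ A, act.H a ∈ Algebra.adjoin ℂ A) (hT : ∀ a ∈ A, act.T a ∈ Algebra.adjoin ℂ A)
    (hT' : ∀ a ∈ A, act.T.symm a ∈ Algebra.adjoin ℂ A) :
    ∃ act' : ExtendedAction φ', ∀ r, act.IsInvariant (j r) → act'.IsInvariant r := by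
  have hj : Function.Injective j := j.toRingHom.injective
  have hom : ∀ g : D →ₐ[ℂ] D, (∀ a ∈ A, g a ∈ Algebra.adjoin ℂ A) →
      ∀ a ∈ Algebra.adjoin ℂ A, g a ∈ Algebra.adjoin ℂ A := fun g hg a ha => by
    have : Algebra.adjoin ℂ A ≤ (Algebra.adjoin ℂ A).comap g := Algebra.adjoin_le hg
    exact this ha
  have hTs := hom act.T.toAlgHom hT
  have hTs' := hom act.T.symm.toAlgHom hT'
  obtain ⟨e1, f1, g1⟩ := act.twisted_one
  have hE' := map_mem_of_twisted (τ := act.T.symm.toLinearMap) (τ' := act.T.toLinearMap)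
    act.E_mul e1 hTs' hTs hE
  have hH' := map_mem_of_twisted (τ := act.T.symm.toLinearMap) (τ' := act.T.toLinearMap)
    act.H_mul g1 hTs' hTs hH
  have hF' := map_mem_of_twisted (τ := LinearMap.id) (τ' := LinearMap.id)
    act.F_mul f1 (fun _ => id) (fun _ => id) hF
  rw [← hA] at hE' hH' hF' hTs hTs'
  obtain ⟨E, hE⟩ := exists_restrict_linearMap j hE'
  obtain ⟨F, hF⟩ := exists_restrict_linearMap j hF'
  obtain ⟨H, hH⟩ := exists_restrict_linearMap j hH'
  obtain ⟨T, hT⟩ := exists_restrict_linearMap (P := act.T.toLinearMap) j hTs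
  obtain ⟨T', hT'⟩ := exists_restrict_linearMap (P := act.T.symm.toLinearMap) j hTs'
  replace hT : ∀ r, j (T r) = act.T (j r) := hT
  replace hT' : ∀ r, j (T' r) = act.T.symm (j r) := hT'
  let Te : R ≃ₐ[ℂ] R := AlgEquiv.ofLinearEquiv
    (LinearEquiv.ofLinearMap T T' (LinearMap.ext fun r => hj (by simp [hT, hT']))
      (LinearMap.ext fun r => hj (by simp [hT, hT'])))
    (hj (by
      change j (T 1) = _
      rw [hT, map_one, map_one])) (fun a b => hj (by
      change j (T (a * b)) = j (T a * T b)
      rw [hT, map_mul, map_mul, map_mul, hT, hT]))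
  have hTe : ∀ r, j (Te r) = act.T (j r) := hT
  have hTe' : ∀ r, j (Te.symm r) = act.T.symm (j r) := hT'
  refine ⟨⟨E, F, H, Te, fun a => hj ?_, fun a => hj ?_, fun a => hj ?_, fun a => hj ?_,
    fun a b => hj ?_, fun a b => hj ?_, fun a b => hj ?_⟩, fun r hr => ⟨hj ?_, hj ?_, hj ?_, hj ?_⟩⟩
  · rw [hE, hφ, hφ, act.E_coe]
  · rw [hF, hφ, hφ, act.F_coe]
  · rw [hH, hφ, hφ, act.H_coe]
  · rw [hTe, hφ, hφ, act.T_coe]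
  · simp only [hE, map_mul, map_add, hTe, hTe', act.E_mul]
  · simp only [hF, map_mul, map_add, act.F_mul]
  · simp only [hH, map_mul, map_add, hTe, hTe', act.H_mul]
  · exact (hE r).trans (hr.1.trans (map_zero j).symm)
  · exact (hF r).trans (hr.2.1.trans (map_zero j).symm)
  · exact (hH r).trans (hr.2.2.1.trans (map_zero j).symm)
  · exact (hTe r).trans hr.2.2.2

theorem expF_expF (t t' : ℂ) (a : HAlg h I) : expF t (expF t' a) = expF (t + t') a := by
  induction a using induction with
  | hx i => simp only [expF_x, expF_y, map_add, map_smul, add_smul, add_assoc]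
  | hy i => simp only [expF_y]
  | hc c => simp only [AlgHomClass.commutes]
  | hadd a b ha hb => simp only [map_add, ha, hb]
  | hmul a b ha hb => simp only [map_mul, ha, hb]

/-- An extended action preserves the division ring generated by `H_I`. -/
theorem ExtendedAction.map_mem_range {Q : Type v} [DivisionRing Q] [Algebra ℂ Q]
    {ι : HAlg h I →ₐ[ℂ] Q} (hq : IsQuotientDivisionRing ι) {κ : Q →ₐ[ℂ] D}
    (act : ExtendedAction (κ.comp ι)) (q : Q) : act.E (κ q) ∈ κ.range ∧ act.F (κ q) ∈ κ.range ∧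
      act.H (κ q) ∈ κ.range ∧ act.T (κ q) ∈ κ.range ∧ act.T.symm (κ q) ∈ κ.range := by
  have hE : ∀ a, act.E (κ (ι a)) = κ (ι (actE a)) := act.E_coe
  have hF : ∀ a, act.F (κ (ι a)) = κ (ι (actF a)) := act.F_coe
  have hH : ∀ a, act.H (κ (ι a)) = κ (ι (actH a)) := act.H_coe
  have hT : ∀ a, act.T (κ (ι a)) = κ (ι (expF h a)) := act.T_coe
  have hT' : ∀ a, act.T.symm (κ (ι a)) = κ (ι (expF (-h) a)) := fun a => by
    rw [AlgEquiv.symm_apply_eq, hT, expF_expF, add_neg_cancel, expF_zero]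
  obtain ⟨e1, f1, g1⟩ := act.twisted_one
  have tw : ∀ {P τ τ' : D → D}, (∀ a b, P (a * b) = P a * τ b + τ' a * P b) → P 1 = 0 →
      (∀ b : HAlg h I, b ≠ 0 → τ' (κ (ι b)) ≠ 0) →
      (∀ b, P (κ (ι b)) ∈ κ.range) → (∀ b, τ' (κ (ι b)) ∈ κ.range) →
      (∀ b, τ (κ (ι b))⁻¹ ∈ κ.range) → P (κ q) ∈ κ.range := by
    intro P τ τ' hP hP1 hτ0 hPb hτb hτi
    obtain ⟨a, b, hb, rfl⟩ := hq.exists_quotient q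
    have hb' : κ (ι b) ≠ 0 := (_root_.map_ne_zero κ).mpr
      ((_root_.map_ne_zero_iff _ hq.injective).mpr hb)
    have hinv : ∀ z ∈ κ.range, z⁻¹ ∈ κ.range := by
      rintro _ ⟨z, rfl⟩
      exact ⟨z⁻¹, map_inv₀ _ _⟩
    -- The value on an inverse is forced by `P (b b⁻¹) = P 1 = 0`.
    have hPi : P (κ (ι b))⁻¹ = -((τ' (κ (ι b)))⁻¹ * (P (κ (ι b)) * τ (κ (ι b))⁻¹)) := by
      have := hP (κ (ι b)) (κ (ι b))⁻¹
      rw [mul_inv_cancel₀ hb', hP1] at this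
      rw [← mul_neg, eq_inv_mul_iff_mul_eq₀ (hτ0 b hb)]
      exact eq_neg_of_add_eq_zero_right this.symm
    rw [map_mul, map_inv₀, hP, hPi]
    exact add_mem (mul_mem (hPb a) (hτi b)) (mul_mem (hτb a)
      (neg_mem (mul_mem (hinv _ (hτb b)) (mul_mem (hPb b) (hτi b)))))
  have hne : ∀ b : HAlg h I, b ≠ 0 → act.T (κ (ι b)) ≠ 0 := fun b hb =>
    (_root_.map_ne_zero act.T).mpr ((_root_.map_ne_zero κ).mpr
      ((_root_.map_ne_zero_iff _ hq.injective).mpr hb))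
  have hTr : ∀ b, act.T (κ (ι b)) ∈ κ.range := fun b => ⟨_, (hT b).symm⟩
  have hTi : ∀ b, act.T.symm (κ (ι b))⁻¹ ∈ κ.range := fun b =>
    ⟨(ι (expF (-h) b))⁻¹, by change κ _ = _; rw [map_inv₀, map_inv₀, hT']⟩
  refine ⟨tw act.E_mul e1 hne (fun b => ⟨_, (hE b).symm⟩) hTr hTi,
    tw (τ := id) (τ' := id) act.F_mul f1
      (fun b hb => (_root_.map_ne_zero κ).mpr ((_root_.map_ne_zero_iff _ hq.injective).mpr hb))
      (fun b => ⟨_, (hF b).symm⟩) (fun b => ⟨_, rfl⟩) (fun b => ⟨(ι b)⁻¹, map_inv₀ _ _⟩),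
    tw act.H_mul g1 hne (fun b => ⟨_, (hH b).symm⟩) hTr hTi, ?_, ?_⟩
  · obtain ⟨a, b, -, rfl⟩ := hq.exists_quotient q
    exact ⟨ι (expF h a) * (ι (expF h b))⁻¹, by
      change κ _ = _
      rw [map_mul, map_inv₀, map_mul, map_inv₀, map_mul, map_inv₀, hT, hT]⟩
  · obtain ⟨a, b, -, rfl⟩ := hq.exists_quotient q
    exact ⟨ι (expF (-h) a) * (ι (expF (-h) b))⁻¹, by
      change κ _ = _
      rw [map_mul, map_inv₀, map_mul, map_inv₀, map_mul, map_inv₀, hT', hT']⟩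

end DivisionSubalgebra

end NCForms

namespace NCForms

/-! ## Existence of the central extension -/

section Existence

variable {I : Type u} [LinearOrder I] {h : ℂ}
  {L : Type u} [Field L] [Algebra ℂ L] [Algebra (PolyGen I) L]
  [IsScalarTower ℂ (PolyGen I) L] {d : Derivation ℂ L L}

/-- The scalars of the field of fractions of the shift algebra. -/
noncomputable def fracScalar (h : ℂ) (l : L) :
    OreLocalization (nonZeroDivisors (ShiftAlg (algebraMap ℂ L h))) (ShiftAlg (algebraMap ℂ L h)) :=
  toFrac _ (algebraMap L _ l)

theorem fracScalar_comm (l : L)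
    (q : OreLocalization (nonZeroDivisors (ShiftAlg (algebraMap ℂ L h)))
      (ShiftAlg (algebraMap ℂ L h))) : fracScalar h l * q = q * fracScalar h l := by
  have hc : ∀ a, Commute (fracScalar h l) (toFrac (ShiftAlg (algebraMap ℂ L h)) a) := fun a => by
    change _ * _ = _ * _
    rw [fracScalar, ← map_mul, Algebra.commutes, map_mul]
  obtain ⟨a, b, -, rfl⟩ := exists_frac q
  exact ((hc b).inv_right₀.mul_right (hc a))

/-- An action of `E, F, H` given by three derivations, twisted by an element `t`. -/
theorem exists_extendedAction_of_derivation {D : Type u} [DivisionRing D] [Algebra ℂ D]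
    {φ : HAlg h I →ₐ[ℂ] D} {t : D} (ht : t ≠ 0) {dE dF dH : D →ₗ[ℂ] D}
    (hE : ∀ a b, dE (a * b) = dE a * b + a * dE b) (hF : ∀ a b, dF (a * b) = dF a * b + a * dF b)
    (hH : ∀ a b, dH (a * b) = dH a * b + a * dH b) (hE' : ∀ a, dE (φ a) = t * φ (actE a) * t)
    (hF' : ∀ a, dF (φ a) = φ (actF a)) (hH' : ∀ a, dH (φ a) = t * φ (actH a) * t)
    (hT' : ∀ a, φ a * t = t * φ (expF h a)) : ∃ act : ExtendedAction φ,
      ∀ c, (∀ r, c * r = r * c) → dE c = 0 → dF c = 0 → dH c = 0 → act.IsInvariant c := by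
  -- As `dE` and `dH` realise `t E(a) t` and `t H(a) t`, the operators are recovered by dividing by
  -- `t` on both sides, and conjugation by `t` provides `T`.
  let sand : (D →ₗ[ℂ] D) → D →ₗ[ℂ] D := fun P =>
    (LinearMap.mulLeft ℂ t⁻¹).comp ((LinearMap.mulRight ℂ t⁻¹).comp P)
  have hs : ∀ P a, sand P a = t⁻¹ * (P a * t⁻¹) := fun _ _ => rfl
  let T : D ≃ₐ[ℂ] D := AlgEquiv.ofLinearEquiv
    (LinearEquiv.ofLinearMap ((LinearMap.mulLeft ℂ t⁻¹).comp (LinearMap.mulRight ℂ t))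
      ((LinearMap.mulLeft ℂ t).comp (LinearMap.mulRight ℂ t⁻¹))
      (LinearMap.ext fun r => by simp [mul_assoc, ht]) (LinearMap.ext fun r => by simp [mul_assoc, ht]))
    (by
      change t⁻¹ * (1 * t) = 1
      rw [one_mul, inv_mul_cancel₀ ht])
    (fun a b => by
      change t⁻¹ * (a * b * t) = t⁻¹ * (a * t) * (t⁻¹ * (b * t))
      rw [mul_assoc t⁻¹ (a * t), mul_assoc a t, mul_inv_cancel_left₀ ht, mul_assoc a])
  have hT : ∀ a, T a = t⁻¹ * (a * t) := fun _ => rfl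
  have hTs : ∀ a, T.symm a = t * (a * t⁻¹) := fun _ => rfl
  have hmul : ∀ {P : D →ₗ[ℂ] D}, (∀ a b, P (a * b) = P a * b + a * P b) →
      ∀ a b, sand P (a * b) = sand P a * T.symm b + T a * sand P b := fun hP a b => by
    rw [hs, hs, hs, hP, hT, hTs, add_mul, mul_add]
    simp only [mul_assoc, inv_mul_cancel_left₀ ht, mul_inv_cancel_left₀ ht]
  have hcoe : ∀ z, t⁻¹ * (t * z * t * t⁻¹) = z := fun z => by
    rw [mul_inv_cancel_right₀ ht, inv_mul_cancel_left₀ ht]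
  refine ⟨⟨sand dE, dF, sand dH, T, fun a => ?_, hF', fun a => ?_, fun a => ?_, hmul hE, hF,
    hmul hH⟩, fun c hc h1 h2 h3 => ⟨?_, h2, ?_, ?_⟩⟩
  · rw [hs, hE', hcoe]
  · rw [hs, hH', hcoe]
  · rw [hT, hT', inv_mul_cancel_left₀ ht]
  · change sand dE c = 0
    rw [hs, h1, zero_mul, mul_zero]
  · change sand dH c = 0
    rw [hs, h3, zero_mul, mul_zero]
  · change T c = c
    rw [hT, hc, inv_mul_cancel_left₀ ht]

/-- The action of the quantum group extends to the field of fractions of the shift algebra. -/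
theorem exists_extendedAction (hh : h ≠ 0) (hd : ParDer I d) :
    ∃ act : ExtendedAction ((toFrac (ShiftAlg (algebraMap ℂ L h))).comp (gpsi L h I)),
      ∀ l, d l = 0 → act.IsInvariant (fracScalar h l) := by
  obtain ⟨dE, hE, hE'⟩ := exists_frac_derivation (derE (algebraMap ℂ L h) d) (derE_mul d)
  obtain ⟨dF, hF, hF'⟩ := exists_frac_derivation (derF (algebraMap ℂ L h)) derF_mul
  obtain ⟨dH, hH, hH'⟩ := exists_frac_derivation (derH (algebraMap ℂ L h)) derH_mul
  obtain ⟨act, hact⟩ := exists_extendedAction_of_derivation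
    (φ := (toFrac (ShiftAlg (algebraMap ℂ L h))).comp (gpsi L h I)) (t := toFrac _ (yel h 1))
    ((_root_.map_ne_zero_iff _ toFrac_injective).mpr (yel_ne_zero one_ne_zero)) hE hF hH
    (fun a => (hE' _).trans ((congrArg _ (derE_psi hh hd.vpar hd.rpar a)).trans
      ((map_mul _ _ _).trans (congrArg (· * _) (map_mul _ _ _)))))
    (fun a => (hF' _).trans (congrArg _ (derF_psi _ _ a)))
    (fun a => (hH' _).trans ((congrArg _ (derH_psi hh _ _ a)).trans
      ((map_mul _ _ _).trans (congrArg (· * _) (map_mul _ _ _)))))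
    (fun a => (map_mul (toFrac _) (gpsi L h I a) (yel h 1)).symm.trans
      ((congrArg (toFrac _) (psi_mul_yel_right _ _ 1 a)).trans
        (map_mul (toFrac _) (yel h 1) (gpsi L h I (expF h a)))))
  refine ⟨act, fun l hl => hact _ (fracScalar_comm l) ?_ ?_ ?_⟩
  · exact (hE' _).trans (by rw [derE_algebraMap, hl, map_zero, map_zero])
  · exact (hF' _).trans (by rw [derF_algebraMap, map_zero])
  · exact (hH' _).trans (by rw [derH_algebraMap, map_zero])

/-- Cardano's radicals. -/
theorem exists_cardano_roots {L : Type u} [Field L] [IsAlgClosed L] [CharZero L] {a e j f : L}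
    (H : 4 * a ^ 3 + j ^ 2 + e * f ^ 2 = 0) : ∃ s u₁ u₂ : L, s ^ 2 = -e ∧
      u₁ ^ 3 = (j + f * s) / 2 ∧ u₂ ^ 3 = (j - f * s) / 2 ∧ u₁ * u₂ = -a := by
  obtain ⟨s, hs⟩ := IsAlgClosed.exists_pow_nat_eq (-e) two_pos
  obtain ⟨u, hu⟩ := IsAlgClosed.exists_pow_nat_eq ((j + f * s) / 2) three_pos
  have hprod : (j + f * s) / 2 * ((j - f * s) / 2) = (-a) ^ 3 := by
    linear_combination (1 / 4) * H - (1 / 4) * f ^ 2 * hs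
  -- The product of the two radicands is `(-a)³`. For `u ≠ 0` the matching root is `-a / u`; for `u
  -- = 0` also `a = 0`, and any cube root serves.
  by_cases hu0 : u = 0
  · obtain ⟨w, hw⟩ := IsAlgClosed.exists_pow_nat_eq ((j - f * s) / 2) three_pos
    refine ⟨s, u, w, hs, hu, hw, ?_⟩
    rw [← hu, hu0, zero_pow three_ne_zero, zero_mul, eq_comm] at hprod
    rw [hu0, zero_mul, eq_zero_of_pow_eq_zero hprod]
  · refine ⟨s, u, -a / u, hs, hu, ?_, mul_div_cancel₀ _ hu0⟩
    rw [div_pow, ← hprod, hu, mul_div_cancel_left₀]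
    rw [← hu]
    exact pow_ne_zero 3 hu0

theorem der_eq_zero_of_pow {L : Type u} [Field L] [Algebra ℂ L] (d : Derivation ℂ L L) {c : L}
    {n : ℕ} (hn : n ≠ 0) (H : d (c ^ n) = 0) : d c = 0 := by
  have : CharZero L := charZero_of_injective_algebraMap (algebraMap ℂ L).injective
  rcases eq_or_ne c 0 with rfl | hc
  · exact map_zero d
  · rw [Derivation.leibniz_pow, nsmul_eq_mul, smul_eq_mul] at H
    exact (mul_eq_zero.mp ((mul_eq_zero.mp H).resolve_left (Nat.cast_ne_zero.mpr hn))).resolve_left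
      (pow_ne_zero _ hc)

variable {o p : I} {Q : Type u} [DivisionRing Q] [Algebra ℂ Q] {ι : HAlg h I →ₐ[ℂ] Q}

/-- The syzygy at the parameters of `p` lets the cube roots be matched. The radicands are constants
of `d`, hence so are the radicals, by `der_eq_zero_of_pow`. -/
theorem CubicForm.exists_radicals [IsAlgClosed L] (f : CubicForm h o p) (hh : h ≠ 0)
    (hd : ParDer I d) (hop : o ≠ p) : ∃ D₃ j₁ f₁ a s u₁ u₂ : L,
      gpsi L h I f.disc = algebraMap L _ D₃ ∧ gpsi L h I f.cubicCov₁ = algebraMap L _ j₁ ∧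
      gpsi L h I f.f₁ = algebraMap L _ f₁ ∧ gpsi L h I f.hessian₁ = algebraMap L _ a ∧
      s ^ 2 = -D₃ ∧ u₁ ^ 3 = (j₁ + f₁ * s) / 2 ∧ u₂ ^ 3 = (j₁ - f₁ * s) / 2 ∧ u₁ * u₂ = -a ∧
      d s = 0 ∧ d u₁ = 0 ∧ d u₂ = 0 := by
  have : CharZero L := charZero_of_injective_algebraMap (algebraMap ℂ L).injective
  obtain ⟨α, β, γ, δ, hr⟩ := f.exists_real hh (vpar L) (rpar L)
  have hc := hr.coeffDer hh hd
  have e : 4 * hessVal α β γ δ (vpar L p) (rpar L p) ^ 3 +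
      covVal α β γ δ (vpar L p) (rpar L p) ^ 2 +
      discVal α β γ δ * cubicVal α β γ δ (vpar L p) (rpar L p) ^ 2 = 0 := by
    simp only [hessVal, covVal, discVal, cubicVal]
    ring
  obtain ⟨s, u₁, u₂, hs, h1, h2, h12⟩ := exists_cardano_roots e
  have h2d : d (2⁻¹ : L) = 0 := by
    have : (2⁻¹ : L) = algebraMap ℂ L 2⁻¹ := by rw [map_inv₀, map_ofNat]
    rw [this, Derivation.map_algebraMap]
  have ds : d s = 0 := der_eq_zero_of_pow d two_ne_zero (by rw [hs, map_neg, hc.discVal, neg_zero])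
  have dj := hc.covVal (hd.vpar p) (hd.rpar p)
  have df := hc.cubicVal (hd.vpar p) (hd.rpar p)
  refine ⟨_, _, _, _, s, u₁, u₂, hr.disc, hr.cubicCov₁ hop, hr.f₁ hop, hr.hessian₁ hop, hs, h1, h2,
    h12, ds, der_eq_zero_of_pow d three_ne_zero ?_, der_eq_zero_of_pow d three_ne_zero ?_⟩
  · rw [h1, div_eq_mul_inv, Derivation.leibniz, map_add, Derivation.leibniz, ds, dj, df, h2d]
    simp
  · rw [h2, div_eq_mul_inv, Derivation.leibniz, map_sub, Derivation.leibniz, ds, dj, df, h2d]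
    simp

/-- A Cardano extension in a division ring with an action, from central radicals. -/
theorem CubicForm.exists_isCardanoExtension_of_central {f : CubicForm h o p}
    (hq : IsQuotientDivisionRing ι) {D : Type u} [DivisionRing D] [Algebra ℂ D] {κ : Q →ₐ[ℂ] D}
    (act : ExtendedAction (κ.comp ι)) {s u₁ u₂ : D} (cs : ∀ r, s * r = r * s)
    (c₁ : ∀ r, u₁ * r = r * u₁) (c₂ : ∀ r, u₂ * r = r * u₂) (hs : s ^ 2 = -κ (ι f.disc))
    (h₁ : u₁ ^ 3 = (1 / 2 : ℂ) • (κ (ι f.cubicCov₁) + κ (ι f.f₁) * s))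
    (h₂ : u₂ ^ 3 = (1 / 2 : ℂ) • (κ (ι f.cubicCov₁) - κ (ι f.f₁) * s))
    (h₁₂ : u₁ * u₂ = -κ (ι f.hessian₁)) (is : act.IsInvariant s) (i₁ : act.IsInvariant u₁)
    (i₂ : act.IsInvariant u₂) :
    ∃ (R : Type u) (_ : DivisionRing R) (_ : Algebra ℂ R) (κ : Q →ₐ[ℂ] R) (s u₁ u₂ : R),
      IsCardanoExtension f ι κ s u₁ u₂ ∧ ∃ act : ExtendedAction (κ.comp ι),
        act.IsInvariant s ∧ act.IsInvariant u₁ ∧ act.IsInvariant u₂ := by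
  have hκ : ∀ q, κ q ∈ Algebra.adjoin ℂ (Set.range κ) := fun q => Algebra.subset_adjoin ⟨q, rfl⟩
  have i0 : ∀ a ∈ Algebra.adjoin ℂ (Set.range κ), a⁻¹ ∈ Algebra.adjoin ℂ (Set.range κ) := by
    have : Algebra.adjoin ℂ (Set.range κ) = κ.range := by
      rw [← AlgHom.coe_range, Algebra.adjoin_eq]
    rw [this]
    rintro _ ⟨z, rfl⟩
    exact ⟨z⁻¹, map_inv₀ _ _⟩
  -- The elements `s`, `u₁`, `u₂` are adjoined one at a time; each is central, with its square or
  -- cube in the division subalgebra obtained before.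
  have k1 := inv_mem_adjoin_insert i0 cs two_ne_zero (by rw [hs]; exact neg_mem (hκ _))
  have hκ1 : ∀ q, κ q ∈ Algebra.adjoin ℂ (insert s (Set.range κ)) := fun q =>
    Algebra.subset_adjoin (Or.inr ⟨q, rfl⟩)
  have hs1 : s ∈ Algebra.adjoin ℂ (insert s (Set.range κ)) := Algebra.subset_adjoin (Or.inl rfl)
  have k2 := inv_mem_adjoin_insert k1 c₁ three_ne_zero (by
    rw [h₁]
    exact Subalgebra.smul_mem _ (add_mem (hκ1 _) (mul_mem (hκ1 _) hs1)) _)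
  have k3 := inv_mem_adjoin_insert k2 c₂ three_ne_zero (by
    rw [h₂]
    exact Algebra.adjoin_mono (Set.subset_insert _ _)
      (Subalgebra.smul_mem _ (sub_mem (hκ1 _) (mul_mem (hκ1 _) hs1)) _))
  set A : Set D := insert u₂ (insert u₁ (insert s (Set.range κ))) with hA
  obtain ⟨R, _, _, j, hj⟩ := exists_divisionRing _ k3
  have hji : Function.Injective j := j.toRingHom.injective
  have hsub : ∀ a ∈ A, ∃ r, j r = a := fun a ha => by
    have : a ∈ j.range := by rw [hj]; exact Algebra.subset_adjoin ha
    exact this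
  obtain ⟨s', hs'⟩ := hsub s (Or.inr (Or.inr (Or.inl rfl)))
  obtain ⟨u₁', hu₁⟩ := hsub u₁ (Or.inr (Or.inl rfl))
  obtain ⟨u₂', hu₂⟩ := hsub u₂ (Or.inl rfl)
  have hκA : ∀ q, κ q ∈ j.range := fun q => hsub _ (Or.inr (Or.inr (Or.inr ⟨q, rfl⟩)))
  let e := AlgEquiv.ofInjective j hji
  let κ' : Q →ₐ[ℂ] R := e.symm.toAlgHom.comp (κ.codRestrict j.range hκA)
  have hκ' : ∀ q, j (κ' q) = κ q := fun q =>
    congrArg Subtype.val (e.apply_symm_apply ⟨κ q, hκA q⟩)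
  have hcen : ∀ {c : R}, (∀ r, j c * r = r * j c) → c ∈ Subalgebra.center ℂ R := fun hc =>
    Subalgebra.mem_center_iff.mpr fun r => hji (by rw [map_mul, map_mul, hc])
  have himg : j '' (Set.range κ' ∪ {s', u₁', u₂'}) = A := by
    rw [Set.image_union, ← Set.range_comp, Set.image_insert_eq, Set.image_pair, hs', hu₁, hu₂,
      show j ∘ κ' = κ from funext hκ', hA]
    ext z
    simp only [Set.mem_union, Set.mem_insert_iff, Set.mem_singleton_iff]
    tauto
  have inv : ∀ a ∈ A, act.E a ∈ Algebra.adjoin ℂ A ∧ act.F a ∈ Algebra.adjoin ℂ A ∧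
      act.H a ∈ Algebra.adjoin ℂ A ∧ act.T a ∈ Algebra.adjoin ℂ A ∧
      act.T.symm a ∈ Algebra.adjoin ℂ A := by
    have key : ∀ a ∈ A, act.IsInvariant a → act.E a ∈ Algebra.adjoin ℂ A ∧
        act.F a ∈ Algebra.adjoin ℂ A ∧ act.H a ∈ Algebra.adjoin ℂ A ∧
        act.T a ∈ Algebra.adjoin ℂ A ∧ act.T.symm a ∈ Algebra.adjoin ℂ A := fun a ha hi => by
      have hTs : act.T.symm a = a := by rw [AlgEquiv.symm_apply_eq, hi.2.2.2]
      rw [hi.1, hi.2.1, hi.2.2.1, hi.2.2.2, hTs]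
      exact ⟨zero_mem _, zero_mem _, zero_mem _, Algebra.subset_adjoin ha,
        Algebra.subset_adjoin ha⟩
    have hle : κ.range ≤ Algebra.adjoin ℂ A := by
      rintro _ ⟨q, rfl⟩
      exact Algebra.subset_adjoin (Or.inr (Or.inr (Or.inr ⟨q, rfl⟩)))
    rintro a (rfl | rfl | rfl | ⟨q, rfl⟩)
    · exact key _ (Or.inl rfl) i₂
    · exact key _ (Or.inr (Or.inl rfl)) i₁
    · exact key _ (Or.inr (Or.inr (Or.inl rfl))) is
    · obtain ⟨m1, m2, m3, m4, m5⟩ := act.map_mem_range hq q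
      exact ⟨hle m1, hle m2, hle m3, hle m4, hle m5⟩
  obtain ⟨act', hact'⟩ := act.exists_restrict j (φ' := κ'.comp ι) (fun a => hκ' (ι a)) hj
    (fun a ha => (inv a ha).1) (fun a ha => (inv a ha).2.1) (fun a ha => (inv a ha).2.2.1)
    (fun a ha => (inv a ha).2.2.2.1) (fun a ha => (inv a ha).2.2.2.2)
  refine ⟨R, inferInstance, inferInstance, κ', s', u₁', u₂',
    ⟨hcen (by rwa [hs']), hcen (by rwa [hu₁]), hcen (by rwa [hu₂]), ?_, hji ?_, hji ?_, hji ?_,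
      hji ?_⟩, act', hact' _ (by rwa [hs']), hact' _ (by rwa [hu₁]), hact' _ (by rwa [hu₂])⟩
  · refine Subalgebra.map_injective hji ?_
    rw [AlgHom.map_adjoin, himg, Algebra.map_top, hj]
  · rw [map_pow, hs', hs, map_neg, hκ']
  · rw [map_pow, hu₁, h₁, map_smul, map_add, map_mul, hκ', hκ', hs']
  · rw [map_pow, hu₂, h₂, map_smul, map_sub, map_mul, hκ', hκ', hs']
  · rw [map_mul, hu₁, hu₂, h₁₂, map_neg, hκ']

/-- The central extension generated by Cardano's radicals, with its action. -/
theorem CubicForm.exists_isCardanoExtension [IsAlgClosed L] (f : CubicForm h o p) (hh : h ≠ 0)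
    (hd : ParDer I d) (hop : o ≠ p) (hq : IsQuotientDivisionRing ι) :
    ∃ (R : Type u) (_ : DivisionRing R) (_ : Algebra ℂ R) (κ : Q →ₐ[ℂ] R) (s u₁ u₂ : R),
      IsCardanoExtension f ι κ s u₁ u₂ ∧ ∃ act : ExtendedAction (κ.comp ι),
        act.IsInvariant s ∧ act.IsInvariant u₁ ∧ act.IsInvariant u₂ := by
  obtain ⟨D₃, j₁, f₁, a, s, u₁, u₂, e1, e2, e3, e4, hs, h1, h2, h12, ds, du₁, du₂⟩ :=
    f.exists_radicals hh hd hop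
  obtain ⟨act, hact⟩ := exists_extendedAction hh hd
  obtain ⟨κ', hκ'⟩ := hq.exists_extension
    (g := (toFrac (ShiftAlg (algebraMap ℂ L h))).comp (gpsi L h I))
    (toFrac_injective.comp (gpsi_injective hd.injective))
  have hcomp : (toFrac (ShiftAlg (algebraMap ℂ L h))).comp (gpsi L h I) = κ'.comp ι :=
    (AlgHom.ext hκ').symm
  have hcomp' : ∀ a, κ' (ι a) = toFrac _ (gpsi L h I a) := hκ'
  clear hκ'
  -- The type of the action depends on the embedding of `H_I`, which is rewritten here as the
  -- composite through `Q`.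
  revert act
  rw [hcomp]
  intro act hact
  have half : ∀ c : L, fracScalar h (c / 2) = (1 / 2 : ℂ) • fracScalar h c := fun c => by
    have : c / 2 = (1 / 2 : ℂ) • c := by
      rw [Algebra.smul_def, map_div₀, map_one, map_ofNat]
      ring
    rw [this, fracScalar, fracScalar, ← map_smul]
    exact congrArg _ (((Algebra.linearMap L (ShiftAlg (algebraMap ℂ L h))).restrictScalars
      ℂ).map_smul _ _)
  have hadd : ∀ a b : L, fracScalar h (a + b) = fracScalar h a + fracScalar h b := fun a b => by
    rw [fracScalar, map_add, map_add]; rfl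
  have hsub : ∀ a b : L, fracScalar h (a - b) = fracScalar h a - fracScalar h b := fun a b => by
    rw [fracScalar, map_sub, map_sub]; rfl
  have hmul : ∀ a b : L, fracScalar h (a * b) = fracScalar h a * fracScalar h b := fun a b => by
    rw [fracScalar, map_mul, map_mul]; rfl
  have hneg : ∀ a : L, fracScalar h (-a) = -fracScalar h a := fun a => by
    rw [fracScalar, map_neg, map_neg]; rfl
  have hpow : ∀ (a : L) n, fracScalar h (a ^ n) = fracScalar h a ^ n := fun a n => by
    rw [fracScalar, map_pow, map_pow]; rfl
  have e1' : κ' (ι f.disc) = fracScalar h D₃ := by rw [hcomp', e1]; rfl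
  have e2' : κ' (ι f.cubicCov₁) = fracScalar h j₁ := by rw [hcomp', e2]; rfl
  have e3' : κ' (ι f.f₁) = fracScalar h f₁ := by rw [hcomp', e3]; rfl
  have e4' : κ' (ι f.hessian₁) = fracScalar h a := by rw [hcomp', e4]; rfl
  refine CubicForm.exists_isCardanoExtension_of_central (f := f) hq act (fracScalar_comm s)
    (fracScalar_comm u₁) (fracScalar_comm u₂) ?_ ?_ ?_ ?_ (hact s ds) (hact u₁ du₁) (hact u₂ du₂)
  · rw [e1', ← hneg, ← hpow, hs]
  · rw [e2', e3', ← hpow, h1, half, hadd, hmul]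
  · rw [e2', e3', ← hpow, h2, half, hsub, hmul]
  · rw [e4', ← hneg, ← hmul, h12]

end Existence

end NCForms



end

theorem mainTheorem4 {I : Type u} [LinearOrder I] (h : ℂ) (hh : h ≠ 0) (o p : I) (hop : o ≠ p)
    (f : NCForms.CubicForm h o p) :
    -- `Δ`, `j`, `d₃` are covariants and an invariant, with the syzygy
    (NCForms.IsInvariant f.hessian ∧ NCForms.IsInvariant f.cubicCov ∧
      NCForms.IsInvariant f.disc ∧
      4 * f.hessian ^ 3 + f.cubicCov ^ 2 + f.disc * f.form ^ 2 = 0) ∧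
    -- `f₁ ≠ 0` is an invariant not involving `x`, `y`; `ξ`, `η` are linear forms
    (f.f₁ ≠ 0 ∧ f.f₁ ∈ NCForms.sub h {o}ᶜ ∧ NCForms.IsInvariant f.f₁ ∧
      NCForms.IsInvariant f.xi ∧ NCForms.IsInvariant f.eta ∧
      NCForms.polar 3 p o f.f₁ = f.xi ∧
      f.xi = NCForms.x o * f.delta - NCForms.y o * f.gamma
        - h • (NCForms.y o * f.delta)) ∧
    -- the typical representation
    (f.form * f.f₁ ^ 2 = f.xi ^ 3 + 3 * f.hessian₁ * f.eta ^ 2 * f.xi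
        - f.cubicCov₁ * f.eta ^ 3) ∧
    -- `H_I` has a right quotient division ring
    (∃ (Q : Type u) (_ : DivisionRing Q) (_ : Algebra ℂ Q) (ι : NCForms.HAlg h I →ₐ[ℂ] Q),
      NCForms.IsQuotientDivisionRing ι) ∧
    ∀ (Q : Type u) [DivisionRing Q] [Algebra ℂ Q] (ι : NCForms.HAlg h I →ₐ[ℂ] Q),
      NCForms.IsQuotientDivisionRing ι →
      -- the central skew field extension exists, with an action for which `s, u₁, u₂` are invariant
      (∃ (R : Type u) (_ : DivisionRing R) (_ : Algebra ℂ R) (κ : Q →ₐ[ℂ] R) (s u₁ u₂ : R),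
        NCForms.IsCardanoExtension f ι κ s u₁ u₂ ∧
        ∃ act : NCForms.ExtendedAction (κ.comp ι),
          act.IsInvariant s ∧ act.IsInvariant u₁ ∧ act.IsInvariant u₂) ∧
      -- in every such extension, `f` decomposes
      ∀ (R : Type v) [DivisionRing R] [Algebra ℂ R] (κ : Q →ₐ[ℂ] R) (s u₁ u₂ : R),
        NCForms.IsCardanoExtension f ι κ s u₁ u₂ →
        let φ : NCForms.HAlg h I →ₐ[ℂ] R := κ.comp ι
        let σ : ℕ → R := NCForms.sigma u₁ u₂
        let L : ℕ → R := fun i => φ f.xi - σ i * φ f.eta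
        let X : ℕ → R := fun i => φ f.gamma - σ i * φ (NCForms.x p)
        let Y : ℕ → R := fun i => φ f.delta - σ i * φ (NCForms.y p)
        let Z : ℕ → R := fun i => X i * (Y i)⁻¹ + algebraMap ℂ R (h / 2)
        φ f.form = κ ((ι f.f₁ ^ 2)⁻¹) * (L 0 * L 1 * L 2) ∧
        (∀ i, L i ∈ Subalgebra.center ℂ R ∧
          L i = φ (NCForms.x o) * Y i - φ (NCForms.y o) * X i - h • (φ (NCForms.y o) * Y i) ∧
          NCForms.IsZero φ o f.form (X i) (Y i) ∧ Y i ≠ 0) ∧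
        (∀ act : NCForms.ExtendedAction φ,
          act.IsInvariant s → act.IsInvariant u₁ → act.IsInvariant u₂ →
          ∀ i, act.IsInvariant (L i)) ∧
        ∀ X' Y' : R, NCForms.IsZero φ o f.form X' Y' →
          Y' ≠ 0 ∧ ∃ i < 3, X' * Y'⁻¹ + algebraMap ℂ R (h / 2) = Z i := by
  -- One generic realisation, over the algebraic closure of the parameter field, serves for all
  -- parts.
  obtain ⟨d, hd⟩ := NCForms.exists_parDer I
  refine ⟨⟨NCForms.CubicForm.isInvariant_hessian hh hd, NCForms.CubicForm.isInvariant_cubicCov hh hd,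
    NCForms.CubicForm.isInvariant_disc hh hd, NCForms.CubicForm.syzygy hh hd⟩,
    ⟨NCForms.CubicForm.f₁_ne_zero hh hd hop, f.f₁_mem hop, NCForms.CubicForm.isInvariant_f₁ hh hd hop,
      NCForms.CubicForm.isInvariant_xi hh hd hop, NCForms.CubicForm.isInvariant_eta hh hd,
      f.polar_f₁ hop, NCForms.CubicForm.xi_eq_delta_gamma hh hd hop⟩,
    NCForms.CubicForm.typical_representation hh hd hop,
    ⟨_, inferInstance, inferInstance, _, NCForms.isQuotientDivisionRing_toFrac⟩, ?_⟩
  intro Q _ _ ι hq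
  refine ⟨f.exists_isCardanoExtension hh hd hop hq, ?_⟩
  intro R _ _ κ s u₁ u₂ E
  dsimp only
  refine ⟨E.form_eq_prod hh hd hop hq, fun i => ⟨?_, E.factor_eq hh hd hop i,
    E.isZero hh hd hop hq i, E.Y_ne_zero hh hd hop hq i⟩,
    fun act _ h1 h2 i => E.isInvariant_factor hh hd hop hq act h1 h2 i, fun X' Y' H => ?_⟩
  · exact Subalgebra.mem_center_iff.mpr fun r => (E.factor_comm hh hd hop hq i r).symm
  · obtain ⟨hY, i, hi, e⟩ := E.zero_classification hh hd hop hq H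
    exact ⟨hY, i, hi, congrArg (· + _) e⟩
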